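/- Let $d,\nu\ge 1$ and $\mathbb T^\nu=(\mathbb R/\mathbb Z)^\nu$. Let $\|x\|=|x_1|+\dots+|x_d|$ on $\mathbb Z^d$ (the graph metric), and use the supremum norm on $\mathbb R^\nu$. Let $W:(2\pi\mathbb Z)^\nu\to(0,\infty)$ satisfy $$c\,\|\ell\|^{\nu+\delta}\le W(\ell)\le C e^{C\|\ell\|^{\zeta}},\qquad \ell\in(2\pi\mathbb Z)^\nu,$$ for some $\zeta,\delta,C,c>0$. Let $\alpha$ be a real $\nu\times d$ matrix such that, for some $A>0$ and $c'>0$, $$\operatorname{dist}(\alpha x,\mathbb Z^\nu)\ge c'\|x\|^{-A},\qquad x\in\mathbb Z^d\setminus\{0\}.$$ Assume that $(A+1)\zeta<1$. On a probability space $(\Theta,\mathcal B^\Theta,\mathbb P^\Theta)$ let $g_\ell,h_\ell$ ($\ell\in(2\pi\mathbb Z)^\nu$) be jointly independent standard Gaussian random variables, and consider the stationary Gaussian process $$v(\omega,\theta)=\sum_{\ell\in(2\pi\mathbb Z)^\nu}\frac{g_\ell(\theta)\cos\langle\omega,\ell\rangle+h_\ell(\theta)\sin\langle\omega,\ell\rangle}{\sqrt{W(\ell)}},\qquad\omega\in\mathbb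 T^\nu,$$ where for each $\omega$ the series converges in mean square. This process has a version with continuous realisations. For any such version $v$, and for $\omega\in\mathbb T^\nu$, $\theta\in\Theta$ and $g>0$, let $H(\omega,\theta;g)$ be the operator on $\ell_2(\mathbb Z^d)$ $$(H(\omega,\theta;g)f)(x)=\sum_{\|y-x\|=1}f(y)+g\,v(\omega+\alpha x,\theta)f(x).$$ Then there is a map $\Theta^+:(0,\infty)\to\mathcal B^\Theta$ with $\mathbb P^\Theta(\Theta^+(g))\to1$ as $g\to+\infty$, such that for every $g>0$, every $\theta\in\Theta^+(g)$ and almost every $\omega\in\mathbb T^\nu$, the spectrum of $H(\omega,\theta;g)$ is pure point (that is, the eigenfunctions span a dense subspace of $\ell_2(\mathbb Z^d)$), and every eigenfunction $\psi$ of $H(\omega,\theta;g)$ satisfies $$\sup_{x\in\mathbb Z^d}|\psi(x)|e^{\|x\|}<\infty.$$ -/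

import Mathlib

open Filter MeasureTheory ProbabilityTheory Topology
open scoped ENNReal

noncomputable section

namespace QPLoc

/-- The Hilbert space `ℓ₂(ℤ^d)` of square-summable complex functions on the lattice. -/
abbrev Ell2 (d : ℕ) : Type := lp (fun _ : Fin d → ℤ => ℂ) 2

/-- The graph metric norm `‖x‖ = |x₁| + ... + |x_d|` on `ℤ^d`. -/
def latticeNorm {d : ℕ} (x : Fin d → ℤ) : ℝ := ∑ j, |(x j : ℝ)|

/-- The vector `α x ∈ ℝ^ν`, for a `ν × d` matrix `α` and `x ∈ ℤ^d`. -/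
def freqVec {ν d : ℕ} (α : Matrix (Fin ν) (Fin d) ℝ) (x : Fin d → ℤ) : Fin ν → ℝ :=
  α.mulVec (fun j => (x j : ℝ))

/-- The Diophantine condition `dist (α x, ℤ^ν) ≥ c ‖x‖^{-A}` for all nonzero `x ∈ ℤ^d`
(`ℝ^ν` with the supremum distance). -/
def IsDiophantine {ν d : ℕ} (α : Matrix (Fin ν) (Fin d) ℝ) (c A : ℝ) : Prop :=
  ∀ x : Fin d → ℤ, x ≠ 0 →
    c * latticeNorm x ^ (-A) ≤
      Metric.infDist (freqVec α x) (Set.range fun (k : Fin ν → ℤ) (i : Fin ν) => (k i : ℝ))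

/-- The point `ω + α x` of the torus `𝕋^ν = (ℝ/ℤ)^ν`. -/
def orbit {ν d : ℕ} (α : Matrix (Fin ν) (Fin d) ℝ) (ω : UnitAddTorus (Fin ν))
    (x : Fin d → ℤ) : UnitAddTorus (Fin ν) :=
  fun i => ω i + ((freqVec α x i : ℝ) : UnitAddCircle)

/-! ### The random hull function -/

/-- The point `ℓ = 2π k` of the dual lattice `(2πℤ)^ν`, as a vector of `ℝ^ν` (supremum norm).
The dual lattice is parametrised by `k ∈ ℤ^ν` throughout. -/
def dualPoint {ν : ℕ} (k : Fin ν → ℤ) : Fin ν → ℝ := fun i => 2 * Real.pi * (k i : ℝ)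

/-- `mFourier k` is the character `ω ↦ e^{i⟨ω, ℓ⟩}` of the torus, where `ℓ = 2π k`. -/
theorem mFourier_eq_exp {ν : ℕ} (k : Fin ν → ℤ) (t : Fin ν → ℝ) :
    UnitAddTorus.mFourier k (fun i => (t i : UnitAddCircle)) =
      Complex.exp (((∑ i, t i * dualPoint k i : ℝ) : ℂ) * Complex.I) := by
  simp only [UnitAddTorus.mFourier, ContinuousMap.coe_mk, fourier_coe_apply, dualPoint]
  rw [← Complex.exp_sum]
  congr 1
  push_cast
  rw [Finset.sum_mul]
  refine Finset.sum_congr rfl fun i _ => ?_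
  ring

/-- The random variable `(γ_ℓ cos⟨ω, ℓ⟩ + h_ℓ sin⟨ω, ℓ⟩) / √W(ℓ)`, where `ℓ = 2π k`. The cosine
and the sine are the real and imaginary parts of the character `e^{i⟨ω, ℓ⟩}` of the torus. -/
def seriesTerm {ν : ℕ} {Θ : Type*} (W : (Fin ν → ℤ) → ℝ) (γ h : (Fin ν → ℤ) → Θ → ℝ)
    (ω : UnitAddTorus (Fin ν)) (k : Fin ν → ℤ) (θ : Θ) : ℝ :=
  (γ k θ * (UnitAddTorus.mFourier k ω).re + h k θ * (UnitAddTorus.mFourier k ω).im) /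
    Real.sqrt (W k)

/-- All the variables `γ_ℓ`, `h_ℓ` together are independent standard Gaussian variables. -/
structure IsStdGaussianFamily {ι Θ : Type*} [MeasurableSpace Θ] (P : Measure Θ)
    (γ h : ι → Θ → ℝ) : Prop where
  law_left : ∀ k, HasLaw (γ k) (gaussianReal 0 1) P
  law_right : ∀ k, HasLaw (h k) (gaussianReal 0 1) P
  indep : iIndepFun (fun s : ι ⊕ ι => Sum.elim γ h s) P

/-- `v` is a version with continuous realisations of the process
`v(ω) = ∑_ℓ (γ_ℓ cos⟨ω, ℓ⟩ + h_ℓ sin⟨ω, ℓ⟩) / √W(ℓ)`: for each `ω`, `v(ω)` is a random variable,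
equal to the sum of the series (unordered, in mean square). -/
structure IsContinuousVersion {ν : ℕ} {Θ : Type*} [MeasurableSpace Θ] (P : Measure Θ)
    (W : (Fin ν → ℤ) → ℝ) (γ h : (Fin ν → ℤ) → Θ → ℝ)
    (v : Θ → C(UnitAddTorus (Fin ν), ℝ)) : Prop where
  measurable : ∀ ω, Measurable fun θ => v θ ω
  sum : ∀ ω, Tendsto
    (fun F : Finset (Fin ν → ℤ) =>
      eLpNorm (fun θ => ∑ k ∈ F, seriesTerm W γ h ω k θ - v θ ω) 2 P) atTop (𝓝 0)

/-! ### The Schrödinger operator -/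

theorem memlp_shift {d : ℕ} (a : Fin d → ℤ) (f : Ell2 d) :
    Memℓp (fun x => f (x + a)) 2 := by
  have h := (memℓp_gen_iff (by norm_num : 0 < (2 : ℝ≥0∞).toReal)).1 (lp.memℓp f)
  exact (memℓp_gen_iff (by norm_num : 0 < (2 : ℝ≥0∞).toReal)).2
    ((Equiv.addRight a).summable_iff.2 h)

/-- The translation `(S_a f)(x) = f(x + a)` on `ℓ₂(ℤ^d)`. -/
def shiftOp {d : ℕ} (a : Fin d → ℤ) : Ell2 d →L[ℂ] Ell2 d :=
  LinearMap.mkContinuous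
    { toFun := fun f => ⟨fun x => f (x + a), memlp_shift a f⟩
      map_add' := fun _ _ => rfl
      map_smul' := fun _ _ => rfl } 1 (by
    intro f
    rw [one_mul]
    have h2 : 0 < (2 : ℝ≥0∞).toReal := by norm_num
    rw [lp.norm_eq_tsum_rpow h2, lp.norm_eq_tsum_rpow h2]
    exact le_of_eq (congrArg (fun t : ℝ => t ^ (1 / (2 : ℝ≥0∞).toReal))
      ((Equiv.addRight a).tsum_eq fun x => ‖f x‖ ^ (2 : ℝ≥0∞).toReal)))

theorem norm_potential_mul_le {ν d : ℕ} (u : C(UnitAddTorus (Fin ν), ℝ))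
    (p : (Fin d → ℤ) → UnitAddTorus (Fin ν)) (f : Ell2 d) (x : Fin d → ℤ) :
    ‖(u (p x) : ℂ) * f x‖ ≤ ‖((‖u‖ : ℂ) • f) x‖ := by
  rw [lp.coeFn_smul, Pi.smul_apply, smul_eq_mul, norm_mul, norm_mul]
  refine mul_le_mul_of_nonneg_right ?_ (norm_nonneg _)
  rw [Complex.norm_real, Complex.norm_real, norm_norm]
  exact u.norm_coe_le_norm _

theorem memlp_potential_mul {ν d : ℕ} (u : C(UnitAddTorus (Fin ν), ℝ))
    (p : (Fin d → ℤ) → UnitAddTorus (Fin ν)) (f : Ell2 d) :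
    Memℓp (fun x => (u (p x) : ℂ) * f x) 2 := by
  have h2 : 0 < (2 : ℝ≥0∞).toReal := by norm_num
  have h := (memℓp_gen_iff h2).1 (lp.memℓp ((‖u‖ : ℂ) • f))
  exact (memℓp_gen_iff h2).2 (Summable.of_nonneg_of_le (fun x => by positivity)
    (fun x => Real.rpow_le_rpow (norm_nonneg _) (norm_potential_mul_le u p f x) h2.le) h)

/-- Multiplication by the potential `x ↦ u (p x)` on `ℓ₂(ℤ^d)`. -/
def potentialOp {ν d : ℕ} (u : C(UnitAddTorus (Fin ν), ℝ))
    (p : (Fin d → ℤ) → UnitAddTorus (Fin ν)) : Ell2 d →L[ℂ] Ell2 d :=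
  LinearMap.mkContinuous
    { toFun := fun f => ⟨fun x => (u (p x) : ℂ) * f x, memlp_potential_mul u p f⟩
      map_add' := fun f g => by
        ext x
        exact mul_add _ _ _
      map_smul' := fun c f => by
        ext x
        exact mul_left_comm _ _ _ } ‖u‖ (by
    intro f
    have h2 : 0 < (2 : ℝ≥0∞).toReal := by norm_num
    have h3 : ‖(‖u‖ : ℂ) • f‖ = ‖u‖ * ‖f‖ := by
      rw [norm_smul, Complex.norm_real, norm_norm]
    rw [← h3, lp.norm_eq_tsum_rpow h2, lp.norm_eq_tsum_rpow h2]
    refine Real.rpow_le_rpow (tsum_nonneg fun x => by positivity) ?_ (by norm_num)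
    refine Summable.tsum_le_tsum
      (fun x => Real.rpow_le_rpow (norm_nonneg _) (norm_potential_mul_le u p f x) h2.le)
      ((memℓp_gen_iff h2).1 (memlp_potential_mul u p f))
      ((memℓp_gen_iff h2).1 (lp.memℓp ((‖u‖ : ℂ) • f))))

/-- The quasi-periodic Schrödinger operator on `ℓ₂(ℤ^d)` with hull function `u`, frequency matrix
`α`, initial point `ω` and coupling `g`. The neighbours of `x` are the points `x ± e_j`. -/
def schrodinger {ν d : ℕ} (α : Matrix (Fin ν) (Fin d) ℝ) (u : C(UnitAddTorus (Fin ν), ℝ))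
    (ω : UnitAddTorus (Fin ν)) (g : ℝ) : Ell2 d →L[ℂ] Ell2 d :=
  (∑ j : Fin d, (shiftOp (Pi.single j 1) + shiftOp (-Pi.single j 1))) +
    (g : ℂ) • potentialOp u (orbit α ω)

/-- The formula `(H f)(x) = ∑_{‖y - x‖ = 1} f(y) + g u(ω + α x) f(x)`. -/
theorem schrodinger_apply {ν d : ℕ} (α : Matrix (Fin ν) (Fin d) ℝ)
    (u : C(UnitAddTorus (Fin ν), ℝ)) (ω : UnitAddTorus (Fin ν)) (g : ℝ) (f : Ell2 d)
    (x : Fin d → ℤ) :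
    schrodinger α u ω g f x =
      (∑ j : Fin d, (f (x + Pi.single j 1) + f (x - Pi.single j 1))) +
        (g : ℂ) * (u (orbit α ω x) : ℂ) * f x := by
  have h1 : ∀ a : Fin d → ℤ, shiftOp a f x = f (x + a) := fun _ => rfl
  have h2 : potentialOp u (orbit α ω) f x = (u (orbit α ω x) : ℂ) * f x := rfl
  rw [mul_assoc]
  simp only [schrodinger, _root_.add_apply, _root_.smul_apply,
    _root_.sum_apply, lp.coeFn_add, lp.coeFn_smul, lp.coeFn_sum, Pi.add_apply,
    Pi.smul_apply, Finset.sum_apply, smul_eq_mul, h1, h2, sub_eq_add_neg]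

/-- The spectrum of a bounded self-adjoint operator is pure point: its eigenvectors span a dense
subspace. -/
def HasPurePointSpectrum {d : ℕ} (H : Ell2 d →L[ℂ] Ell2 d) : Prop :=
  (⨆ E : ℂ, Module.End.eigenspace (H : Ell2 d →ₗ[ℂ] Ell2 d) E).topologicalClosure = ⊤

/-- Every eigenfunction `ψ` satisfies `sup_x |ψ(x)| e^{‖x‖} < ∞`. -/
def EigenfunctionsDecay {d : ℕ} (H : Ell2 d →L[ℂ] Ell2 d) : Prop :=
  ∀ (E : ℂ) (ψ : Ell2 d), Module.End.HasEigenvector (H : Ell2 d →ₗ[ℂ] Ell2 d) E ψ →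
    BddAbove (Set.range fun x : Fin d → ℤ => ‖ψ x‖ * Real.exp (latticeNorm x))

end QPLoc

end

/-! A finite set is resonant at `E` if the operator restricted to it has an eigenvalue close to `E`.
The proof is a multiscale analysis whose only probabilistic input is control of how many disjoint
rectangles in a box can resonate at one common energy. No energy is fixed in advance or excluded.

Deterministic part. A point is nonsingular at scale `ℓ` if solutions near it are smaller there, by a
factor `q`, than on the surrounding box. When a box has few separated singular points and its
concentric subboxes are not resonant, this gain can be iterated through concentric shells; all but
`2J` shells contribute, and the centre is nonsingular at the larger scale (`nonsingular_step`).
Hence, if at most `J` disjoint rectangles ever resonate together, each singular point has a resonant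
rectangle nearby (`ScaleSeq.exists_resonant`). If in addition pairs are excluded around `x₀` at all
large scales, a solution for which `x₀` is singular at those scales meets only nonsingular points at
intermediate distances, and decays (`ScaleSeq.norm_le_exp`). An eigenfunction with `ψ x₀ ≠ 0` is of
this kind. Completeness (`apply_eq_zero_of_orthogonal`) avoids generalised eigenfunctions: `f x₀` is
expanded in eigenbases of growing boxes. Eigenfunctions for which `x₀` is nonsingular have little
weight at `x₀`; the others decay uniformly and are bounded in number, and their limits are true
eigenfunctions, to which `f` is orthogonal.

Resonances at a fixed point of the torus. If the covariance matrix of the potential on a box is at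
least `lam`, its values split as an independent vector plus a Gaussian multiple of the indicator of
any chosen set (`exists_indep_shift`). Moving the potential on one of `J + 1` disjoint sets shifts
its spectrum and leaves the others alone, so a simultaneous resonance costs a factor `ε / g` for
each set but one (`measure_resonant_le`). The Diophantine condition separates the orbit points in a
box of radius `M` by a power `M ^ (-A)`, so a frequency of size `M ^ (A + 1)` distinguishes them,
and the upper bound on the weight gives `lam ≥ exp (-K M ^ b)` with `b = (A + 1) ζ`
(`exists_exp_mul_sq_le_variance`). Since `b < 1`, this loss is subexponential.

Uniformity on the torus. The lower bound on the weight gives, by chaining over nets, a continuous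
version with a power modulus of continuity outside a small event. Multiple resonances are then
excluded on a net: for large `J` the power `(ε / g) ^ J` beats the number of net points
(`exists_noResonance_uniform`). Pairs have too little decay for that, so they are excluded only for
almost every `ω`, by Fubini and Borel–Cantelli (`ae_eventually_noResonance`). This is where the
exceptional null set of `ω` arises. -/

namespace QPLoc

/-! ### Lattice geometry -/

/-- The supremum distance on `ℤ^d`, with values in `ℕ`. -/
def supDist {d : ℕ} (x y : Fin d → ℤ) : ℕ := Finset.univ.sup fun j => (x j - y j).natAbs

theorem supDist_le {d : ℕ} {x y : Fin d → ℤ} {n : ℕ} :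
    supDist x y ≤ n ↔ ∀ j, (x j - y j).natAbs ≤ n := by
  simp [supDist, Finset.sup_le_iff]

theorem natAbs_le_supDist {d : ℕ} (x y : Fin d → ℤ) (j : Fin d) :
    (x j - y j).natAbs ≤ supDist x y := supDist_le.1 le_rfl j

theorem supDist_comm {d : ℕ} (x y : Fin d → ℤ) : supDist x y = supDist y x := by
  unfold supDist
  congr 1
  ext j
  omega

theorem supDist_triangle {d : ℕ} (x y z : Fin d → ℤ) :
    supDist x z ≤ supDist x y + supDist y z := by
  refine supDist_le.2 fun j => ?_
  have h1 := natAbs_le_supDist x y j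
  have h2 := natAbs_le_supDist y z j
  omega

@[simp] theorem supDist_self {d : ℕ} (x : Fin d → ℤ) : supDist x x = 0 := by
  refine Nat.le_zero.1 (supDist_le.2 fun j => by simp)

theorem supDist_add_single {d : ℕ} (x : Fin d → ℤ) (j : Fin d) :
    supDist (x + Pi.single j 1) x ≤ 1 := by
  refine supDist_le.2 fun i => ?_
  rcases eq_or_ne i j with rfl | h
  · simp
  · simp [Pi.single_eq_of_ne h]

theorem supDist_sub_single {d : ℕ} (x : Fin d → ℤ) (j : Fin d) :
    supDist (x - Pi.single j 1) x ≤ 1 := by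
  refine supDist_le.2 fun i => ?_
  rcases eq_or_ne i j with rfl | h
  · simp
  · simp [Pi.single_eq_of_ne h]

/-- The box of radius `r` around `y`. -/
noncomputable def box {d : ℕ} (y : Fin d → ℤ) (r : ℕ) : Finset (Fin d → ℤ) :=
  Finset.Icc (fun j => y j - r) (fun j => y j + r)

theorem mem_box {d : ℕ} {x y : Fin d → ℤ} {r : ℕ} : x ∈ box y r ↔ supDist x y ≤ r := by
  rw [box, Finset.mem_Icc, supDist_le, Pi.le_def, Pi.le_def, ← forall_and]
  refine forall_congr' fun j => ?_
  omega

theorem card_box {d : ℕ} (y : Fin d → ℤ) (r : ℕ) : (box y r).card = (2 * r + 1) ^ d := by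
  rw [box, Pi.card_Icc]
  simp only [Int.card_Icc]
  rw [Finset.prod_congr rfl (g := fun _ => 2 * r + 1) (fun j _ => by omega)]
  simp

/-- A finite subset of the lattice is a rectangle if it is an order interval. -/
def IsRect {d : ℕ} (S : Finset (Fin d → ℤ)) : Prop := ∃ a b, S = Finset.Icc a b

/-- The region `R` meets each box in a rectangle. -/
def RectRegion {d : ℕ} (R : Set (Fin d → ℤ)) : Prop :=
  ∀ (y : Fin d → ℤ) (r : ℕ), ∃ S : Finset (Fin d → ℤ), IsRect S ∧
    ∀ x, x ∈ S ↔ x ∈ R ∧ supDist x y ≤ r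

theorem rectRegion_univ {d : ℕ} : RectRegion (Set.univ : Set (Fin d → ℤ)) := fun y r =>
  ⟨box y r, ⟨_, _, rfl⟩, fun x => by simp [mem_box]⟩

theorem rectRegion_box {d : ℕ} (x₀ : Fin d → ℤ) (N : ℕ) :
    RectRegion (box x₀ N : Set (Fin d → ℤ)) := fun y r => by
  refine ⟨box x₀ N ∩ box y r, ?_, fun x => by simp [mem_box]⟩
  refine ⟨(fun j => x₀ j - N) ⊔ (fun j => y j - r), (fun j => x₀ j + N) ⊓ (fun j => y j + r), ?_⟩
  ext x
  simp only [box, Finset.mem_inter, Finset.mem_Icc, sup_le_iff, le_inf_iff]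
  tauto

/-! ### The operator on functions -/

/-- The discrete Laplacian without diagonal part. -/
noncomputable def hop {d : ℕ} (φ : (Fin d → ℤ) → ℂ) (x : Fin d → ℤ) : ℂ :=
  ∑ j : Fin d, (φ (x + Pi.single j 1) + φ (x - Pi.single j 1))

/-- The Schrödinger operator with potential `V`, acting on all functions. -/
noncomputable def ham {d : ℕ} (V : (Fin d → ℤ) → ℝ) (φ : (Fin d → ℤ) → ℂ) (x : Fin d → ℤ) : ℂ :=
  hop φ x + (V x : ℂ) * φ x

theorem hop_sub {d : ℕ} (φ χ : (Fin d → ℤ) → ℂ) (x : Fin d → ℤ) :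
    hop (fun u => φ u - χ u) x = hop φ x - hop χ x := by
  simp only [hop, ← Finset.sum_sub_distrib]
  exact Finset.sum_congr rfl fun j _ => by ring

theorem norm_hop_le {d : ℕ} {φ : (Fin d → ℤ) → ℂ} {x : Fin d → ℤ} {C : ℝ}
    (h : ∀ u, supDist u x ≤ 1 → ‖φ u‖ ≤ C) : ‖hop φ x‖ ≤ 2 * d * C := by
  calc ‖hop φ x‖ ≤ ∑ j : Fin d, ‖φ (x + Pi.single j 1) + φ (x - Pi.single j 1)‖ := norm_sum_le _ _
    _ ≤ ∑ _j : Fin d, (C + C) := Finset.sum_le_sum fun j _ => (norm_add_le _ _).trans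
        (add_le_add (h _ (supDist_add_single x j)) (h _ (supDist_sub_single x j)))
    _ = 2 * d * C := by simp; ring

/-- The restriction of the operator to `S` has an `ε`-quasimode of energy `E`. -/
def Resonant {d : ℕ} (V : (Fin d → ℤ) → ℝ) (S : Finset (Fin d → ℤ)) (E ε : ℝ) : Prop :=
  ∃ φ : (Fin d → ℤ) → ℂ, (∀ x ∉ S, φ x = 0) ∧
    ∑ x ∈ S, ‖ham V φ x - E * φ x‖ ^ 2 < ε ^ 2 * ∑ x ∈ S, ‖φ x‖ ^ 2

/-- There is no energy at which `J + 1` disjoint rectangles in a box of radius `M` resonate. -/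
def NoResonance {d : ℕ} (V : (Fin d → ℤ) → ℝ) (J M : ℕ) (ε : ℝ) (x₀ : Fin d → ℤ) : Prop :=
  ∀ (E : ℝ) (S : Fin (J + 1) → Finset (Fin d → ℤ)), (∀ i, IsRect (S i)) →
    (∀ i, S i ⊆ box x₀ M) → (∀ i j, i ≠ j → Disjoint (S i) (S j)) → ¬ ∀ i, Resonant V (S i) E ε

/-- Solutions in the part of `R` within distance `ℓ` of `y` are smaller at `y`, by the factor `q`,
than on the box of radius `ℓ + 1`. -/
def Nonsingular {d : ℕ} (V : (Fin d → ℤ) → ℝ) (R : Set (Fin d → ℤ)) (E : ℝ) (ℓ : ℕ) (q : ℝ)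
    (y : Fin d → ℤ) : Prop :=
  ∀ φ : (Fin d → ℤ) → ℂ, (∀ x ∉ R, φ x = 0) →
    (∀ x ∈ R, supDist x y ≤ ℓ → ham V φ x = E * φ x) →
    ∀ C, (∀ u, supDist u y ≤ ℓ + 1 → ‖φ u‖ ≤ C) → ‖φ y‖ ≤ q * C

/-- Truncated to `S`, the function `φ` solves the equation on `S` up to the hopping terms cut off at
distance `r + 1`. In the absence of an `ε`-quasimode the inverse of the restriction of `H - E` is
bounded by `1 / ε` in `ℓ₂`, and the passage from the supremum norm to `ℓ₂` and back costs at most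
the number of sites. -/
theorem norm_le_of_not_resonant {d : ℕ} {V : (Fin d → ℤ) → ℝ} {R : Set (Fin d → ℤ)} {E ε s : ℝ}
    {r : ℕ} {y : Fin d → ℤ} {S : Finset (Fin d → ℤ)} (hε : 0 < ε) (hs : 0 ≤ s)
    (hS : ∀ x, x ∈ S ↔ x ∈ R ∧ supDist x y ≤ r) (hres : ¬ Resonant V S E ε)
    {φ : (Fin d → ℤ) → ℂ} (hφ : ∀ x ∉ R, φ x = 0)
    (hsol : ∀ x ∈ R, supDist x y ≤ r → ham V φ x = E * φ x)
    (hbd : ∀ u ∈ R, supDist u y = r + 1 → ‖φ u‖ ≤ s) :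
    ∀ z, supDist z y ≤ r → ‖φ z‖ ≤ 2 * d * (2 * r + 1) ^ d / ε * s := by
  classical
  intro z hz
  by_cases hzS : z ∈ S
  swap
  · rw [hφ z fun h => hzS ((hS z).2 ⟨h, hz⟩), norm_zero]
    positivity
  have hcard : (S.card : ℝ) ≤ (2 * r + 1) ^ d := by
    have h1 : S ⊆ box y r := fun x hx => mem_box.2 ((hS x).1 hx).2
    have h2 := Finset.card_le_card h1
    rw [card_box] at h2
    exact_mod_cast h2
  have hcard1 : (1 : ℝ) ≤ S.card := by
    exact_mod_cast Finset.card_pos.2 ⟨z, hzS⟩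
  set χ : (Fin d → ℤ) → ℂ := fun x => if x ∈ S then φ x else 0 with hχ
  have key : ∀ x ∈ S, ‖ham V χ x - E * χ x‖ ≤ 2 * d * s := by
    intro x hx
    have hx' := (hS x).1 hx
    have e : ham V χ x - E * χ x = hop (fun u => χ u - φ u) x := by
      have h1 := hsol x hx'.1 hx'.2
      have h2 : χ x = φ x := if_pos hx
      rw [hop_sub]
      simp only [ham] at h1 ⊢
      rw [h2]
      linear_combination h1
    rw [e]
    refine norm_hop_le fun u hu => ?_
    by_cases huS : u ∈ S
    · simp [hχ, huS, hs]
    · by_cases huR : u ∈ R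
      · simp only [hχ, huS, if_false, zero_sub, norm_neg]
        refine hbd u huR ?_
        have h1 := supDist_triangle u x y
        have h2 : ¬ supDist u y ≤ r := fun h => huS ((hS u).2 ⟨huR, h⟩)
        omega
      · simp [hχ, huS, hφ u huR, hs]
  have h1 : ε ^ 2 * ∑ x ∈ S, ‖χ x‖ ^ 2 ≤ ∑ x ∈ S, ‖ham V χ x - E * χ x‖ ^ 2 := by
    by_contra h
    exact hres ⟨χ, fun x hx => if_neg hx, not_le.1 h⟩
  have h2 : ∑ x ∈ S, ‖ham V χ x - E * χ x‖ ^ 2 ≤ S.card * (2 * d * s) ^ 2 := by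
    rw [← nsmul_eq_mul]
    exact Finset.sum_le_card_nsmul _ _ _ fun x hx =>
      pow_le_pow_left₀ (norm_nonneg _) (key x hx) 2
  have h3 : ‖φ z‖ ^ 2 ≤ ∑ x ∈ S, ‖χ x‖ ^ 2 := by
    have : ‖φ z‖ ^ 2 = ‖χ z‖ ^ 2 := by simp [hχ, hzS]
    rw [this]
    exact Finset.single_le_sum (f := fun x => ‖χ x‖ ^ 2) (fun _ _ => by positivity) hzS
  have h4 : (ε * ‖φ z‖) ^ 2 ≤ (S.card * (2 * d * s)) ^ 2 := by
    calc (ε * ‖φ z‖) ^ 2 = ε ^ 2 * ‖φ z‖ ^ 2 := by ring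
      _ ≤ ε ^ 2 * ∑ x ∈ S, ‖χ x‖ ^ 2 := by gcongr
      _ ≤ S.card * (2 * d * s) ^ 2 := h1.trans h2
      _ ≤ S.card ^ 2 * (2 * d * s) ^ 2 := by
          gcongr
          nlinarith
      _ = _ := by ring
  have h5 : ε * ‖φ z‖ ≤ S.card * (2 * d * s) :=
    le_of_sq_le_sq h4 (by positivity)
  rw [div_mul_eq_mul_div, le_div_iff₀ hε]
  calc ‖φ z‖ * ε = ε * ‖φ z‖ := mul_comm _ _
    _ ≤ S.card * (2 * d * s) := h5
    _ ≤ (2 * r + 1) ^ d * (2 * d * s) := by gcongr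
    _ = _ := by ring

/-- A set of indices with more than `2J` elements has `J + 1` elements with gaps at least two. -/
theorem exists_separated_subset {T : Finset ℕ} {J : ℕ} (h : 2 * J < T.card) :
    ∃ T' ⊆ T, J < T'.card ∧ ∀ i ∈ T', ∀ j ∈ T', i < j → i + 2 ≤ j := by
  have h1 := Finset.card_filter_add_card_filter_not (s := T) (fun n => Even n)
  by_cases h2 : J < (T.filter fun n => Even n).card
  · refine ⟨_, Finset.filter_subset _ _, h2, fun i hi j hj hij => ?_⟩
    obtain ⟨a, ha⟩ := (Finset.mem_filter.1 hi).2
    obtain ⟨b, hb⟩ := (Finset.mem_filter.1 hj).2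
    omega
  · refine ⟨_, Finset.filter_subset _ _, (by omega : J < (T.filter fun n => ¬ Even n).card),
      fun i hi j hj hij => ?_⟩
    obtain ⟨a, ha⟩ := Nat.not_even_iff_odd.1 (Finset.mem_filter.1 hi).2
    obtain ⟨b, hb⟩ := Nat.not_even_iff_odd.1 (Finset.mem_filter.1 hj).2
    omega

/-- One step of the multiscale analysis: a point of a region without resonances is nonsingular at
the scale `L` if the box of radius `L` has few clusters of points that are singular at the
scale `ℓ`. -/
theorem nonsingular_step {d : ℕ} {V : (Fin d → ℤ) → ℝ} {R : Set (Fin d → ℤ)} {E ε q : ℝ}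
    {ℓ L J : ℕ} {y : Fin d → ℤ} (hε : 0 < ε) (hq : 0 ≤ q) (hR : RectRegion R)
    (hA : 2 * d * (2 * L + 1) ^ d / ε * q ≤ 1)
    (hres : ∀ r ≤ L, ∀ S : Finset (Fin d → ℤ), IsRect S →
      (∀ x, x ∈ S ↔ x ∈ R ∧ supDist x y ≤ r) → ¬ Resonant V S E ε)
    (hbad : ∀ Z : Finset (Fin d → ℤ), (∀ z ∈ Z, supDist z y ≤ L ∧ ¬ Nonsingular V R E ℓ q z) →
      (∀ z ∈ Z, ∀ w ∈ Z, z ≠ w → 2 * ℓ < supDist z w) → Z.card ≤ J) :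
    Nonsingular V R E L ((2 * d * (2 * L + 1) ^ d / ε * q) ^ (L / (ℓ + 2) - 2 * J)) y := by
  classical
  intro φ hφ hsol C hC
  set A : ℝ := 2 * d * (2 * L + 1) ^ d / ε with hAdef
  have hA0 : 0 ≤ A := by positivity
  have hC0 : 0 ≤ C := (norm_nonneg (φ y)).trans (hC y (by simp))
  set N := L / (ℓ + 2) with hN
  have hNL : N * (ℓ + 2) ≤ L := Nat.div_mul_le_self _ _
  -- The spacing `ℓ + 2` is chosen so that the box of radius `ℓ + 1` around a point at distance `j
  -- (ℓ + 2) + 1` stays within distance `(j + 1) (ℓ + 2)`, where the bound from the previous shell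
  -- is available.
  let good : ℕ → Prop := fun j => ∀ z ∈ R, supDist z y = j * (ℓ + 2) + 1 → Nonsingular V R E ℓ q z
  have iter : ∀ k ≤ N, ∀ z, supDist z y ≤ (N - k) * (ℓ + 2) →
      ‖φ z‖ ≤ (A * q) ^ ((Finset.Ico (N - k) N).filter good).card * C := by
    intro k
    induction k with
    | zero =>
      intro _ z hz
      simpa using hC z (by simp at hz; omega)
    | succ k ih =>
      intro hk z hz
      have ih' := ih (by omega)
      set i := N - (k + 1) with hi
      have hi' : N - k = i + 1 := by omega
      rw [hi'] at ih'
      have hiN : i < N := by omega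
      have hmul : (i + 1) * (ℓ + 2) ≤ N * (ℓ + 2) := Nat.mul_le_mul_right _ hiN
      have hexp : (i + 1) * (ℓ + 2) = i * (ℓ + 2) + ℓ + 2 := by ring
      set c' := ((Finset.Ico (i + 1) N).filter good).card with hc'
      rw [← Finset.insert_Ico_add_one_left_eq_Ico hiN, Finset.filter_insert]
      by_cases hg : good i
      · rw [if_pos hg, Finset.card_insert_of_notMem (by simp)]
        have hb : ∀ u ∈ R, supDist u y = i * (ℓ + 2) + 1 → ‖φ u‖ ≤ q * ((A * q) ^ c' * C) := by
          intro u hu huy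
          refine hg u hu huy φ hφ (fun x hx hxu => hsol x hx ?_) _ fun w hw => ih' w ?_
          · have := supDist_triangle x u y
            omega
          · have := supDist_triangle w u y
            omega
        obtain ⟨S, hS, hS'⟩ := hR y (i * (ℓ + 2))
        have h1 := norm_le_of_not_resonant hε (by positivity) hS'
          (hres _ (by omega) S hS hS') hφ (fun x hx hxy => hsol x hx (by omega)) hb z hz
        refine h1.trans ?_
        rw [pow_succ]
        have h2 : 2 * (d : ℝ) * (2 * ((i * (ℓ + 2) : ℕ) : ℝ) + 1) ^ d / ε ≤ A := by
          rw [hAdef]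
          have : ((i * (ℓ + 2) : ℕ) : ℝ) ≤ L := by exact_mod_cast (by omega)
          gcongr
        calc _ ≤ A * (q * ((A * q) ^ c' * C)) :=
              mul_le_mul_of_nonneg_right h2 (by positivity)
          _ = _ := by ring
      -- A bad shell gives no gain, but also costs nothing: the bound on the larger box is simply
      -- kept, and no factor `1 / ε` is paid.
      · rw [if_neg hg]
        exact ih' z (by omega)
  have hfin := iter N le_rfl y (by simp)
  rw [Nat.sub_self] at hfin
  refine hfin.trans (mul_le_mul_of_nonneg_right (pow_le_pow_of_le_one (by positivity) hA ?_) hC0)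
  set T := (Finset.Ico 0 N).filter fun j => ¬ good j with hT
  -- Each bad shell contains a singular point, and points on shells whose indices differ by at least
  -- two are more than `2ℓ` apart. The factor 2 pays for selecting indices of one parity.
  have hTcard : T.card ≤ 2 * J := by
    by_contra hcon
    obtain ⟨T', hT', hcard, hsep⟩ := exists_separated_subset (not_le.1 hcon)
    have hch : ∀ j ∈ T', ∃ z ∈ R, supDist z y = j * (ℓ + 2) + 1 ∧ ¬ Nonsingular V R E ℓ q z := by
      intro j hj
      have := (Finset.mem_filter.1 (hT' hj)).2
      simp only [good] at this
      push Not at this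
      exact this
    choose! w hwR hwd hws using hch
    have hws_sep : ∀ i ∈ T', ∀ j ∈ T', i < j → 2 * ℓ < supDist (w i) (w j) := by
      intro i hi j hj hij
      have h1 := hsep i hi j hj hij
      have h2 := supDist_triangle (w j) (w i) y
      rw [hwd i hi, hwd j hj, supDist_comm (w j)] at h2
      have h3 : (i + 2) * (ℓ + 2) ≤ j * (ℓ + 2) := Nat.mul_le_mul_right _ h1
      have h4 : (i + 2) * (ℓ + 2) = i * (ℓ + 2) + 2 * ℓ + 4 := by ring
      omega
    have hsep' : ∀ i ∈ T', ∀ j ∈ T', i ≠ j → 2 * ℓ < supDist (w i) (w j) := by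
      intro i hi j hj hij
      rcases lt_or_gt_of_ne hij with h | h
      · exact hws_sep i hi j hj h
      · rw [supDist_comm]
        exact hws_sep j hj i hi h
    have hinj : Set.InjOn w T' := by
      intro i hi j hj hij
      by_contra hne
      have := hsep' i hi j hj hne
      rw [hij] at this
      simp at this
    have h1 := hbad (T'.image w) ?_ ?_
    · rw [Finset.card_image_of_injOn hinj] at h1
      omega
    · intro z hz
      obtain ⟨j, hj, rfl⟩ := Finset.mem_image.1 hz
      refine ⟨?_, hws j hj⟩
      have hjN : j < N := by
        have := (Finset.mem_filter.1 (hT' hj)).1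
        simpa using this
      have h3 : (j + 1) * (ℓ + 2) ≤ N * (ℓ + 2) := Nat.mul_le_mul_right _ hjN
      have h4 : (j + 1) * (ℓ + 2) = j * (ℓ + 2) + ℓ + 2 := by ring
      rw [hwd j hj]
      omega
    · intro z hz z' hz' hne
      obtain ⟨i, hi, rfl⟩ := Finset.mem_image.1 hz
      obtain ⟨j, hj, rfl⟩ := Finset.mem_image.1 hz'
      exact hsep' i hi j hj fun h => hne (by rw [h])
  have h1 := Finset.card_filter_add_card_filter_not (s := Finset.Ico 0 N) good
  rw [Nat.card_Ico] at h1
  have h2 : ((Finset.Ico 0 N).filter fun j => ¬ good j).card ≤ 2 * J := hTcard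
  omega

/-- Base step: a site with a nonresonant single-site operator is nonsingular. -/
theorem nonsingular_zero {d : ℕ} {V : (Fin d → ℤ) → ℝ} {R : Set (Fin d → ℤ)} {E ε : ℝ}
    {y : Fin d → ℤ} (hε : 0 < ε) (hR : RectRegion R)
    (hres : ∀ S : Finset (Fin d → ℤ), IsRect S →
      (∀ x, x ∈ S ↔ x ∈ R ∧ supDist x y ≤ 0) → ¬ Resonant V S E ε) :
    Nonsingular V R E 0 (2 * d / ε) y := by
  intro φ hφ hsol C hC
  obtain ⟨S, hS, hS'⟩ := hR y 0
  have hC0 : 0 ≤ C := (norm_nonneg (φ y)).trans (hC y (by simp))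
  have := norm_le_of_not_resonant hε hC0 hS' (hres S hS hS') hφ hsol
    (fun u _ hu => hC u (by omega)) y (by simp)
  simpa using this

/-! ### The induction over scales -/

/-- Scales, resonance thresholds and decay factors suitable for a multiscale analysis with at most
`J` clusters of singular points in each box. -/
structure ScaleSeq (d J : ℕ) where
  /-- the length scales -/
  L : ℕ → ℕ
  /-- the resonance thresholds -/
  ε : ℕ → ℝ
  /-- the decay factors -/
  q : ℕ → ℝ
  L_zero : L 0 = 0
  L_strictMono : StrictMono L
  ε_pos : ∀ k, 0 < ε k
  q_zero : q 0 = 2 * d / ε 0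
  q_nonneg : ∀ k, 0 ≤ q k
  step_le_one : ∀ k, 2 * d * (2 * L (k + 1) + 1) ^ d / ε (k + 1) * q k ≤ 1
  step_le : ∀ k, (2 * d * (2 * L (k + 1) + 1) ^ d / ε (k + 1) * q k) ^
    (L (k + 1) / (L k + 2) - 2 * J) ≤ q (k + 1)
  -- The 8 compensates for the number of iterations in `ScaleSeq.norm_le_exp`, which is at least an
  -- eighth of the distance divided by the scale. The factor `d` converts supremum distance into the
  -- graph metric, so that the final rate is one.
  q_le : ∀ k, q (k + 1) ≤ Real.exp (-(8 * d * L (k + 1)))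

theorem Nonsingular.mono {d : ℕ} {V : (Fin d → ℤ) → ℝ} {R : Set (Fin d → ℤ)} {E q q' : ℝ} {ℓ : ℕ}
    {y : Fin d → ℤ} (h : Nonsingular V R E ℓ q y) (hq : q ≤ q') : Nonsingular V R E ℓ q' y :=
  fun φ hφ hsol C hC => (h φ hφ hsol C hC).trans
    (mul_le_mul_of_nonneg_right hq ((norm_nonneg (φ y)).trans (hC y (by simp))))

/-- If every singular point has a resonant rectangle nearby, then separated singular points are
as few as disjoint resonant rectangles. -/
theorem card_singular_le {d J M ℓ : ℕ} {V : (Fin d → ℤ) → ℝ} {R : Set (Fin d → ℤ)} {E ε q : ℝ}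
    {x : Fin d → ℤ}
    (hsing : ∀ y, ¬ Nonsingular V R E ℓ q y → ∃ S, IsRect S ∧ S ⊆ box y ℓ ∧ Resonant V S E ε)
    (hV : NoResonance V J (M + ℓ) ε x) (Z : Finset (Fin d → ℤ))
    (hZ : ∀ z ∈ Z, supDist z x ≤ M ∧ ¬ Nonsingular V R E ℓ q z)
    (hsep : ∀ z ∈ Z, ∀ w ∈ Z, z ≠ w → 2 * ℓ < supDist z w) : Z.card ≤ J := by
  by_contra hcon
  obtain ⟨Z', hZ', hcard⟩ := Finset.exists_subset_card_eq (show J + 1 ≤ Z.card by omega)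
  let e := (Z'.equivFinOfCardEq hcard).symm
  have hmem : ∀ i, (e i : Fin d → ℤ) ∈ Z := fun i => hZ' (e i).2
  choose S hS1 hS2 hS3 using fun i => hsing (e i) (hZ _ (hmem i)).2
  refine hV E S hS1 (fun i u hu => ?_) (fun i j hij => ?_) hS3
  · have h1 := mem_box.1 (hS2 i hu)
    have h2 := (hZ _ (hmem i)).1
    have h3 := supDist_triangle u (e i) x
    exact mem_box.2 (by omega)
  · rw [Finset.disjoint_left]
    intro u hu hu'
    have h1 := mem_box.1 (hS2 i hu)
    have h2 := mem_box.1 (hS2 j hu')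
    have hne : (e i : Fin d → ℤ) ≠ e j := fun h => hij (e.injective (Subtype.ext h))
    have h3 := hsep _ (hmem i) _ (hmem j) hne
    have h4 := supDist_triangle (e i : Fin d → ℤ) u (e j)
    rw [supDist_comm _ u] at h4
    omega

/-- A singular point has a resonant rectangle nearby. -/
theorem ScaleSeq.exists_resonant {d J : ℕ} (s : ScaleSeq d J) {V : (Fin d → ℤ) → ℝ}
    {R : Set (Fin d → ℤ)} (hR : RectRegion R)
    (hV : ∀ k x, NoResonance V J (s.L (k + 1) + s.L k) (s.ε k) x) (E : ℝ) (k : ℕ) :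
    ∀ y, ¬ Nonsingular V R E (s.L k) (s.q k) y →
      ∃ S, IsRect S ∧ S ⊆ box y (s.L k) ∧ Resonant V S E (s.ε k) := by
  induction k with
  | zero =>
    intro y hy
    by_contra hcon
    refine hy ?_
    rw [s.q_zero, s.L_zero]
    refine nonsingular_zero (s.ε_pos 0) hR fun S hS hS' hres => hcon ⟨S, hS, fun u hu => ?_, hres⟩
    rw [s.L_zero]
    exact mem_box.2 ((hS' u).1 hu).2
  | succ k ih =>
    intro y hy
    by_contra hcon
    refine hy (Nonsingular.mono (nonsingular_step (J := J) (s.ε_pos _) (s.q_nonneg k) hR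
      (s.step_le_one k) (fun r hr S hS hS' hres => hcon ⟨S, hS, fun u hu => ?_, hres⟩)
      fun Z hZ hsep => card_singular_le ih (hV k y) Z hZ hsep) (s.step_le k))
    exact mem_box.2 (((hS' u).1 hu).2.trans hr)

/-- Bounded solutions decay away from a point at which all large scales are singular. -/
theorem ScaleSeq.norm_le_exp {d J : ℕ} (s : ScaleSeq d J) {V : (Fin d → ℤ) → ℝ}
    {R : Set (Fin d → ℤ)} (hR : RectRegion R)
    (hV : ∀ k x, NoResonance V J (s.L (k + 1) + s.L k) (s.ε k) x) {E C : ℝ} {k₁ : ℕ} (hk₁ : 1 ≤ k₁)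
    {x₀ : Fin d → ℤ} (hV1 : ∀ k ≥ k₁, NoResonance V 1 (8 * s.L (k + 1) + s.L k) (s.ε k) x₀)
    (hsing : ∀ k ≥ k₁, ¬ Nonsingular V R E (s.L k) (s.q k) x₀) {φ : (Fin d → ℤ) → ℂ}
    (hφ : ∀ x ∉ R, φ x = 0) (hsol : ∀ x ∈ R, ham V φ x = E * φ x) (hC : ∀ x, ‖φ x‖ ≤ C)
    {y : Fin d → ℤ} (hy : 4 * s.L k₁ ≤ supDist y x₀) :
    ‖φ y‖ ≤ C * Real.exp (-(d * supDist y x₀)) := by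
  classical
  have hC0 : 0 ≤ C := (norm_nonneg _).trans (hC x₀)
  set r := supDist y x₀ with hr
  -- The scale is adapted to the distance `r`. The iteration below may also move away from `x₀`, by
  -- at most `r` in total, so it stays within `2r < 8 L (k + 1)`, the range in which pairs are
  -- excluded.
  obtain ⟨k, hk, hk1, hk2⟩ : ∃ k, k₁ ≤ k ∧ 4 * s.L k ≤ r ∧ r < 4 * s.L (k + 1) := by
    have hex : ∃ n, r < 4 * s.L n := ⟨r + 1, by have := s.L_strictMono.le_apply (x := r + 1); omega⟩
    have hn := Nat.find_spec hex
    have hlt : k₁ < Nat.find hex := by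
      by_contra h
      have := s.L_strictMono.monotone (not_lt.1 h)
      omega
    obtain ⟨k, hk⟩ : ∃ k, Nat.find hex = k + 1 := ⟨Nat.find hex - 1, by omega⟩
    rw [hk] at hn hlt
    exact ⟨k, by omega, not_lt.1 (Nat.find_min hex (by omega)), hn⟩
  have hL1 : 1 ≤ s.L k := by
    have := s.L_strictMono.le_apply (x := k)
    omega
  -- Since `x₀` is itself singular at scale `L k`, a second singular point at distance more than `2
  -- L k` would produce two disjoint resonant rectangles.
  have hns : ∀ z, 2 * s.L k < supDist z x₀ → supDist z x₀ ≤ 8 * s.L (k + 1) →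
      Nonsingular V R E (s.L k) (s.q k) z := by
    intro z hz1 hz2
    by_contra hz
    have hne : z ≠ x₀ := by
      rintro rfl
      simp at hz1
    have := card_singular_le (s.exists_resonant hR hV E k) (hV1 k hk) {z, x₀} ?_ ?_
    · rw [Finset.card_pair hne] at this
      omega
    · intro w hw
      rcases Finset.mem_insert.1 hw with rfl | hw
      · exact ⟨hz2, hz⟩
      · rw [Finset.mem_singleton.1 hw]
        exact ⟨by simp, hsing k hk⟩
    · intro w hw w' hw' hww
      simp only [Finset.mem_insert, Finset.mem_singleton] at hw hw'
      rcases hw with rfl | rfl <;> rcases hw' with rfl | rfl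
      · exact absurd rfl hww
      · exact hz1
      · rw [supDist_comm]
        exact hz1
      · exact absurd rfl hww
  have iter : ∀ n : ℕ, ∀ z, n * (s.L k + 1) + 2 * s.L k ≤ supDist z x₀ →
      n * (s.L k + 1) + supDist z x₀ ≤ 8 * s.L (k + 1) → ‖φ z‖ ≤ s.q k ^ n * C := by
    intro n
    induction n with
    | zero =>
      intro z _ _
      simpa using hC z
    | succ n ih =>
      intro z hz1 hz2
      rw [add_one_mul] at hz1 hz2
      rw [pow_succ', mul_assoc]
      refine hns z (by omega) (by omega) φ hφ (fun x hx _ => hsol x hx) _ fun u hu => ih u ?_ ?_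
      · have := supDist_triangle z u x₀
        rw [supDist_comm z u] at this
        omega
      · have := supDist_triangle u z x₀
        omega
  set n := (r - 2 * s.L k) / (s.L k + 1) with hn
  have hn1 : n * (s.L k + 1) ≤ r - 2 * s.L k := Nat.div_mul_le_self _ _
  have hn2 : r - 2 * s.L k < n * (s.L k + 1) + (s.L k + 1) := by
    have := Nat.lt_div_mul_add (a := r - 2 * s.L k) (b := s.L k + 1) (by omega)
    omega
  refine (iter n y (by omega) (by omega)).trans ?_
  rw [mul_comm]
  refine mul_le_mul_of_nonneg_left ?_ hC0
  obtain ⟨k', rfl⟩ : ∃ k', k = k' + 1 := ⟨k - 1, by omega⟩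
  refine (pow_le_pow_left₀ (s.q_nonneg _) (s.q_le k') n).trans ?_
  rw [← Real.exp_nat_mul]
  refine Real.exp_le_exp.2 ?_
  -- Because `r ≥ 4 L`, there is at least one iteration, and the remainders `2 L` and `L + 1` are
  -- absorbed in multiples of `n L`.
  have h3 : (r : ℝ) ≤ 8 * (n * s.L (k' + 1)) := by
    have h4 : n ≤ n * s.L (k' + 1) := Nat.le_mul_of_pos_right _ hL1
    rw [mul_add, mul_one] at hn1 hn2
    have : r ≤ 8 * (n * s.L (k' + 1)) := by omega
    exact_mod_cast this
  have hd : (0 : ℝ) ≤ d := Nat.cast_nonneg d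
  nlinarith

/-- A bounded function vanishes at a point which is nonsingular at arbitrarily large scales. -/
theorem ScaleSeq.eventually_singular {d J : ℕ} (s : ScaleSeq d J) (hd : 1 ≤ d)
    {V : (Fin d → ℤ) → ℝ}
    {R : Set (Fin d → ℤ)} {E C : ℝ} {x₀ : Fin d → ℤ} {φ : (Fin d → ℤ) → ℂ}
    (hφ : ∀ x ∉ R, φ x = 0) (hsol : ∀ x ∈ R, ham V φ x = E * φ x) (hC : ∀ x, ‖φ x‖ ≤ C)
    (hx₀ : φ x₀ ≠ 0) : ∀ᶠ k in atTop, ¬ Nonsingular V R E (s.L k) (s.q k) x₀ := by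
  have hL : Tendsto (fun k => (8 * d * s.L k : ℝ)) atTop atTop := by
    refine Tendsto.const_mul_atTop (by positivity) ?_
    exact tendsto_natCast_atTop_atTop.comp s.L_strictMono.tendsto_atTop
  have h0 : Tendsto (fun k => Real.exp (-(8 * d * s.L k)) * C) atTop (𝓝 0) := by
    simpa using (Real.tendsto_exp_neg_atTop_nhds_zero.comp hL).mul_const C
  have h1 := h0.eventually_lt_const (norm_pos_iff.2 hx₀)
  filter_upwards [h1, eventually_ge_atTop 1] with k hk hk1 hns
  obtain ⟨k, rfl⟩ : ∃ k', k = k' + 1 := ⟨k - 1, by omega⟩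
  have h2 := hns φ hφ (fun x hx _ => hsol x hx) C fun u _ => hC u
  have hC0 : 0 ≤ C := (norm_nonneg _).trans (hC x₀)
  have h3 := mul_le_mul_of_nonneg_right (s.q_le k) hC0
  linarith

/-! ### Finite-volume eigenbases -/

theorem ham_single_comm {d : ℕ} (V : (Fin d → ℤ) → ℝ) (x y : Fin d → ℤ) :
    ham V (Pi.single y 1) x = ham V (Pi.single x 1) y := by
  have h1 : ∀ u v : Fin d → ℤ, (Pi.single u (1 : ℂ) : (Fin d → ℤ) → ℂ) v = if v = u then 1 else 0 :=
    fun u v => by simp [Pi.single_apply]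
  unfold ham hop
  congr 1
  · refine Finset.sum_congr rfl fun j _ => ?_
    rw [h1, h1, h1, h1, add_comm]
    congr 1
    · refine if_congr ⟨fun h => ?_, fun h => ?_⟩ rfl rfl
      · rw [← h]; abel
      · rw [← h]; abel
    · refine if_congr ⟨fun h => ?_, fun h => ?_⟩ rfl rfl
      · rw [← h]; abel
      · rw [← h]; abel
  · rw [h1, h1]
    by_cases h : x = y
    · rw [h]
    · rw [if_neg h, if_neg (Ne.symm h)]; simp

theorem ham_single_real {d : ℕ} (V : (Fin d → ℤ) → ℝ) (x y : Fin d → ℤ) :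
    star (ham V (Pi.single y 1) x) = ham V (Pi.single y 1) x := by
  have h1 : ∀ u v : Fin d → ℤ, (Pi.single u (1 : ℂ) : (Fin d → ℤ) → ℂ) v = if v = u then 1 else 0 :=
    fun u v => by simp [Pi.single_apply]
  have h2 : ∀ u v : Fin d → ℤ, star ((Pi.single u (1 : ℂ) : (Fin d → ℤ) → ℂ) v) =
      (Pi.single u (1 : ℂ) : (Fin d → ℤ) → ℂ) v := fun u v => by
    rw [h1]; split_ifs <;> simp
  unfold ham hop
  rw [star_add, star_sum, star_mul']
  simp only [star_add, h2]
  simp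

theorem ham_sum {d : ℕ} {ι : Type*} (V : (Fin d → ℤ) → ℝ) (s : Finset ι) (a : ι → ℂ)
    (φ : ι → (Fin d → ℤ) → ℂ) (x : Fin d → ℤ) :
    ham V (fun u => ∑ i ∈ s, a i * φ i u) x = ∑ i ∈ s, a i * ham V (φ i) x := by
  simp only [ham, hop, mul_add, Finset.mul_sum, Finset.sum_add_distrib]
  congr 1
  · congr 1
    · rw [Finset.sum_comm]
    · rw [Finset.sum_comm]
  · exact Finset.sum_congr rfl fun i _ => by ring

/-- An orthonormal eigenbasis of the restriction of the operator to the finite set `S`. -/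
structure EigenBasis {d : ℕ} (V : (Fin d → ℤ) → ℝ) (S : Finset (Fin d → ℤ)) where
  /-- the eigenfunctions -/
  ψ : S → (Fin d → ℤ) → ℂ
  /-- the eigenvalues -/
  E : S → ℝ
  supp : ∀ j, ∀ x ∉ S, ψ j x = 0
  eigen : ∀ j, ∀ x ∈ S, ham V (ψ j) x = E j * ψ j x
  orth : ∀ i j, ∑ x ∈ S, star (ψ i x) * ψ j x = if i = j then 1 else 0
  complete : ∀ x ∈ S, ∀ y ∈ S, ∑ j, ψ j x * star (ψ j y) = if x = y then 1 else 0

theorem eq_sum_single {d : ℕ} {S : Finset (Fin d → ℤ)} {φ : (Fin d → ℤ) → ℂ}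
    (hφ : ∀ x ∉ S, φ x = 0) :
    φ = fun u => ∑ y : S, φ y * (Pi.single (y : Fin d → ℤ) (1 : ℂ) : (Fin d → ℤ) → ℂ) u := by
  ext u
  simp only [Pi.single_apply, mul_ite, mul_one, mul_zero]
  rw [Finset.sum_coe_sort S fun y => if u = y then φ y else 0]
  by_cases hu : u ∈ S
  · simp [hu]
  · simp [hu, hφ u hu]

/-- This is the spectral theorem for a real symmetric matrix. The eigenvectors are extended by zero,
so that `ham`, with its full hopping, acts on them. -/
theorem nonempty_eigenBasis {d : ℕ} (V : (Fin d → ℤ) → ℝ) (S : Finset (Fin d → ℤ)) :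
    Nonempty (EigenBasis V S) := by
  classical
  let A : Matrix S S ℂ := fun x y => ham V (Pi.single (y : Fin d → ℤ) 1) x
  have hA : A.IsHermitian := by
    ext x y
    change star (ham V (Pi.single (x : Fin d → ℤ) 1) (y : Fin d → ℤ)) =
      ham V (Pi.single (y : Fin d → ℤ) 1) (x : Fin d → ℤ)
    rw [ham_single_real, ham_single_comm]
  let U := hA.eigenvectorBasis
  let ψ : S → (Fin d → ℤ) → ℂ := fun j x => if h : x ∈ S then U j ⟨x, h⟩ else 0
  have hψ : ∀ j (x : S), ψ j x = U j x := fun j x => by simp [ψ]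
  have hsupp : ∀ j, ∀ x ∉ S, ψ j x = 0 := fun j x hx => by simp [ψ, hx]
  have hun := Matrix.mem_unitaryGroup_iff.1 hA.eigenvectorUnitary.2
  have hun' := Matrix.mem_unitaryGroup_iff'.1 hA.eigenvectorUnitary.2
  refine ⟨⟨ψ, hA.eigenvalues, hsupp, fun j x hx => ?_, fun i j => ?_, fun x hx y hy => ?_⟩⟩
  · have h1 := congrFun (hA.mulVec_eigenvectorBasis j) ⟨x, hx⟩
    rw [eq_sum_single (hsupp j), ham_sum]
    simp only [Matrix.mulVec, dotProduct, A] at h1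
    rw [← eq_sum_single (hsupp j), hψ j ⟨x, hx⟩]
    simp only [hψ]
    rw [Finset.sum_congr rfl fun y _ => mul_comm _ _, h1]
    simp [U]
  · have h1 := congrFun (congrFun hun' i) j
    rw [Matrix.mul_apply, Matrix.one_apply] at h1
    rw [← h1, ← Finset.sum_coe_sort S fun x => star (ψ i x) * ψ j x]
    refine Finset.sum_congr rfl fun x _ => ?_
    rw [hψ, hψ, Matrix.star_apply, hA.eigenvectorUnitary_apply, hA.eigenvectorUnitary_apply]
  · have h1 := congrFun (congrFun hun ⟨x, hx⟩) ⟨y, hy⟩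
    rw [Matrix.mul_apply, Matrix.one_apply] at h1
    simp only [Subtype.mk.injEq] at h1
    rw [← h1]
    refine Finset.sum_congr rfl fun j _ => ?_
    rw [hψ j ⟨x, hx⟩, hψ j ⟨y, hy⟩, Matrix.star_apply, hA.eigenvectorUnitary_apply,
      hA.eigenvectorUnitary_apply]

namespace EigenBasis

variable {d : ℕ} {V : (Fin d → ℤ) → ℝ} {S : Finset (Fin d → ℤ)} (b : EigenBasis V S)

/-- The coefficients of a function in the eigenbasis. -/
noncomputable def coeff (φ : (Fin d → ℤ) → ℂ) (j : S) : ℂ := ∑ x ∈ S, star (b.ψ j x) * φ x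

theorem sum_coeff (φ : (Fin d → ℤ) → ℂ) {x : Fin d → ℤ} (hx : x ∈ S) :
    ∑ j, b.coeff φ j * b.ψ j x = φ x := by
  simp only [coeff, Finset.sum_mul]
  rw [Finset.sum_comm]
  have : ∀ y ∈ S, ∑ j, star (b.ψ j y) * φ y * b.ψ j x = if x = y then φ y else 0 := by
    intro y hy
    rw [Finset.sum_congr rfl fun j _ =>
      (show star (b.ψ j y) * φ y * b.ψ j x = b.ψ j x * star (b.ψ j y) * φ y by ring),
      ← Finset.sum_mul, b.complete x hx y hy]
    simp
  rw [Finset.sum_congr rfl this]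
  simp [hx]

theorem sum_norm_sq_combination (a : S → ℂ) :
    ∑ x ∈ S, ‖∑ j, a j * b.ψ j x‖ ^ 2 = ∑ j, ‖a j‖ ^ 2 := by
  have h : ((∑ x ∈ S, ‖∑ j, a j * b.ψ j x‖ ^ 2 : ℝ) : ℂ) = ((∑ j, ‖a j‖ ^ 2 : ℝ) : ℂ) := by
    push_cast
    have e : ∀ z : ℂ, (‖z‖ : ℂ) ^ 2 = star z * z := fun z => (Complex.conj_mul' z).symm
    simp only [e, star_sum, Finset.sum_mul_sum, star_mul']
    rw [Finset.sum_comm]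
    refine Finset.sum_congr rfl fun i _ => ?_
    rw [Finset.sum_comm]
    have : ∀ j, ∑ x ∈ S, star (a i) * star (b.ψ i x) * (a j * b.ψ j x) =
        if i = j then star (a i) * a j else 0 := by
      intro j
      rw [Finset.sum_congr rfl fun x _ =>
        (show star (a i) * star (b.ψ i x) * (a j * b.ψ j x) =
          star (a i) * a j * (star (b.ψ i x) * b.ψ j x) by ring), ← Finset.mul_sum, b.orth]
      split_ifs <;> simp
    rw [Finset.sum_congr rfl fun j _ => this j]
    simp
  exact_mod_cast h

theorem sum_norm_sq_coeff (φ : (Fin d → ℤ) → ℂ) :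
    ∑ j, ‖b.coeff φ j‖ ^ 2 = ∑ x ∈ S, ‖φ x‖ ^ 2 := by
  rw [← b.sum_norm_sq_combination]
  exact Finset.sum_congr rfl fun x hx => by rw [b.sum_coeff φ hx]

theorem sum_norm_sq_eq_one (j : S) : ∑ x ∈ S, ‖b.ψ j x‖ ^ 2 = 1 := by
  have h : ((∑ x ∈ S, ‖b.ψ j x‖ ^ 2 : ℝ) : ℂ) = 1 := by
    push_cast
    have := b.orth j j
    rw [if_pos rfl] at this
    rw [← this]
    exact Finset.sum_congr rfl fun x _ => (Complex.conj_mul' _).symm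
  exact_mod_cast h

theorem sum_norm_sq_apply_le (x : Fin d → ℤ) : ∑ j, ‖b.ψ j x‖ ^ 2 ≤ 1 := by
  by_cases hx : x ∈ S
  · have h : ((∑ j, ‖b.ψ j x‖ ^ 2 : ℝ) : ℂ) = 1 := by
      push_cast
      have := b.complete x hx x hx
      rw [if_pos rfl] at this
      rw [← this]
      exact Finset.sum_congr rfl fun j _ => (Complex.mul_conj' _).symm
    exact (show (∑ j, ‖b.ψ j x‖ ^ 2 : ℝ) = 1 by exact_mod_cast h).le
  · simp [b.supp _ x hx]

theorem norm_apply_le_one (j : S) (x : Fin d → ℤ) : ‖b.ψ j x‖ ≤ 1 := by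
  have h1 : ‖b.ψ j x‖ ^ 2 ≤ 1 :=
    (Finset.single_le_sum (f := fun j => ‖b.ψ j x‖ ^ 2) (fun _ _ => by positivity)
      (Finset.mem_univ j)).trans (b.sum_norm_sq_apply_le x)
  nlinarith [norm_nonneg (b.ψ j x)]

/-- A resonance is an eigenvalue nearby. -/
theorem exists_eigenvalue_of_resonant {E ε : ℝ} (hε : 0 < ε) (h : Resonant V S E ε) :
    ∃ j, |b.E j - E| < ε := by
  obtain ⟨φ, hφ, hlt⟩ := h
  have hφ' : φ = fun u => ∑ j, b.coeff φ j * b.ψ j u := by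
    ext u
    by_cases hu : u ∈ S
    · exact (b.sum_coeff φ hu).symm
    · simp [hφ u hu, b.supp _ u hu]
  have h1 : ∀ x ∈ S, ham V φ x - E * φ x = ∑ j, (b.coeff φ j * (b.E j - E)) * b.ψ j x := by
    intro x hx
    conv_lhs => rw [hφ', ham_sum]
    simp only [Finset.mul_sum, ← Finset.sum_sub_distrib]
    refine Finset.sum_congr rfl fun j _ => ?_
    rw [b.eigen j x hx]
    ring
  rw [Finset.sum_congr rfl fun x hx => by rw [h1 x hx], b.sum_norm_sq_combination,
    ← b.sum_norm_sq_coeff, Finset.mul_sum] at hlt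
  obtain ⟨j, -, hj⟩ := Finset.exists_lt_of_sum_lt hlt
  refine ⟨j, ?_⟩
  rw [norm_mul, mul_pow, mul_comm] at hj
  have h2 := lt_of_mul_lt_mul_right hj (by positivity)
  have h3 : ‖((b.E j : ℂ) - E)‖ = |b.E j - E| := by
    rw [← Complex.ofReal_sub, Complex.norm_real, Real.norm_eq_abs]
  rw [h3] at h2
  exact lt_of_pow_lt_pow_left₀ 2 hε.le h2

end EigenBasis

/-! ### Summation over the lattice -/

/-- The points at distance exactly `n` lie in a box with `(2n + 1) ^ d` points. -/
theorem summable_supDist {d : ℕ} (x₀ : Fin d → ℤ) {F : ℕ → ℝ} (hF : ∀ n, 0 ≤ F n)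
    (hs : Summable fun n : ℕ => (2 * n + 1 : ℝ) ^ d * F n) :
    Summable fun x : Fin d → ℤ => F (supDist x x₀) := by
  classical
  refine summable_of_sum_le (c := ∑' n : ℕ, (2 * n + 1 : ℝ) ^ d * F n) (fun x => hF _) fun s => ?_
  have hmaps : ∀ x ∈ s, supDist x x₀ ∈ s.image fun x => supDist x x₀ := fun x hx =>
    Finset.mem_image_of_mem _ hx
  rw [← Finset.sum_fiberwise_of_maps_to hmaps]
  refine (Finset.sum_le_sum fun n _ => ?_).trans
    (hs.sum_le_tsum (s.image fun x => supDist x x₀) fun n _ => mul_nonneg (by positivity) (hF n))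
  rw [Finset.sum_congr rfl (g := fun _ => F n) fun x hx => by rw [(Finset.mem_filter.1 hx).2],
    Finset.sum_const, nsmul_eq_mul]
  refine mul_le_mul_of_nonneg_right ?_ (hF n)
  have h1 : (s.filter fun x => supDist x x₀ = n) ⊆ box x₀ n := fun x hx =>
    mem_box.2 (Finset.mem_filter.1 hx).2.le
  have h2 := Finset.card_le_card h1
  rw [card_box] at h2
  exact_mod_cast h2

theorem summable_pow_mul_exp {d : ℕ} (hd : 1 ≤ d) :
    Summable fun n : ℕ => (2 * n + 3 : ℝ) ^ d * Real.exp (-(d * n)) := by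
  have hg : Summable fun n : ℕ => 6 ^ d * Real.exp (-(1 / 2)) ^ n := by
    refine (summable_geometric_of_lt_one (Real.exp_nonneg _) ?_).mul_left _
    rw [Real.exp_lt_one_iff]
    norm_num
  refine Summable.of_nonneg_of_le (fun n => by positivity) (fun n => ?_) hg
  have h1 : (2 * n + 3 : ℝ) ≤ 6 * Real.exp (n / 2) := by
    have := Real.add_one_le_exp ((n : ℝ) / 2)
    have hn : (0 : ℝ) ≤ n := Nat.cast_nonneg n
    linarith
  calc (2 * n + 3 : ℝ) ^ d * Real.exp (-(d * n))
      ≤ (6 * Real.exp (n / 2)) ^ d * Real.exp (-(d * n)) := by gcongr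
    _ = 6 ^ d * Real.exp (-(d * n / 2)) := by
        rw [mul_pow, ← Real.exp_nat_mul, mul_assoc, ← Real.exp_add]
        ring_nf
    _ ≤ 6 ^ d * Real.exp (-(1 / 2)) ^ n := by
        rw [← Real.exp_nat_mul]
        gcongr
        have hd' : (1 : ℝ) ≤ d := by exact_mod_cast hd
        have hn : (0 : ℝ) ≤ n := Nat.cast_nonneg n
        nlinarith

theorem summable_exp_supDist {d : ℕ} (hd : 1 ≤ d) (x₀ : Fin d → ℤ) :
    Summable fun x : Fin d → ℤ => Real.exp (-(d * supDist x x₀)) := by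
  refine summable_supDist x₀ (F := fun n => Real.exp (-(d * n))) (fun n => Real.exp_nonneg _) ?_
  refine Summable.of_nonneg_of_le (fun n => by positivity) (fun n => ?_) (summable_pow_mul_exp hd)
  gcongr
  linarith

/-! ### Pure point spectrum -/

/-- Evaluate the equation at a site where `‖φ‖` is maximal. The bound confines all finite-volume
eigenvalues to one compact interval, so that they have limit points. -/
theorem norm_energy_le {d : ℕ} {V : (Fin d → ℤ) → ℝ} {B E : ℝ} (hB : ∀ x, |V x| ≤ B)
    {S : Finset (Fin d → ℤ)} {φ : (Fin d → ℤ) → ℂ} (hφ : ∀ x ∉ S, φ x = 0)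
    (hsol : ∀ x ∈ S, ham V φ x = E * φ x) (hne : ∃ x, φ x ≠ 0) : |E| ≤ 2 * d + B := by
  obtain ⟨x₁, hx₁⟩ := hne
  have hx₁S : x₁ ∈ S := by
    by_contra h
    exact hx₁ (hφ x₁ h)
  obtain ⟨x, hx, hmax⟩ := S.exists_max_image (fun x => ‖φ x‖) ⟨x₁, hx₁S⟩
  have hpos : 0 < ‖φ x‖ := (norm_pos_iff.2 hx₁).trans_le (hmax x₁ hx₁S)
  have hle : ∀ u, ‖φ u‖ ≤ ‖φ x‖ := fun u => by
    by_cases hu : u ∈ S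
    · exact hmax u hu
    · rw [hφ u hu, norm_zero]
      exact hpos.le
  have h1 : |E| * ‖φ x‖ ≤ (2 * d + B) * ‖φ x‖ := by
    calc |E| * ‖φ x‖ = ‖ham V φ x‖ := by
          rw [hsol x hx, norm_mul, Complex.norm_real, Real.norm_eq_abs]
      _ ≤ ‖hop φ x‖ + ‖(V x : ℂ) * φ x‖ := norm_add_le _ _
      _ ≤ 2 * d * ‖φ x‖ + B * ‖φ x‖ := by
          refine add_le_add (norm_hop_le fun u _ => hle u) ?_
          rw [norm_mul, Complex.norm_real, Real.norm_eq_abs]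
          exact mul_le_mul_of_nonneg_right (hB x) (norm_nonneg _)
      _ = _ := by ring
  exact le_of_mul_le_mul_right h1 hpos

theorem memlp_of_summable_bound {d : ℕ} {G : (Fin d → ℤ) → ℝ} (hG : Summable G) {K : ℝ}
    {ψ : (Fin d → ℤ) → ℂ} (h : ∀ x, ‖ψ x‖ ≤ G x) (hK : ∀ x, ‖ψ x‖ ≤ K) : Memℓp ψ 2 := by
  refine (memℓp_gen_iff (by norm_num)).2 ?_
  refine Summable.of_nonneg_of_le (fun x => by positivity) (fun x => ?_) (hG.mul_left K)
  have : (2 : ℝ≥0∞).toReal = (2 : ℕ) := by norm_num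
  rw [this, Real.rpow_natCast, sq]
  exact mul_le_mul (hK x) (h x) (norm_nonneg _) ((norm_nonneg _).trans (hK x))

/-- The sum of the pairings of `f` with uniformly decaying finite-volume eigenfunctions tends to
zero if `f` is orthogonal to all eigenfunctions. -/
theorem eventually_norm_coeff_lt {d : ℕ} (H : Ell2 d →L[ℂ] Ell2 d) {V : (Fin d → ℤ) → ℝ}
    (hH : ∀ f x, H f x = ham V f x) {B : ℝ} (hB : ∀ x, |V x| ≤ B) {x₀ : Fin d → ℤ}
    (b : ∀ N, EigenBasis V (box x₀ N)) {G : (Fin d → ℤ) → ℝ} (hG : Summable G) {f : Ell2 d}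
    (hf : ∀ (E : ℂ) (ψ : Ell2 d), H ψ = E • ψ → inner ℂ ψ f = 0) {η : ℝ} (hη : 0 < η) :
    ∀ᶠ N in atTop, ∀ j, (∀ x, ‖(b N).ψ j x‖ ≤ G x) → ‖(b N).coeff f j‖ < η := by
  by_contra hcon
  rw [not_eventually] at hcon
  let A : Set ℕ := {N | ∃ j, (∀ x, ‖(b N).ψ j x‖ ≤ G x) ∧ η ≤ ‖(b N).coeff f j‖}
  have hA : ∃ᶠ N in atTop, N ∈ A := hcon.mono fun N hN => by
    push Not at hN
    exact hN
  -- Along an ultrafilter supported on the radii where the claim fails, the eigenvalues and the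
  -- values of the eigenfunctions at all sites converge simultaneously by compactness.
  have : (atTop ⊓ 𝓟 A : Filter ℕ).NeBot := frequently_mem_iff_neBot.1 hA
  let U := Ultrafilter.of (atTop ⊓ 𝓟 A : Filter ℕ)
  have hU : (U : Filter ℕ) ≤ atTop ⊓ 𝓟 A := Ultrafilter.of_le _
  have hU1 : (U : Filter ℕ) ≤ atTop := hU.trans inf_le_left
  have hUA : ∀ᶠ N in (U : Filter ℕ), N ∈ A := hU (mem_inf_of_right (mem_principal_self A))
  have hch : ∀ N, ∃ j : box x₀ N, N ∈ A →
      (∀ x, ‖(b N).ψ j x‖ ≤ G x) ∧ η ≤ ‖(b N).coeff f j‖ := by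
    intro N
    by_cases hN : N ∈ A
    · obtain ⟨j, hj⟩ := hN
      exact ⟨j, fun _ => hj⟩
    · exact ⟨⟨x₀, mem_box.2 (by simp)⟩, fun h => absurd h hN⟩
  choose j hj using hch
  let φ : ℕ → (Fin d → ℤ) → ℂ := fun N => (b N).ψ (j N)
  have hφ1 : ∀ N x, ‖φ N x‖ ≤ 1 := fun N x => (b N).norm_apply_le_one _ x
  have hφG : ∀ᶠ N in (U : Filter ℕ), ∀ x, ‖φ N x‖ ≤ G x := hUA.mono fun N hN => (hj N hN).1
  -- limits along the ultrafilter
  have hlim : ∀ x, ∃ z : ℂ, Tendsto (fun N => φ N x) U (𝓝 z) := by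
    intro x
    have hc := (isCompact_closedBall (0 : ℂ) 1).ultrafilter_le_nhds (U.map fun N => φ N x) (by
      rw [le_principal_iff]
      change ∀ᶠ N in (U : Filter ℕ), φ N x ∈ Metric.closedBall (0 : ℂ) 1
      exact Filter.Eventually.of_forall fun N => by simpa using hφ1 N x)
    obtain ⟨z, -, hz⟩ := hc
    exact ⟨z, hz⟩
  choose ψ hψ using hlim
  have hE : ∀ N, |(b N).E (j N)| ≤ 2 * d + B := by
    intro N
    refine norm_energy_le hB ((b N).supp _) ((b N).eigen _) ?_
    by_contra hzero
    push Not at hzero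
    have := (b N).sum_norm_sq_eq_one (j N)
    simp [hzero] at this
  obtain ⟨E, hEl⟩ : ∃ E : ℝ, Tendsto (fun N => (b N).E (j N)) U (𝓝 E) := by
    have hc := (isCompact_Icc (a := -(2 * d + B)) (b := 2 * d + B)).ultrafilter_le_nhds
      (U.map fun N => (b N).E (j N)) (by
        rw [le_principal_iff]
        change ∀ᶠ N in (U : Filter ℕ), (b N).E (j N) ∈ Set.Icc (-(2 * d + B)) (2 * d + B)
        exact Filter.Eventually.of_forall fun N => abs_le.1 (hE N))
    obtain ⟨z, -, hz⟩ := hc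
    exact ⟨z, hz⟩
  have hψG : ∀ x, ‖ψ x‖ ≤ G x := fun x =>
    le_of_tendsto (hψ x).norm (hφG.mono fun N hN => hN x)
  have hψ1 : ∀ x, ‖ψ x‖ ≤ 1 := fun x =>
    le_of_tendsto (hψ x).norm (Filter.Eventually.of_forall fun N => hφ1 N x)
  let Ψ : Ell2 d := ⟨ψ, memlp_of_summable_bound hG hψG hψ1⟩
  -- Every site eventually lies in the box, where the zero-extended eigenfunction satisfies the full
  -- equation; both sides involve finitely many sites and pass to the limit.
  have heig : H Ψ = (E : ℂ) • Ψ := by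
    ext x
    rw [hH, lp.coeFn_smul, Pi.smul_apply, smul_eq_mul]
    change ham V ψ x = (E : ℂ) * ψ x
    have h1 : Tendsto (fun N => ham V (φ N) x) U (𝓝 (ham V ψ x)) := by
      refine Tendsto.add (tendsto_finsetSum _ fun i _ => (hψ _).add (hψ _)) ((hψ x).const_mul _)
    have h2 : Tendsto (fun N => ((b N).E (j N) : ℂ) * φ N x) U (𝓝 ((E : ℂ) * ψ x)) :=
      ((Complex.continuous_ofReal.tendsto E).comp hEl).mul (hψ x)
    refine tendsto_nhds_unique (h1.congr' ?_) h2
    filter_upwards [hU1 (eventually_ge_atTop (supDist x x₀))] with N hN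
    exact (b N).eigen (j N) x (mem_box.2 hN)
  have hzero := hf E Ψ heig
  have hlimit : Tendsto (fun N => (b N).coeff f (j N)) U (𝓝 0) := by
    rw [← hzero, lp.inner_eq_tsum]
    have h1 : ∀ N, (b N).coeff f (j N) = ∑' x, star (φ N x) * f x := by
      intro N
      rw [tsum_eq_sum (s := box x₀ N)]
      · rfl
      · intro x hx
        simp [φ, (b N).supp _ x hx]
    simp only [h1]
    -- The common summable majorant `G` prevents mass from escaping to infinity, so the coefficients
    -- converge to the inner product of the limiting eigenfunction with `f`, which is zero.
    refine tendsto_tsum_of_dominated_convergence (bound := fun x => G x * ‖f‖)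
      (hG.mul_right _) (fun x => ?_) (hφG.mono fun N hN x => ?_)
    · have : inner ℂ (Ψ x) (f x) = star (ψ x) * f x := by
        rw [RCLike.inner_apply, mul_comm]
        rfl
      rw [this]
      exact ((hψ x).star).mul_const _
    · rw [norm_mul, norm_star]
      exact mul_le_mul (hN x) (lp.norm_apply_le_norm (by norm_num) f x) (norm_nonneg _)
        ((norm_nonneg _).trans (hN x))
  have h3 : η ≤ ‖(0 : ℂ)‖ := ge_of_tendsto hlimit.norm (hUA.mono fun N hN => (hj N hN).2)
  rw [norm_zero] at h3
  linarith

/-- A function bounded by the nonsingular estimate, in square-summed form. -/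
theorem Nonsingular.norm_sq_le {d : ℕ} {V : (Fin d → ℤ) → ℝ} {R : Set (Fin d → ℤ)} {E q : ℝ}
    {ℓ : ℕ} {y : Fin d → ℤ} (hns : Nonsingular V R E ℓ q y) {φ : (Fin d → ℤ) → ℂ}
    (hφ : ∀ x ∉ R, φ x = 0) (hsol : ∀ x ∈ R, ham V φ x = E * φ x) :
    ‖φ y‖ ^ 2 ≤ q ^ 2 * ∑ u ∈ box y (ℓ + 1), ‖φ u‖ ^ 2 := by
  set C := Real.sqrt (∑ u ∈ box y (ℓ + 1), ‖φ u‖ ^ 2) with hC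
  have h0 : 0 ≤ ∑ u ∈ box y (ℓ + 1), ‖φ u‖ ^ 2 := Finset.sum_nonneg fun _ _ => by positivity
  have h1 := hns φ hφ (fun x hx _ => hsol x hx) C fun u hu => by
    rw [hC]
    refine Real.le_sqrt_of_sq_le ?_
    exact Finset.single_le_sum (f := fun u => ‖φ u‖ ^ 2) (fun _ _ => by positivity) (mem_box.2 hu)
  calc ‖φ y‖ ^ 2 ≤ (q * C) ^ 2 := pow_le_pow_left₀ (norm_nonneg _) h1 2
    _ = _ := by rw [mul_pow, hC, Real.sq_sqrt h0]

/-- The weight at `x₀` of the finite-volume eigenfunctions for which `x₀` is nonsingular at some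
large scale. -/
theorem sum_norm_sq_nonsingular_le {d J : ℕ} (s : ScaleSeq d J) {V : (Fin d → ℤ) → ℝ}
    {x₀ : Fin d → ℤ} {N : ℕ} (b : EigenBasis V (box x₀ N)) {k₁ : ℕ} {δ : ℝ}
    (hδ : ∀ T : Finset ℕ, (∀ k ∈ T, k₁ ≤ k) →
      ∑ k ∈ T, s.q k ^ 2 * (2 * (s.L k + 1 : ℕ) + 1 : ℝ) ^ d ≤ δ)
    (I : Finset (box x₀ N)) (hI : ∀ j ∈ I, ∃ k ≥ k₁,
      Nonsingular V (box x₀ N : Set (Fin d → ℤ)) (b.E j) (s.L k) (s.q k) x₀) :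
    ∑ j ∈ I, ‖b.ψ j x₀‖ ^ 2 ≤ δ := by
  classical
  choose! k hk1 hk2 using hI
  refine le_trans ?_ (hδ (I.image k) fun n hn => ?_)
  swap
  · obtain ⟨j, hj, rfl⟩ := Finset.mem_image.1 hn
    exact hk1 j hj
  rw [← Finset.sum_fiberwise_of_maps_to (g := k) (t := I.image k)
    fun j hj => Finset.mem_image_of_mem _ hj]
  refine Finset.sum_le_sum fun n _ => ?_
  calc ∑ j ∈ I with k j = n, ‖b.ψ j x₀‖ ^ 2
      ≤ ∑ j ∈ I with k j = n, s.q n ^ 2 * ∑ u ∈ box x₀ (s.L n + 1), ‖b.ψ j u‖ ^ 2 := by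
        refine Finset.sum_le_sum fun j hj => ?_
        obtain ⟨hj1, rfl⟩ := Finset.mem_filter.1 hj
        exact (hk2 j hj1).norm_sq_le (b.supp j) (b.eigen j)
    -- Enlarging the sum to the whole eigenbasis makes completeness applicable: at each site the
    -- total weight is at most one, however many eigenfunctions there are.
    _ ≤ ∑ j, s.q n ^ 2 * ∑ u ∈ box x₀ (s.L n + 1), ‖b.ψ j u‖ ^ 2 :=
        Finset.sum_le_sum_of_subset_of_nonneg (Finset.subset_univ _) fun _ _ _ => by positivity
    _ = s.q n ^ 2 * ∑ u ∈ box x₀ (s.L n + 1), ∑ j, ‖b.ψ j u‖ ^ 2 := by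
        rw [← Finset.mul_sum, Finset.sum_comm]
    _ ≤ s.q n ^ 2 * ∑ u ∈ box x₀ (s.L n + 1), 1 := by
        gcongr
        exact b.sum_norm_sq_apply_le _
    _ = _ := by
        rw [Finset.sum_const, card_box]
        simp

theorem ScaleSeq.summable_q {d J : ℕ} (s : ScaleSeq d J) (hd : 1 ≤ d) :
    Summable fun k => s.q k ^ 2 * (2 * (s.L k + 1 : ℕ) + 1 : ℝ) ^ d := by
  rw [← summable_nat_add_iff 1]
  have h1 := ((summable_pow_mul_exp hd).comp_injective s.L_strictMono.injective).comp_injective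
    (add_left_injective 1)
  refine Summable.of_nonneg_of_le (fun k => by positivity) (fun k => ?_) h1
  simp only [Function.comp]
  rw [mul_comm]
  push_cast
  have h2 : (2 * ((s.L (k + 1) : ℝ) + 1) + 1) = 2 * s.L (k + 1) + 3 := by ring
  rw [h2]
  refine mul_le_mul_of_nonneg_left ?_ (by positivity)
  calc s.q (k + 1) ^ 2 ≤ Real.exp (-(8 * d * s.L (k + 1))) ^ 2 :=
        pow_le_pow_left₀ (s.q_nonneg _) (s.q_le k) 2
    _ = Real.exp (-(16 * d * s.L (k + 1))) := by
        rw [← Real.exp_nat_mul]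
        congr 1
        push_cast
        ring
    _ ≤ _ := by
        refine Real.exp_le_exp.2 ?_
        have : (0 : ℝ) ≤ d * s.L (k + 1) := by positivity
        linarith

/-- For each `δ`, the eigenfunctions of a box around `x₀` are divided in two. Those with `x₀`
nonsingular at some scale beyond `k₁` contribute at most `√δ ‖f‖` to `f x₀`, by Cauchy–Schwarz and
the smallness of their weight at `x₀`. The others are bounded by a fixed summable function; there
are boundedly many of them, and their coefficients tend to zero as the box grows. -/
theorem apply_eq_zero_of_orthogonal {d J : ℕ} (s : ScaleSeq d J) (hd : 1 ≤ d)
    (H : Ell2 d →L[ℂ] Ell2 d) {V : (Fin d → ℤ) → ℝ} (hH : ∀ f x, H f x = ham V f x) {B : ℝ}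
    (hB : ∀ x, |V x| ≤ B) (hV : ∀ k x, NoResonance V J (s.L (k + 1) + s.L k) (s.ε k) x)
    {x₀ : Fin d → ℤ} {k₀ : ℕ}
    (hV1 : ∀ k ≥ k₀, NoResonance V 1 (8 * s.L (k + 1) + s.L k) (s.ε k) x₀) {f : Ell2 d}
    (hf : ∀ (E : ℂ) (ψ : Ell2 d), H ψ = E • ψ → inner ℂ ψ f = 0) : f x₀ = 0 := by
  classical
  have b : ∀ N, EigenBasis V (box x₀ N) := fun N => (nonempty_eigenBasis V _).some
  have hfN : ∀ N, ∑ x ∈ box x₀ N, ‖f x‖ ^ 2 ≤ ‖f‖ ^ 2 := by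
    intro N
    have := lp.sum_rpow_le_norm_rpow (p := 2) (by norm_num) f (box x₀ N)
    have h2 : (2 : ℝ≥0∞).toReal = (2 : ℕ) := by norm_num
    rw [h2] at this
    simp only [Real.rpow_natCast] at this
    exact this
  -- the estimate for each `δ`
  have key : ∀ δ > 0, ‖f x₀‖ ≤ Real.sqrt δ * ‖f‖ := by
    intro δ hδ
    obtain ⟨T₀, hT₀⟩ := summable_iff_vanishing_norm.1 (s.summable_q hd) δ hδ
    obtain ⟨k₁, hk₁0, hk₁1, hk₁⟩ : ∃ k₁, k₀ ≤ k₁ ∧ 1 ≤ k₁ ∧ ∀ T : Finset ℕ, (∀ k ∈ T, k₁ ≤ k) →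
        ∑ k ∈ T, s.q k ^ 2 * (2 * (s.L k + 1 : ℕ) + 1 : ℝ) ^ d ≤ δ := by
      refine ⟨max (max k₀ 1) (T₀.sup id + 1), by simp, by simp, fun T hT => ?_⟩
      have hdis : Disjoint T T₀ := by
        rw [Finset.disjoint_left]
        intro k hk hk'
        have h1 := hT k hk
        have h2 : k ≤ T₀.sup id := Finset.le_sup (f := id) hk'
        omega
      exact (le_abs_self _).trans (hT₀ T hdis).le
    set g : (Fin d → ℤ) → ℝ := fun x => Real.exp (-(d * supDist x x₀)) with hg
    have hgs : Summable g := summable_exp_supDist hd x₀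
    set ρ₁ := 4 * s.L k₁ with hρ₁
    set G : (Fin d → ℤ) → ℝ := fun x => g x + if x ∈ box x₀ ρ₁ then 1 else 0 with hGdef
    have hG : Summable G := by
      refine hgs.add (summable_of_hasFiniteSupport ((box x₀ ρ₁).finite_toSet.subset fun x hx => ?_))
      by_contra h
      exact hx (if_neg h)
    have hG0 : ∀ x, 0 ≤ G x := fun x => by
      simp only [hGdef, hg]
      positivity
    -- Off `T₁` the majorant has mass at most one half, so every normalised eigenfunction below it
    -- has half its mass on `T₁`. As each site carries total weight at most one, the number of such
    -- eigenfunctions is bounded independently of `N`.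
    obtain ⟨T₁, hT₁⟩ := summable_iff_vanishing_norm.1 hG (1 / 2) (by norm_num)
    -- eigenfunctions of the second kind decay
    let bad : ∀ N, Finset (box x₀ N) := fun N => Finset.univ.filter fun j => ∃ k ≥ k₁,
      Nonsingular V (box x₀ N : Set (Fin d → ℤ)) ((b N).E j) (s.L k) (s.q k) x₀
    have hdecay : ∀ N, ∀ j ∉ bad N, ∀ x, ‖(b N).ψ j x‖ ≤ G x := by
      intro N j hj x
      have hj' : ∀ k ≥ k₁,
          ¬ Nonsingular V (box x₀ N : Set (Fin d → ℤ)) ((b N).E j) (s.L k) (s.q k) x₀ := by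
        intro k hk hns
        exact hj (Finset.mem_filter.2 ⟨Finset.mem_univ _, k, hk, hns⟩)
      by_cases hx : supDist x x₀ ≤ ρ₁
      · simp only [hGdef, mem_box, hx, if_true]
        have := (b N).norm_apply_le_one j x
        have : 0 ≤ g x := Real.exp_nonneg _
        linarith
      · have := s.norm_le_exp (rectRegion_box x₀ N) hV hk₁1 (fun k hk => hV1 k (hk₁0.trans hk)) hj'
          ((b N).supp j) ((b N).eigen j) ((b N).norm_apply_le_one j) (y := x) (by omega)
        simpa [hGdef, mem_box, hx] using this
    have hcount : ∀ N, ((bad N)ᶜ.card : ℝ) ≤ 2 * T₁.card := by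
      intro N
      have h1 : ∀ j ∈ (bad N)ᶜ, (1 / 2 : ℝ) ≤ ∑ x ∈ T₁, ‖(b N).ψ j x‖ ^ 2 := by
        intro j hj
        have hj' := hdecay N j (Finset.mem_compl.1 hj)
        have h2 := (b N).sum_norm_sq_eq_one j
        have h3 : ∑ x ∈ box x₀ N \ T₁, ‖(b N).ψ j x‖ ^ 2 ≤ 1 / 2 := by
          calc ∑ x ∈ box x₀ N \ T₁, ‖(b N).ψ j x‖ ^ 2 ≤ ∑ x ∈ box x₀ N \ T₁, G x := by
                refine Finset.sum_le_sum fun x _ => ?_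
                have h4 := (b N).norm_apply_le_one j x
                have h5 := hj' x
                have h6 := norm_nonneg ((b N).ψ j x)
                nlinarith
            _ ≤ 1 / 2 := (le_abs_self _).trans (hT₁ _ Finset.sdiff_disjoint).le
        have h4 : ∑ x ∈ box x₀ N, ‖(b N).ψ j x‖ ^ 2 ≤
            ∑ x ∈ box x₀ N \ T₁, ‖(b N).ψ j x‖ ^ 2 + ∑ x ∈ T₁, ‖(b N).ψ j x‖ ^ 2 := by
          rw [← Finset.sum_union Finset.sdiff_disjoint]
          refine Finset.sum_le_sum_of_subset_of_nonneg (fun x hx => ?_) fun _ _ _ => by positivity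
          by_cases hxT : x ∈ T₁
          · exact Finset.mem_union_right _ hxT
          · exact Finset.mem_union_left _ (Finset.mem_sdiff.2 ⟨hx, hxT⟩)
        linarith
      have h2 : ((bad N)ᶜ.card : ℝ) * (1 / 2) ≤ T₁.card := by
        calc ((bad N)ᶜ.card : ℝ) * (1 / 2) = ∑ _j ∈ (bad N)ᶜ, (1 / 2 : ℝ) := by simp
          _ ≤ ∑ j ∈ (bad N)ᶜ, ∑ x ∈ T₁, ‖(b N).ψ j x‖ ^ 2 := Finset.sum_le_sum h1
          _ ≤ ∑ j, ∑ x ∈ T₁, ‖(b N).ψ j x‖ ^ 2 :=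
              Finset.sum_le_sum_of_subset_of_nonneg (Finset.subset_univ _)
                fun _ _ _ => Finset.sum_nonneg fun _ _ => by positivity
          _ = ∑ x ∈ T₁, ∑ j, ‖(b N).ψ j x‖ ^ 2 := Finset.sum_comm
          _ ≤ ∑ x ∈ T₁, 1 := Finset.sum_le_sum fun x _ => (b N).sum_norm_sq_apply_le x
          _ = T₁.card := by simp
      linarith
    have hη : ∀ η > 0, ‖f x₀‖ ≤ 2 * T₁.card * η + Real.sqrt δ * ‖f‖ := by
      intro η hη
      obtain ⟨N, hN⟩ := (eventually_norm_coeff_lt H hH hB b hG hf hη).exists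
      have h1 : f x₀ = ∑ j ∈ (bad N)ᶜ, (b N).coeff f j * (b N).ψ j x₀ +
          ∑ j ∈ bad N, (b N).coeff f j * (b N).ψ j x₀ := by
        rw [Finset.sum_compl_add_sum, (b N).sum_coeff f (mem_box.2 (by simp))]
      have h2 : ‖∑ j ∈ (bad N)ᶜ, (b N).coeff f j * (b N).ψ j x₀‖ ≤ 2 * T₁.card * η := by
        calc _ ≤ ∑ j ∈ (bad N)ᶜ, ‖(b N).coeff f j * (b N).ψ j x₀‖ := norm_sum_le _ _
          _ ≤ ∑ _j ∈ (bad N)ᶜ, η := by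
              refine Finset.sum_le_sum fun j hj => ?_
              rw [norm_mul]
              have h3 := hN j (hdecay N j (Finset.mem_compl.1 hj))
              have h4 := (b N).norm_apply_le_one j x₀
              nlinarith [norm_nonneg ((b N).ψ j x₀), norm_nonneg ((b N).coeff f j)]
          _ = ((bad N)ᶜ.card : ℝ) * η := by simp
          _ ≤ _ := mul_le_mul_of_nonneg_right (hcount N) hη.le
      have h3 : ‖∑ j ∈ bad N, (b N).coeff f j * (b N).ψ j x₀‖ ≤ Real.sqrt δ * ‖f‖ := by
        calc _ ≤ ∑ j ∈ bad N, ‖(b N).coeff f j * (b N).ψ j x₀‖ := norm_sum_le _ _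
          _ = ∑ j ∈ bad N, ‖(b N).coeff f j‖ * ‖(b N).ψ j x₀‖ := by simp only [norm_mul]
          _ ≤ Real.sqrt (∑ j ∈ bad N, ‖(b N).coeff f j‖ ^ 2) *
              Real.sqrt (∑ j ∈ bad N, ‖(b N).ψ j x₀‖ ^ 2) := Real.sum_mul_le_sqrt_mul_sqrt _ _ _
          _ ≤ ‖f‖ * Real.sqrt δ := by
              refine mul_le_mul ?_ (Real.sqrt_le_sqrt ?_) (Real.sqrt_nonneg _) (norm_nonneg _)
              · refine Real.sqrt_le_iff.2 ⟨norm_nonneg _, ?_⟩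
                calc _ ≤ ∑ j, ‖(b N).coeff f j‖ ^ 2 :=
                      Finset.sum_le_sum_of_subset_of_nonneg (Finset.subset_univ _)
                        fun _ _ _ => by positivity
                  _ ≤ ‖f‖ ^ 2 := by
                      rw [(b N).sum_norm_sq_coeff]
                      exact hfN N
              · exact sum_norm_sq_nonsingular_le s (b N) hk₁ (bad N)
                  fun j hj => (Finset.mem_filter.1 hj).2
          _ = _ := mul_comm _ _
      rw [h1]
      exact (norm_add_le _ _).trans (add_le_add h2 h3)
    have hlim : Tendsto (fun η : ℝ => 2 * T₁.card * η + Real.sqrt δ * ‖f‖) (𝓝[>] 0)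
        (𝓝 (2 * T₁.card * 0 + Real.sqrt δ * ‖f‖)) := by
      refine Tendsto.mono_left ?_ nhdsWithin_le_nhds
      exact (Continuous.tendsto (by fun_prop) 0)
    have := ge_of_tendsto hlim (eventually_nhdsWithin_of_forall fun η hη' => hη η hη')
    simpa using this
  have hlim : Tendsto (fun δ : ℝ => Real.sqrt δ * ‖f‖) (𝓝[>] 0) (𝓝 (Real.sqrt 0 * ‖f‖)) := by
    refine Tendsto.mono_left ?_ nhdsWithin_le_nhds
    exact (Continuous.tendsto (by fun_prop) 0)
  have := ge_of_tendsto hlim (eventually_nhdsWithin_of_forall fun δ hδ => key δ hδ)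
  rw [Real.sqrt_zero, zero_mul] at this
  exact norm_le_zero_iff.1 this

/-! ### Application to the quasi-periodic operator -/

theorem shiftOp_apply {d : ℕ} (a : Fin d → ℤ) (f : Ell2 d) (x : Fin d → ℤ) :
    shiftOp a f x = f (x + a) := rfl

theorem inner_shiftOp {d : ℕ} (a : Fin d → ℤ) (f g : Ell2 d) :
    inner ℂ (shiftOp a f) g = inner ℂ f (shiftOp (-a) g) := by
  rw [lp.inner_eq_tsum, lp.inner_eq_tsum, ← (Equiv.addRight a).tsum_eq fun x =>
    inner ℂ (f x) (shiftOp (-a) g x)]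
  refine tsum_congr fun x => ?_
  simp [shiftOp_apply]

theorem inner_potentialOp {ν d : ℕ} (u : C(UnitAddTorus (Fin ν), ℝ))
    (p : (Fin d → ℤ) → UnitAddTorus (Fin ν)) (f g : Ell2 d) :
    inner ℂ (potentialOp u p f) g = inner ℂ f (potentialOp u p g) := by
  rw [lp.inner_eq_tsum, lp.inner_eq_tsum]
  refine tsum_congr fun x => ?_
  have h : ∀ f : Ell2 d, potentialOp u p f x = (u (p x) : ℂ) * f x := fun _ => rfl
  rw [h, h]
  simp only [RCLike.inner_apply, map_mul, Complex.conj_ofReal]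
  ring

theorem inner_schrodinger {ν d : ℕ} (α : Matrix (Fin ν) (Fin d) ℝ)
    (u : C(UnitAddTorus (Fin ν), ℝ)) (ω : UnitAddTorus (Fin ν)) (t : ℝ) (f g : Ell2 d) :
    inner ℂ (schrodinger α u ω t f) g = inner ℂ f (schrodinger α u ω t g) := by
  simp only [schrodinger, _root_.add_apply, _root_.smul_apply, _root_.sum_apply, inner_add_left,
    inner_add_right, sum_inner, inner_sum, inner_smul_left, inner_smul_right, inner_shiftOp,
    inner_potentialOp, neg_neg, Complex.conj_ofReal]
  congr 1
  exact Finset.sum_congr rfl fun j _ => add_comm _ _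

/-- The potential of the quasi-periodic operator. -/
noncomputable def qpPotential {ν d : ℕ} (α : Matrix (Fin ν) (Fin d) ℝ)
    (u : C(UnitAddTorus (Fin ν), ℝ)) (g : ℝ) (ω : UnitAddTorus (Fin ν)) (x : Fin d → ℤ) : ℝ :=
  g * u (orbit α ω x)

theorem schrodinger_eq_ham {ν d : ℕ} (α : Matrix (Fin ν) (Fin d) ℝ)
    (u : C(UnitAddTorus (Fin ν), ℝ)) (ω : UnitAddTorus (Fin ν)) (g : ℝ) (f : Ell2 d)
    (x : Fin d → ℤ) : schrodinger α u ω g f x = ham (qpPotential α u g ω) f x := by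
  rw [schrodinger_apply, ham, hop, qpPotential]
  push_cast
  rfl

theorem latticeNorm_le {d : ℕ} (x : Fin d → ℤ) : latticeNorm x ≤ d * supDist x 0 := by
  rw [latticeNorm]
  calc ∑ j, |(x j : ℝ)| ≤ ∑ _j : Fin d, (supDist x 0 : ℝ) := by
        refine Finset.sum_le_sum fun j _ => ?_
        have := natAbs_le_supDist x 0 j
        simp only [Pi.zero_apply, sub_zero] at this
        rw [← Int.cast_abs, Int.abs_eq_natAbs]
        exact_mod_cast this
    _ = d * supDist x 0 := by simp

/-- Deterministic criterion for localisation: uniform control of the number of resonances, and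
eventually no double resonance around each site. -/
theorem localised_of_noResonance {ν d J : ℕ} (s : ScaleSeq d J) (hd : 1 ≤ d)
    (α : Matrix (Fin ν) (Fin d) ℝ) (u : C(UnitAddTorus (Fin ν), ℝ)) (ω : UnitAddTorus (Fin ν))
    (g : ℝ)
    (hV : ∀ k x, NoResonance (qpPotential α u g ω) J (s.L (k + 1) + s.L k) (s.ε k) x)
    (hV1 : ∀ x, ∃ k₀, ∀ k ≥ k₀,
      NoResonance (qpPotential α u g ω) 1 (8 * s.L (k + 1) + s.L k) (s.ε k) x) :
    HasPurePointSpectrum (schrodinger α u ω g) ∧ EigenfunctionsDecay (schrodinger α u ω g) := by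
  have hH := schrodinger_eq_ham α u ω g
  have hB : ∀ x, |qpPotential α u g ω x| ≤ |g| * ‖u‖ := fun x => by
    rw [qpPotential, abs_mul]
    exact mul_le_mul_of_nonneg_left (u.norm_coe_le_norm _) (abs_nonneg _)
  refine ⟨?_, fun E ψ hψ => ?_⟩
  · rw [HasPurePointSpectrum, Submodule.topologicalClosure_eq_top_iff, Submodule.eq_bot_iff]
    intro f hf
    ext x
    obtain ⟨k₀, hk₀⟩ := hV1 x
    refine apply_eq_zero_of_orthogonal s hd _ hH hB hV hk₀ fun E ψ hψ => ?_
    refine (Submodule.mem_orthogonal _ _).1 hf ψ ?_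
    exact Submodule.mem_iSup_of_mem E (Module.End.mem_eigenspace_iff.2 hψ)
  · have hEψ : schrodinger α u ω g ψ = E • ψ := hψ.apply_eq_smul
    have hψ0 : ψ ≠ 0 := hψ.2
    -- the eigenvalue is real
    have hreal : (E.re : ℂ) = E := by
      have h1 := inner_schrodinger α u ω g ψ ψ
      rw [hEψ, inner_smul_left, inner_smul_right] at h1
      exact Complex.conj_eq_iff_re.1 (mul_right_cancel₀ (inner_self_ne_zero.2 hψ0) h1)
    have hsol : ∀ x ∈ (Set.univ : Set (Fin d → ℤ)),
        ham (qpPotential α u g ω) ψ x = E.re * ψ x := by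
      intro x _
      rw [← hH, hEψ, hreal]
      rfl
    obtain ⟨x₀, hx₀⟩ : ∃ x, ψ x ≠ 0 := by
      by_contra h
      push Not at h
      exact hψ0 (by ext x; exact h x)
    have hC : ∀ x, ‖ψ x‖ ≤ ‖ψ‖ := fun x => lp.norm_apply_le_norm (by norm_num) ψ x
    obtain ⟨k₀, hk₀⟩ := hV1 x₀
    obtain ⟨k₁, hk₁⟩ := eventually_atTop.1
      (s.eventually_singular hd (fun x hx => absurd (Set.mem_univ x) hx) hsol hC hx₀)
    set k₂ := max (max k₀ k₁) 1 with hk₂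
    have hdec := fun y => s.norm_le_exp (rectRegion_univ (d := d)) hV (k₁ := k₂) (by omega)
      (fun k hk => hk₀ k (by omega)) (fun k hk => hk₁ k (by omega))
      (fun x hx => absurd (Set.mem_univ x) hx) hsol hC (y := y)
    have htri : ∀ x : Fin d → ℤ, latticeNorm x ≤ d * supDist x x₀ + d * supDist x₀ 0 := by
      intro x
      refine (latticeNorm_le x).trans ?_
      rw [← mul_add]
      refine mul_le_mul_of_nonneg_left ?_ (Nat.cast_nonneg d)
      exact_mod_cast supDist_triangle x x₀ 0
    refine ⟨‖ψ‖ * Real.exp (d * (4 * s.L k₂ : ℕ) + d * supDist x₀ 0), ?_⟩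
    rintro _ ⟨x, rfl⟩
    by_cases hx : 4 * s.L k₂ ≤ supDist x x₀
    · calc ‖ψ x‖ * Real.exp (latticeNorm x)
          ≤ (‖ψ‖ * Real.exp (-(d * supDist x x₀))) *
              Real.exp (d * supDist x x₀ + d * supDist x₀ 0) :=
            mul_le_mul (hdec x hx) (Real.exp_le_exp.2 (htri x)) (Real.exp_nonneg _) (by positivity)
        _ = ‖ψ‖ * Real.exp (d * supDist x₀ 0) := by
            rw [mul_assoc, ← Real.exp_add]
            ring_nf
        _ ≤ _ := by
            gcongr
            have : (0 : ℝ) ≤ d * (4 * s.L k₂ : ℕ) := by positivity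
            linarith
    · refine mul_le_mul (hC x) (Real.exp_le_exp.2 ((htri x).trans ?_)) (Real.exp_nonneg _)
        (norm_nonneg _)
      gcongr
      omega

/-! ### Gaussian vectors and shifts -/

/-- The Gaussian density is at most `1 / √(2π w)`, whatever the mean. -/
theorem gaussianReal_le_smul_volume (m : ℝ) {w : NNReal} {D : ℝ} (hD : 0 < D)
    (hw : 1 / D ^ 2 ≤ (w : ℝ)) (s : Set ℝ) :
    gaussianReal m w s ≤ ENNReal.ofReal D * volume s := by
  have hD2 : 0 < 1 / D ^ 2 := by positivity
  have hw0 : (0 : ℝ) < w := hD2.trans_le hw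
  have hw' : w ≠ 0 := by
    rintro rfl
    simp at hw0
  rw [gaussianReal_apply _ hw', ← setLIntegral_const]
  refine lintegral_mono fun x => ENNReal.ofReal_le_ofReal ?_
  rw [gaussianPDFReal]
  have h1 : Real.exp (-(x - m) ^ 2 / (2 * w)) ≤ 1 := by
    rw [Real.exp_le_one_iff]
    exact div_nonpos_of_nonpos_of_nonneg (by nlinarith [sq_nonneg (x - m)]) (by positivity)
  have h2 : (Real.sqrt (2 * Real.pi * w))⁻¹ ≤ D := by
    rw [inv_le_comm₀ (by positivity) hD]
    refine Real.le_sqrt_of_sq_le ?_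
    have : (D⁻¹) ^ 2 = 1 / D ^ 2 := by simp
    rw [this]
    refine hw.trans ?_
    nlinarith [Real.pi_gt_three]
  calc _ ≤ D * 1 := mul_le_mul h2 h1 (Real.exp_nonneg _) hD.le
    _ = D := mul_one D

/-- A nondegenerate Gaussian vector is the sum of an independent vector and a Gaussian multiple of
the indicator of `S`. -/
theorem exists_indep_shift {Θ κ : Type*} [MeasurableSpace Θ] [Fintype κ] [DecidableEq κ]
    {P : Measure Θ}
    {X : κ → Θ → ℝ} (hX : HasGaussianLaw (fun θ k => X k θ) P) {lam : ℝ} (hlam : 0 < lam)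
    (hvar : ∀ (u : κ → ℝ) (k : κ), lam * u k ^ 2 ≤ Var[fun θ => ∑ i, u i * X i θ; P])
    (S : Finset κ) (hS : S.Nonempty) :
    ∃ (Y : κ → Θ → ℝ) (t : Θ → ℝ) (m : ℝ) (w : NNReal), AEMeasurable t P ∧
      AEMeasurable (fun θ k => Y k θ) P ∧
      IndepFun (fun θ k => Y k θ) t P ∧ P.map t = gaussianReal m w ∧
      lam / (Fintype.card κ : ℝ) ^ 2 ≤ (w : ℝ) ∧
      ∀ k θ, X k θ = Y k θ + t θ * if k ∈ S then 1 else 0 := by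
  have := hX.isProbabilityMeasure
  have hXk : ∀ k, MemLp (X k) 2 P := fun k => (hX.eval k).memLp_two
  -- solve the equation for the dual vector
  let K : (κ → ℝ) →ₗ[ℝ] (κ → ℝ) :=
    { toFun := fun u k => ∑ i, u i * cov[X i, X k; P]
      map_add' := fun u v => by
        ext k
        simp [add_mul, Finset.sum_add_distrib]
      map_smul' := fun c u => by
        ext k
        simp [Finset.mul_sum, mul_assoc] }
  have hcovK : ∀ (u : κ → ℝ) (k : κ), cov[fun θ => ∑ i, u i * X i θ, X k; P] = K u k := by
    intro u k
    rw [covariance_fun_sum_left (fun i => (hXk i).const_mul _) (hXk k)]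
    exact Finset.sum_congr rfl fun i _ => covariance_const_mul_left _
  have hmem : ∀ u : κ → ℝ, MemLp (fun θ => ∑ i, u i * X i θ) 2 P := fun u =>
    memLp_finsetSum _ fun i _ => (hXk i).const_mul _
  have hvarK : ∀ u : κ → ℝ, Var[fun θ => ∑ i, u i * X i θ; P] = ∑ k, u k * K u k := by
    intro u
    rw [← covariance_self (hmem u).aestronglyMeasurable.aemeasurable,
      covariance_fun_sum_right (fun i => (hXk i).const_mul _) (hmem u)]
    refine Finset.sum_congr rfl fun k _ => ?_
    rw [covariance_const_mul_right, hcovK]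
  have hinj : Function.Injective K := by
    rw [injective_iff_map_eq_zero]
    intro u hu
    ext k
    have h1 := hvar u k
    rw [hvarK, hu] at h1
    simp only [Pi.zero_apply, mul_zero, Finset.sum_const_zero] at h1
    have h2 : u k ^ 2 ≤ 0 := by
      by_contra h
      have := mul_pos hlam (not_le.1 h)
      linarith
    exact pow_eq_zero_iff (two_ne_zero) |>.1 (le_antisymm h2 (sq_nonneg _))
  -- With `K c` equal to the indicator of `S`, the combination `T` of the `X i` has exactly this
  -- indicator as its vector of covariances with the `X k`. Hence subtracting `T / Var T` on `S`
  -- leaves a vector uncorrelated with `T`, and so independent of it by joint Gaussianity.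
  obtain ⟨c, hc⟩ := (LinearMap.injective_iff_surjective.1 hinj) fun k => if k ∈ S then 1 else 0
  set T : Θ → ℝ := fun θ => ∑ i, c i * X i θ with hT
  set τ : ℝ := Var[T; P] with hτ
  have hτS : τ = ∑ k ∈ S, c k := by
    rw [hτ, hvarK, hc]
    simp
  have hτ0 : 0 < τ := by
    have h0 : 0 ≤ τ := variance_nonneg _ _
    refine lt_of_le_of_ne h0 fun h => ?_
    obtain ⟨k, hk⟩ := hS
    have hc0 : c = 0 := by
      ext i
      have h1 := hvar c i
      rw [← hT, ← hτ, ← h] at h1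
      have h2 : c i ^ 2 ≤ 0 := by
        by_contra h
        have := mul_pos hlam (not_le.1 h)
        linarith
      exact pow_eq_zero_iff (two_ne_zero) |>.1 (le_antisymm h2 (sq_nonneg _))
    have := congrFun hc k
    rw [hc0, map_zero, if_pos hk] at this
    simp at this
  -- The multiplier `t` has variance `1 / τ`, so an upper bound for `τ` is needed. Nondegeneracy
  -- gives `|c i| ≤ √(τ / lam)`, while `τ` is a sum of entries of `c`; the resulting inequality for
  -- `τ` closes on itself.
  have hτle : τ ≤ (Fintype.card κ : ℝ) ^ 2 / lam := by
    have h1 : ∀ i, |c i| ≤ Real.sqrt (τ / lam) := fun i => by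
      refine Real.abs_le_sqrt ?_
      rw [le_div_iff₀ hlam, mul_comm]
      exact hvar c i
    have h2 : τ ≤ Fintype.card κ * Real.sqrt (τ / lam) := by
      calc τ = ∑ k ∈ S, c k := hτS
        _ ≤ ∑ k ∈ S, |c k| := Finset.sum_le_sum fun k _ => le_abs_self _
        _ ≤ ∑ k, |c k| := Finset.sum_le_sum_of_subset_of_nonneg (Finset.subset_univ _)
            fun _ _ _ => abs_nonneg _
        _ ≤ ∑ _k : κ, Real.sqrt (τ / lam) := Finset.sum_le_sum fun k _ => h1 k
        _ = _ := by simp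
    have h3 : τ ^ 2 ≤ (Fintype.card κ : ℝ) ^ 2 * (τ / lam) := by
      calc τ ^ 2 ≤ (Fintype.card κ * Real.sqrt (τ / lam)) ^ 2 := pow_le_pow_left₀ hτ0.le h2 2
        _ = _ := by rw [mul_pow, Real.sq_sqrt (by positivity)]
    have h4 : τ * τ ≤ (Fintype.card κ : ℝ) ^ 2 / lam * τ := by
      calc τ * τ = τ ^ 2 := (sq τ).symm
        _ ≤ _ := h3
        _ = _ := by ring
    exact le_of_mul_le_mul_right h4 hτ0
  set t : Θ → ℝ := fun θ => τ⁻¹ * T θ with ht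
  set Y : κ → Θ → ℝ := fun k θ => X k θ - t θ * if k ∈ S then 1 else 0 with hY
  -- the joint law is Gaussian
  let Lt : (κ → ℝ) →L[ℝ] ℝ := τ⁻¹ • ∑ i, c i • ContinuousLinearMap.proj (R := ℝ) i
  have hLt : ∀ x, Lt x = τ⁻¹ * ∑ i, c i * x i := fun x => by simp [Lt]
  let LY : (κ → ℝ) →L[ℝ] (κ → ℝ) := ContinuousLinearMap.pi fun k =>
    ContinuousLinearMap.proj (R := ℝ) k - (if k ∈ S then (1 : ℝ) else 0) • Lt
  let Lt1 : (κ → ℝ) →L[ℝ] (Unit → ℝ) := ContinuousLinearMap.pi fun _ => Lt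
  have hLY : ∀ x k, LY x k = x k - Lt x * if k ∈ S then 1 else 0 := fun x k => by
    by_cases hk : k ∈ S <;> simp [LY, hk]
  have hjoint : HasGaussianLaw (fun θ => ((fun k => Y k θ), fun _ : Unit => t θ)) P := by
    have e : (fun θ => ((fun k => Y k θ), fun _ : Unit => t θ)) =
        fun θ => (LY.prod Lt1) fun k => X k θ := by
      funext θ
      refine Prod.ext ?_ ?_
      · funext k
        change Y k θ = LY (fun k => X k θ) k
        rw [hLY, hLt]
      · funext k
        simp [Lt1, ht, hT, hLt]
    rw [e]
    exact hX.map_fun (LY.prod Lt1)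
  have htm : MemLp t 2 P := (hmem c).const_mul _
  have hindep := hjoint.indepFun_of_covariance_eval (X := Y) (Y := fun _ : Unit => t) fun k _ => by
    simp only [hY]
    rw [covariance_fun_sub_left (hXk k) (htm.mul_const _) htm, covariance_mul_const_left,
      covariance_self htm.aestronglyMeasurable.aemeasurable, ht, covariance_const_mul_right,
      variance_const_mul, covariance_comm, hcovK, hc, ← hτ]
    by_cases hk : k ∈ S
    · simp only [hk, if_true]
      field_simp
      ring
    · simp [hk]
  have hgt : HasGaussianLaw t P := (hjoint.snd).eval ()
  refine ⟨Y, t, _, _, hgt.aemeasurable, hjoint.fst.aemeasurable,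
    hindep.comp measurable_id (measurable_pi_apply ()), hgt.map_eq_gaussianReal, ?_,
    fun k θ => by simp [hY]⟩
  rw [Real.coe_toNNReal _ (variance_nonneg _ _), ht, variance_const_mul, ← hτ]
  have hN : 0 < (Fintype.card κ : ℝ) := by
    obtain ⟨k, -⟩ := hS
    exact_mod_cast Fintype.card_pos_iff.2 ⟨k⟩
  have h5 : τ⁻¹ ^ 2 * τ = τ⁻¹ := by field_simp
  rw [h5, ← inv_div]
  exact inv_anti₀ hτ0 hτle

/-- If `F` meets every line in the direction of the indicator of `S` in a small set, and `G` is
invariant in this direction, then `G ∩ F` is much less likely than `G`. -/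
theorem measure_inter_le_of_shift {Θ κ : Type*} [MeasurableSpace Θ] [Fintype κ] [DecidableEq κ]
    {P : Measure Θ} {X : κ → Θ → ℝ} (hX : HasGaussianLaw (fun θ k => X k θ) P) {lam : ℝ}
    (hlam : 0 < lam)
    (hvar : ∀ (u : κ → ℝ) (k : κ), lam * u k ^ 2 ≤ Var[fun θ => ∑ i, u i * X i θ; P])
    (S : Finset κ) (hS : S.Nonempty) {F G : Set (κ → ℝ)} (hF : MeasurableSet F)
    (hG : MeasurableSet G)
    (hinv : ∀ (x : κ → ℝ) (τ : ℝ), (fun k => x k + τ * if k ∈ S then 1 else 0) ∈ G ↔ x ∈ G)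
    {v : ℝ≥0∞}
    (hv : ∀ x : κ → ℝ, volume {τ : ℝ | (fun k => x k + τ * if k ∈ S then 1 else 0) ∈ F} ≤ v) :
    P {θ | (fun k => X k θ) ∈ G ∧ (fun k => X k θ) ∈ F} ≤
      ENNReal.ofReal (Fintype.card κ / Real.sqrt lam) * v * P {θ | (fun k => X k θ) ∈ G} := by
  have := hX.isProbabilityMeasure
  obtain ⟨Y, t, m, w, htm, hYm, hind, hmap, hw, hXY⟩ := exists_indep_shift hX hlam hvar S hS
  have hN : 0 < (Fintype.card κ : ℝ) := by
    obtain ⟨k, -⟩ := hS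
    exact_mod_cast Fintype.card_pos_iff.2 ⟨k⟩
  have hprod := (indepFun_iff_map_prod_eq_prod_map_map hYm htm).1 hind
  have hshift : Measurable fun p : (κ → ℝ) × ℝ => fun k => p.1 k + p.2 * if k ∈ S then (1 : ℝ) else 0 := by
    fun_prop
  set A : Set ((κ → ℝ) × ℝ) :=
    {p | p.1 ∈ G ∧ (fun k => p.1 k + p.2 * if k ∈ S then (1 : ℝ) else 0) ∈ F} with hA
  have hAm : MeasurableSet A := (hG.preimage measurable_fst).inter (hF.preimage hshift)
  have hXeq : ∀ θ, (fun k => X k θ) = fun k => Y k θ + t θ * if k ∈ S then 1 else 0 := fun θ =>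
    funext fun k => hXY k θ
  -- By invariance, membership in `G` is decided by `Y` alone. Given `Y`, only the independent
  -- Gaussian `t` is left to put the vector in `F`.
  have e1 : {θ | (fun k => X k θ) ∈ G ∧ (fun k => X k θ) ∈ F} =
      (fun θ => ((fun k => Y k θ), t θ)) ⁻¹' A := by
    ext θ
    simp only [Set.mem_ofPred_eq, Set.mem_preimage, hA, hXeq θ, hinv]
  have e2 : {θ | (fun k => X k θ) ∈ G} = (fun θ k => Y k θ) ⁻¹' G := by
    ext θ
    simp only [Set.mem_ofPred_eq, Set.mem_preimage, hXeq θ, hinv]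
  rw [e1, e2, ← Measure.map_apply_of_aemeasurable (hYm.prodMk htm) hAm,
    ← Measure.map_apply_of_aemeasurable hYm hG, hprod, Measure.prod_apply hAm]
  have : IsProbabilityMeasure (P.map t) := Measure.isProbabilityMeasure_map htm
  calc ∫⁻ x, (P.map t) (Prod.mk x ⁻¹' A) ∂(P.map fun θ k => Y k θ)
      ≤ ∫⁻ x, G.indicator (fun _ => ENNReal.ofReal (Fintype.card κ / Real.sqrt lam) * v) x
          ∂(P.map fun θ k => Y k θ) := by
        refine lintegral_mono fun x => ?_
        by_cases hx : x ∈ G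
        · rw [Set.indicator_of_mem hx, hmap]
          refine (gaussianReal_le_smul_volume m (D := Fintype.card κ / Real.sqrt lam)
            (by positivity) ?_ _).trans ?_
          · rw [div_pow, Real.sq_sqrt hlam.le, one_div_div]
            exact hw
          · refine mul_le_mul' le_rfl ((measure_mono ?_).trans (hv x))
            exact fun τ hτ => hτ.2
        · rw [Set.indicator_of_notMem hx]
          have : Prod.mk x ⁻¹' A = ∅ := by
            ext τ
            simp [hA, hx]
          rw [this, measure_empty]
    _ = _ := by rw [lintegral_indicator_const hG]

/-! ### Probability of multiple resonances -/

theorem Resonant.congr {d : ℕ} {V V' : (Fin d → ℤ) → ℝ} {S : Finset (Fin d → ℤ)} {E ε : ℝ}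
    (h : Resonant V S E ε) (hV : ∀ x ∈ S, V x = V' x) : Resonant V' S E ε := by
  obtain ⟨φ, hφ, hlt⟩ := h
  refine ⟨φ, hφ, ?_⟩
  rw [Finset.sum_congr rfl fun x hx => by rw [ham, ← hV x hx, ← ham]]
  exact hlt

theorem Resonant.shift {d : ℕ} {V V' : (Fin d → ℤ) → ℝ} {S : Finset (Fin d → ℤ)} {E ε c : ℝ}
    (h : Resonant V S E ε) (hV : ∀ x ∈ S, V x = V' x + c) : Resonant V' S (E - c) ε := by
  obtain ⟨φ, hφ, hlt⟩ := h
  refine ⟨φ, hφ, ?_⟩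
  rw [Finset.sum_congr rfl fun x hx => ?_]
  · exact hlt
  · simp only [ham, hV x hx]
    push_cast
    ring_nf

theorem Resonant.nonempty {d : ℕ} {V : (Fin d → ℤ) → ℝ} {S : Finset (Fin d → ℤ)} {E ε : ℝ}
    (h : Resonant V S E ε) : S.Nonempty := by
  obtain ⟨φ, -, hlt⟩ := h
  by_contra hS
  rw [Finset.not_nonempty_iff_eq_empty.1 hS] at hlt
  simp at hlt

/-- The quasimode inequality is strict and continuous in the potential for fixed `E` and `φ`, so the
union over these is open. This yields measurability of resonance events without any measurable
choice of eigenvalues. -/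
theorem isOpen_resonant {d : ℕ} {Y ι : Type*} [TopologicalSpace Y] [Finite ι]
    {V : Y → (Fin d → ℤ) → ℝ} (hV : ∀ x, Continuous fun y => V y x) (S : ι → Finset (Fin d → ℤ))
    (ε : ℝ) : IsOpen {y | ∃ E, ∀ i, Resonant (V y) (S i) E ε} := by
  have e : {y | ∃ E, ∀ i, Resonant (V y) (S i) E ε} = ⋃ E : ℝ, ⋂ i, ⋃ φ : (Fin d → ℤ) → ℂ,
      {y | (∀ x ∉ S i, φ x = 0) ∧
        ∑ x ∈ S i, ‖ham (V y) φ x - E * φ x‖ ^ 2 < ε ^ 2 * ∑ x ∈ S i, ‖φ x‖ ^ 2} := by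
    ext y
    simp only [Set.mem_ofPred_eq, Set.mem_iUnion, Set.mem_iInter, Resonant]
  rw [e]
  refine isOpen_iUnion fun E => isOpen_iInter_of_finite fun i => isOpen_iUnion fun φ => ?_
  refine IsOpen.and isOpen_const (isOpen_lt ?_ continuous_const)
  refine continuous_finsetSum _ fun x _ => ?_
  have h := Complex.continuous_ofReal.comp (hV x)
  simp only [ham]
  fun_prop

/-- The potential `g x`, extended by zero outside the finite set `B`. -/
noncomputable def extendPotential {d : ℕ} (B : Finset (Fin d → ℤ)) (g : ℝ) (x : B → ℝ)
    (u : Fin d → ℤ) : ℝ := by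
  classical
  exact if h : u ∈ B then g * x ⟨u, h⟩ else 0

theorem continuous_extendPotential {d : ℕ} (B : Finset (Fin d → ℤ)) (g : ℝ) (u : Fin d → ℤ) :
    Continuous fun x => extendPotential B g x u := by
  unfold extendPotential
  by_cases h : u ∈ B
  · simp only [h, dif_pos]
    fun_prop
  · simp only [h, dif_neg, not_false_iff]
    fun_prop

/-- The potentials on a line for which two operators, one of which is moved along, resonate. -/
theorem volume_resonant_shift_le {d : ℕ} {V : (Fin d → ℤ) → ℝ} {S₀ S₁ : Finset (Fin d → ℤ)}
    {g ε : ℝ} (hg : 0 < g) (hε : 0 < ε) :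
    volume {τ : ℝ | ∃ E, Resonant V S₀ E ε ∧ Resonant V S₁ (E - g * τ) ε} ≤
      ENNReal.ofReal (S₀.card * S₁.card * (4 * ε / g)) := by
  have b₀ := (nonempty_eigenBasis V S₀).some
  have b₁ := (nonempty_eigenBasis V S₁).some
  have hsub : {τ : ℝ | ∃ E, Resonant V S₀ E ε ∧ Resonant V S₁ (E - g * τ) ε} ⊆
      ⋃ p : S₀ × S₁, Metric.ball ((b₀.E p.1 - b₁.E p.2) / g) (2 * ε / g) := by
    rintro τ ⟨E, h₀, h₁⟩
    obtain ⟨i, hi⟩ := b₀.exists_eigenvalue_of_resonant hε h₀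
    obtain ⟨j, hj⟩ := b₁.exists_eigenvalue_of_resonant hε h₁
    refine Set.mem_iUnion.2 ⟨(i, j), ?_⟩
    rw [Metric.mem_ball, Real.dist_eq]
    have h2 : |g * τ - (b₀.E i - b₁.E j)| < 2 * ε := by
      rw [abs_lt] at hi hj ⊢
      constructor <;> linarith [hi.1, hi.2, hj.1, hj.2]
    have h3 : τ - (b₀.E i - b₁.E j) / g = (g * τ - (b₀.E i - b₁.E j)) / g := by field_simp
    rw [h3, abs_div, abs_of_pos hg]
    exact div_lt_div_of_pos_right h2 hg
  calc _ ≤ volume (⋃ p : S₀ × S₁, Metric.ball ((b₀.E p.1 - b₁.E p.2) / g) (2 * ε / g)) :=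
        measure_mono hsub
    _ ≤ ∑ p : S₀ × S₁, volume (Metric.ball ((b₀.E p.1 - b₁.E p.2) / g) (2 * ε / g)) :=
        measure_iUnion_fintype_le _ _
    _ = ∑ _p : S₀ × S₁, ENNReal.ofReal (4 * ε / g) := by
        refine Finset.sum_congr rfl fun p _ => ?_
        rw [Real.volume_ball]
        congr 1
        ring
    _ = _ := by
        rw [Finset.sum_const, Finset.card_univ, Fintype.card_prod, Fintype.card_coe,
          Fintype.card_coe, nsmul_eq_mul, ENNReal.ofReal_mul (by positivity),
          ENNReal.ofReal_mul (by positivity)]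
        simp

/-- Wegner-type estimate: the probability that `J + 1` disjoint sets resonate simultaneously. -/
theorem measure_resonant_le {Θ : Type*} [MeasurableSpace Θ] {d J : ℕ} {P : Measure Θ}
    (B : Finset (Fin d → ℤ)) {X : B → Θ → ℝ} (hX : HasGaussianLaw (fun θ k => X k θ) P) {lam : ℝ}
    (hlam : 0 < lam)
    (hvar : ∀ (u : B → ℝ) (k : B), lam * u k ^ 2 ≤ Var[fun θ => ∑ i, u i * X i θ; P])
    {g ε : ℝ} (hg : 0 < g) (hε : 0 < ε) (S : Fin (J + 1) → Finset (Fin d → ℤ))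
    (hSB : ∀ i, S i ⊆ B) (hdisj : ∀ i j, i ≠ j → Disjoint (S i) (S j)) :
    P {θ | ∃ E, ∀ i, Resonant (extendPotential B g fun k => X k θ) (S i) E ε} ≤
      ENNReal.ofReal (B.card ^ 3 / Real.sqrt lam * (4 * ε / g)) ^ J := by
  classical
  have := hX.isProbabilityMeasure
  set p := ENNReal.ofReal (B.card ^ 3 / Real.sqrt lam * (4 * ε / g)) with hp
  -- A simultaneous resonance is weakened to `J` pair resonances with `S 0`, at energies that may
  -- depend on `j`. A constant added to the potential on `S j` affects `F j` but no other `F i`, so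
  -- each `j` contributes its own small factor.
  let F : Fin (J + 1) → Set (B → ℝ) := fun j => {x | ∃ E,
    Resonant (extendPotential B g x) (S 0) E ε ∧ Resonant (extendPotential B g x) (S j) E ε}
  have hFm : ∀ j, MeasurableSet (F j) := by
    intro j
    have h1 := isOpen_resonant (continuous_extendPotential B g) (fun i : Fin 2 => S (![0, j] i)) ε
    convert h1.measurableSet using 1
    ext x
    simp [F, Fin.forall_fin_two]
  -- effect of a shift
  let one : Fin (J + 1) → B → ℝ := fun j k => if (k : Fin d → ℤ) ∈ S j then 1 else 0
  have hsh : ∀ (x : B → ℝ) (τ : ℝ) (j i : Fin (J + 1)), i ≠ j → ∀ u ∈ S i,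
      extendPotential B g (fun k => x k + τ * one j k) u = extendPotential B g x u := by
    intro x τ j i hij u hu
    have h1 : u ∉ S j := Finset.disjoint_left.1 (hdisj i j hij) hu
    simp [extendPotential, one, h1, hSB i hu]
  have hsh' : ∀ (x : B → ℝ) (τ : ℝ) (j : Fin (J + 1)), ∀ u ∈ S j,
      extendPotential B g (fun k => x k + τ * one j k) u = extendPotential B g x u + g * τ := by
    intro x τ j u hu
    simp [extendPotential, one, hu, hSB j hu, mul_add]
  have main : ∀ T : Finset (Fin (J + 1)), 0 ∉ T →
      P {θ | (fun k => X k θ) ∈ ⋂ j ∈ T, F j} ≤ p ^ T.card := by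
    intro T
    induction T using Finset.induction_on with
    | empty =>
      intro _
      simp
    | insert j T hjT ih =>
      intro h0
      rw [Finset.mem_insert, not_or] at h0
      obtain ⟨h0j, h0T⟩ := h0
      have ih' := ih h0T
      rw [Finset.card_insert_of_notMem hjT, pow_succ']
      rcases (S j).eq_empty_or_nonempty with hSj | hSj
      · have : {θ | (fun k => X k θ) ∈ ⋂ i ∈ insert j T, F i} = ∅ := by
          ext θ
          simp only [Set.mem_ofPred_eq, Set.mem_iInter, Set.mem_empty_iff_false, iff_false]
          intro h
          obtain ⟨E, -, hE⟩ := h j (Finset.mem_insert_self _ _)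
          have := hE.nonempty
          rw [hSj] at this
          simp at this
        rw [this, measure_empty]
        exact zero_le
      set S' : Finset B := Finset.univ.filter fun k => (k : Fin d → ℤ) ∈ S j with hS'
      have hone : ∀ k, (if k ∈ S' then (1 : ℝ) else 0) = one j k := fun k => by simp [hS', one]
      have hS'ne : S'.Nonempty := by
        obtain ⟨u, hu⟩ := hSj
        exact ⟨⟨u, hSB j hu⟩, by simp [hS', hu]⟩
      have h1 := measure_inter_le_of_shift hX hlam hvar S' hS'ne (hFm j)
        (G := ⋂ i ∈ T, F i) (Finset.measurableSet_biInter _ fun i _ => hFm i) ?_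
        (v := ENNReal.ofReal (B.card ^ 2 * (4 * ε / g))) ?_
      · have e : {θ | (fun k => X k θ) ∈ ⋂ i ∈ insert j T, F i} =
            {θ | (fun k => X k θ) ∈ (⋂ i ∈ T, F i) ∧ (fun k => X k θ) ∈ F j} := by
          ext θ
          simp only [Set.mem_ofPred_eq, Set.mem_iInter, Finset.mem_insert, forall_eq_or_imp]
          tauto
        rw [e]
        refine h1.trans (mul_le_mul' (le_of_eq ?_) ih')
        rw [← ENNReal.ofReal_mul (by positivity), hp, Fintype.card_coe]
        congr 1
        ring
      · intro x τ
        simp only [hone, Set.mem_iInter]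
        refine forall₂_congr fun i hi => ?_
        have hij : i ≠ j := fun h => hjT (h ▸ hi)
        constructor
        · rintro ⟨E, h2, h3⟩
          exact ⟨E, h2.congr (hsh x τ j 0 h0j), h3.congr (hsh x τ j i hij)⟩
        · rintro ⟨E, h2, h3⟩
          exact ⟨E, h2.congr fun u hu => (hsh x τ j 0 h0j u hu).symm,
            h3.congr fun u hu => (hsh x τ j i hij u hu).symm⟩
      · intro x
        simp only [hone]
        refine (measure_mono ?_).trans ((volume_resonant_shift_le (V := extendPotential B g x)
          (S₀ := S 0) (S₁ := S j) hg hε).trans (ENNReal.ofReal_le_ofReal ?_))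
        · rintro τ ⟨E, h2, h3⟩
          exact ⟨E, h2.congr (hsh x τ j 0 h0j), h3.shift (hsh' x τ j)⟩
        · have h2 : ((S 0).card : ℝ) ≤ B.card := by exact_mod_cast Finset.card_le_card (hSB 0)
          have h3 : ((S j).card : ℝ) ≤ B.card := by exact_mod_cast Finset.card_le_card (hSB j)
          have : (0 : ℝ) ≤ 4 * ε / g := by positivity
          refine mul_le_mul_of_nonneg_right ?_ this
          rw [sq]
          exact mul_le_mul h2 h3 (by positivity) (by positivity)
  have hcard : (Finset.univ.erase (0 : Fin (J + 1))).card = J := by simp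
  have h2 := main (Finset.univ.erase 0) (by simp)
  rw [hcard] at h2
  refine (measure_mono ?_).trans h2
  rintro θ ⟨E, hE⟩
  simp only [Set.mem_ofPred_eq, Set.mem_iInter]
  exact fun j _ => ⟨E, hE 0, hE j⟩

/-! ### Gaussian sums -/

theorem map_sum_eq_gaussianReal {Θ ι : Type*} [MeasurableSpace Θ] {P : Measure Θ}
    [IsProbabilityMeasure P]
    {ξ : ι → Θ → ℝ} (hlaw : ∀ i, HasLaw (ξ i) (gaussianReal 0 1) P) (hind : iIndepFun ξ P)
    (T : Finset ι) (c : ι → ℝ) :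
    HasLaw (fun θ => ∑ i ∈ T, c i * ξ i θ) (gaussianReal 0 (∑ i ∈ T, c i ^ 2).toNNReal) P := by
  classical
  have hG : ∀ i, HasGaussianLaw (ξ i) P := fun i => (hlaw i).hasGaussianLaw
  have hT := iIndepFun.hasGaussianLaw (fun i : T => hG i)
    (hind.precomp (g := fun i : T => (i : ι)) Subtype.val_injective)
  let L : (T → ℝ) →L[ℝ] ℝ := ∑ i : T, c i • ContinuousLinearMap.proj (R := ℝ) i
  have hL : ∀ x, L x = ∑ i : T, c i * x i := fun x => by simp [L]
  have e : (fun θ => ∑ i ∈ T, c i * ξ i θ) = fun θ => L fun i => ξ i θ := by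
    funext θ
    rw [hL]
    exact (Finset.sum_coe_sort T fun i => c i * ξ i θ).symm
  have hS : HasGaussianLaw (fun θ => ∑ i ∈ T, c i * ξ i θ) P := by
    rw [e]
    exact hT.map_fun L
  refine ⟨hS.aemeasurable, ?_⟩
  rw [hS.map_eq_gaussianReal]
  have hmean : ∀ i, P[ξ i] = 0 := fun i => by
    rw [(hlaw i).integral_eq, integral_id_gaussianReal]
  have hvar : ∀ i, Var[ξ i; P] = 1 := fun i => by
    rw [(hlaw i).variance_eq, variance_id_gaussianReal]
    simp
  congr 1
  · rw [integral_finsetSum _ fun i _ => (hG i).integrable.const_mul _]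
    refine Finset.sum_eq_zero fun i _ => ?_
    rw [integral_const_mul, hmean, mul_zero]
  · congr 1
    have h1 : (fun θ => ∑ i ∈ T, c i * ξ i θ) = ∑ i ∈ T, fun θ => c i * ξ i θ := by
      funext θ
      simp
    rw [h1, IndepFun.variance_sum (fun i _ => (hG i).memLp_two.const_mul _)
      fun i _ j _ hij => (hind.indepFun hij).comp (measurable_const_mul _) (measurable_const_mul _)]
    refine Finset.sum_congr rfl fun i _ => ?_
    rw [variance_const_mul, hvar, mul_one]

/-- An almost sure limit of centred Gaussian variables is Gaussian. -/
theorem map_eq_gaussianReal_of_tendsto {Θ : Type*} [MeasurableSpace Θ] {P : Measure Θ}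
    [IsProbabilityMeasure P] {Y : ℕ → Θ → ℝ} {Z : Θ → ℝ} {w : ℕ → NNReal} {w' : NNReal}
    (hY : ∀ n, HasLaw (Y n) (gaussianReal 0 (w n)) P)
    (hlim : ∀ᵐ θ ∂P, Tendsto (fun n => Y n θ) atTop (𝓝 (Z θ)))
    (hw : Tendsto w atTop (𝓝 w')) : HasLaw Z (gaussianReal 0 w') P := by
  have hZ : AEMeasurable Z P := aemeasurable_of_tendsto_metrizable_ae _ (fun n => (hY n).aemeasurable)
    hlim
  refine ⟨hZ, ?_⟩
  have : IsProbabilityMeasure (P.map Z) := Measure.isProbabilityMeasure_map hZ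
  refine Measure.ext_of_charFun ?_
  ext t
  rw [charFun_gaussianReal]
  have h1 : ∀ n, ∫ θ, Complex.exp (t * Y n θ * Complex.I) ∂P =
      Complex.exp (t * (0 : ℝ) * Complex.I - w n * t ^ 2 / 2) := by
    intro n
    rw [← charFun_gaussianReal, ← (hY n).map_eq, charFun_apply_real,
      integral_map (hY n).aemeasurable (by fun_prop)]
  rw [charFun_apply_real, integral_map hZ (by fun_prop)]
  have h2 : Tendsto (fun n => ∫ θ, Complex.exp (t * Y n θ * Complex.I) ∂P) atTop
      (𝓝 (∫ θ, Complex.exp (t * Z θ * Complex.I) ∂P)) := by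
    refine tendsto_integral_of_dominated_convergence (fun _ => (1 : ℝ)) (fun n => ?_)
      (integrable_const _) (fun n => ?_) ?_
    · have := (hY n).aemeasurable
      exact AEMeasurable.aestronglyMeasurable (by fun_prop)
    · refine Filter.Eventually.of_forall fun θ => ?_
      rw [← Complex.ofReal_mul, Complex.norm_exp_ofReal_mul_I]
    · filter_upwards [hlim] with θ hθ
      have hc : Continuous fun y : ℝ => Complex.exp (t * y * Complex.I) := by fun_prop
      exact (hc.tendsto _).comp hθ
  refine tendsto_nhds_unique h2 ?_
  simp only [h1]
  have hc : Continuous fun y : NNReal => Complex.exp (t * (0 : ℝ) * Complex.I - y * t ^ 2 / 2) := by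
    fun_prop
  exact (hc.tendsto _).comp hw

/-- The random variable `(γ_k Re z_k + h_k Im z_k) / √W_k`. -/
noncomputable def gaussTerm {ν : ℕ} {Θ : Type*} (W : (Fin ν → ℤ) → ℝ)
    (γ h : (Fin ν → ℤ) → Θ → ℝ) (z : (Fin ν → ℤ) → ℂ) (k : Fin ν → ℤ) (θ : Θ) : ℝ :=
  (γ k θ * (z k).re + h k θ * (z k).im) / Real.sqrt (W k)

theorem hasLaw_sum_gaussTerm {ν : ℕ} {Θ : Type*} [MeasurableSpace Θ] {P : Measure Θ}
    [IsProbabilityMeasure P] {W : (Fin ν → ℤ) → ℝ} (hW : ∀ k, 0 < W k)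
    {γ h : (Fin ν → ℤ) → Θ → ℝ} (hγh : IsStdGaussianFamily P γ h) (z : (Fin ν → ℤ) → ℂ)
    (F : Finset (Fin ν → ℤ)) :
    HasLaw (fun θ => ∑ k ∈ F, gaussTerm W γ h z k θ)
      (gaussianReal 0 (∑ k ∈ F, ‖z k‖ ^ 2 / W k).toNNReal) P := by
  have hlaw : ∀ i, HasLaw (Sum.elim γ h i) (gaussianReal 0 1) P := by
    rintro (k | k)
    · exact hγh.law_left k
    · exact hγh.law_right k
  have key := map_sum_eq_gaussianReal hlaw hγh.indep (F.disjSum F)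
    (Sum.elim (fun k => (z k).re / Real.sqrt (W k)) fun k => (z k).im / Real.sqrt (W k))
  simp only [Finset.sum_disjSum, Sum.elim_inl, Sum.elim_inr, ← Finset.sum_add_distrib] at key
  have e1 : ∀ k, ((z k).re / Real.sqrt (W k)) ^ 2 + ((z k).im / Real.sqrt (W k)) ^ 2 =
      ‖z k‖ ^ 2 / W k := by
    intro k
    rw [div_pow, div_pow, Real.sq_sqrt (hW k).le, ← add_div, ← Complex.normSq_eq_norm_sq,
      Complex.normSq_apply]
    ring
  simp only [e1] at key
  convert key using 4 with θ k
  rw [gaussTerm]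
  ring

theorem seriesTerm_eq_gaussTerm {ν : ℕ} {Θ : Type*} (W : (Fin ν → ℤ) → ℝ)
    (γ h : (Fin ν → ℤ) → Θ → ℝ) (ω : UnitAddTorus (Fin ν)) :
    seriesTerm W γ h ω = gaussTerm W γ h fun k => UnitAddTorus.mFourier k ω := rfl

theorem norm_mFourier_apply {ν : ℕ} (k : Fin ν → ℤ) (ω : UnitAddTorus (Fin ν)) :
    ‖UnitAddTorus.mFourier k ω‖ = 1 := by
  simp only [UnitAddTorus.mFourier, ContinuousMap.coe_mk, fourier_apply, norm_prod]
  exact Finset.prod_eq_one fun _ _ => Circle.norm_coe _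

/-- The exponential sum with weights `u` at the points `p`. -/
noncomputable def expSum {ν : ℕ} {I : Type*} [Fintype I] (p : I → UnitAddTorus (Fin ν))
    (u : I → ℝ) (k : Fin ν → ℤ) : ℂ := ∑ i, (u i : ℂ) * UnitAddTorus.mFourier k (p i)

theorem sum_mul_seriesTerm {ν : ℕ} {Θ I : Type*} [Fintype I] (W : (Fin ν → ℤ) → ℝ)
    (γ h : (Fin ν → ℤ) → Θ → ℝ) (p : I → UnitAddTorus (Fin ν)) (u : I → ℝ) (k : Fin ν → ℤ)
    (θ : Θ) :
    ∑ i, u i * seriesTerm W γ h (p i) k θ = gaussTerm W γ h (expSum p u) k θ := by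
  simp only [seriesTerm, gaussTerm, expSum, Complex.re_sum, Complex.im_sum, Complex.re_ofReal_mul,
    Complex.im_ofReal_mul, Finset.mul_sum, ← Finset.sum_add_distrib, Finset.sum_div]
  refine Finset.sum_congr rfl fun i _ => ?_
  ring

/-- The partial sums are centred Gaussian, with the partial sums of the series as variances.
Mean-square convergence gives convergence in measure, hence almost sure convergence along one
sequence of finite sets that serves all the points `p i`; an almost sure limit of Gaussians is
Gaussian. -/
theorem IsContinuousVersion.hasLaw_sum {ν : ℕ} {Θ I : Type*} [Fintype I] [MeasurableSpace Θ]
    {P : Measure Θ} [IsProbabilityMeasure P] {W : (Fin ν → ℤ) → ℝ} (hW : ∀ k, 0 < W k)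
    (hWs : Summable fun k => (W k)⁻¹)
    {γ h : (Fin ν → ℤ) → Θ → ℝ} (hγh : IsStdGaussianFamily P γ h)
    {v : Θ → C(UnitAddTorus (Fin ν), ℝ)} (hv : IsContinuousVersion P W γ h v)
    (p : I → UnitAddTorus (Fin ν)) (u : I → ℝ) :
    HasLaw (fun θ => ∑ i, u i * v θ (p i))
      (gaussianReal 0 (∑' k, ‖expSum p u k‖ ^ 2 / W k).toNNReal) P := by
  have hterm : ∀ (ω : UnitAddTorus (Fin ν)) (k : Fin ν → ℤ),
      AEStronglyMeasurable (seriesTerm W γ h ω k) P := by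
    intro ω k
    have h1 := (hγh.law_left k).aemeasurable
    have h2 := (hγh.law_right k).aemeasurable
    refine AEMeasurable.aestronglyMeasurable ?_
    unfold seriesTerm
    fun_prop
  have hmeas : ∀ i, TendstoInMeasure P (fun (F : Finset (Fin ν → ℤ)) θ =>
      ∑ k ∈ F, seriesTerm W γ h (p i) k θ) atTop (fun θ => v θ (p i)) := by
    intro i
    refine tendstoInMeasure_of_tendsto_eLpNorm (p := 2) (by norm_num) (fun F => ?_)
      (hv.measurable (p i)).aestronglyMeasurable (hv.sum (p i))
    exact Finset.aestronglyMeasurable_fun_sum _ fun k _ => hterm _ k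
  -- a common sequence along which all the series converge
  have hseq : ∀ T : Finset I, ∃ F : ℕ → Finset (Fin ν → ℤ), Tendsto F atTop atTop ∧
      ∀ᵐ θ ∂P, ∀ i ∈ T, Tendsto (fun n => ∑ k ∈ F n, seriesTerm W γ h (p i) k θ) atTop
        (𝓝 (v θ (p i))) := by
    classical
    intro T
    induction T using Finset.induction_on with
    | empty =>
      obtain ⟨F, hF⟩ := (atTop : Filter (Finset (Fin ν → ℤ))).exists_seq_tendsto
      exact ⟨F, hF, by simp⟩
    | insert i T _ ih =>
      obtain ⟨F, hF, hFT⟩ := ih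
      have h1 : TendstoInMeasure P (fun n θ => ∑ k ∈ F n, seriesTerm W γ h (p i) k θ) atTop
          (fun θ => v θ (p i)) := (hmeas i).comp hF
      obtain ⟨ns, hns, hae⟩ := h1.exists_seq_tendsto_ae
      refine ⟨F ∘ ns, hF.comp hns.tendsto_atTop, ?_⟩
      filter_upwards [hFT, hae] with θ h2 h3 j hj
      rcases Finset.mem_insert.1 hj with rfl | hj
      · exact h3
      · exact (h2 j hj).comp hns.tendsto_atTop
  obtain ⟨F, hF, hFlim⟩ := hseq Finset.univ
  have hsum : Summable fun k => ‖expSum p u k‖ ^ 2 / W k := by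
    refine Summable.of_nonneg_of_le (fun k => div_nonneg (by positivity) (hW k).le) (fun k => ?_)
      (hWs.mul_left ((∑ i, |u i|) ^ 2))
    rw [div_eq_mul_inv]
    refine mul_le_mul_of_nonneg_right (pow_le_pow_left₀ (norm_nonneg _) ?_ 2)
      (inv_nonneg.2 (hW k).le)
    refine (norm_sum_le _ _).trans (Finset.sum_le_sum fun i _ => ?_)
    rw [norm_mul, norm_mFourier_apply, mul_one, Complex.norm_real, Real.norm_eq_abs]
  refine map_eq_gaussianReal_of_tendsto
    (fun n => hasLaw_sum_gaussTerm hW hγh (expSum p u) (F n)) ?_ ?_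
  · filter_upwards [hFlim] with θ hθ
    have h1 : Tendsto (fun n => ∑ i, u i * ∑ k ∈ F n, seriesTerm W γ h (p i) k θ) atTop
        (𝓝 (∑ i, u i * v θ (p i))) :=
      tendsto_finsetSum _ fun i _ => (hθ i (Finset.mem_univ i)).const_mul _
    refine h1.congr fun n => ?_
    simp only [Finset.mul_sum]
    rw [Finset.sum_comm]
    exact Finset.sum_congr rfl fun k _ => sum_mul_seriesTerm W γ h p u k θ
  · exact (continuous_real_toNNReal.tendsto _).comp (hsum.hasSum.comp hF)

/-- Every linear functional of the vector is a sum of the form treated in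
`IsContinuousVersion.hasLaw_sum`. -/
theorem IsContinuousVersion.hasGaussianLaw {ν : ℕ} {Θ I : Type*} [Fintype I] [MeasurableSpace Θ]
    {P : Measure Θ} [IsProbabilityMeasure P] {W : (Fin ν → ℤ) → ℝ} (hW : ∀ k, 0 < W k)
    (hWs : Summable fun k => (W k)⁻¹)
    {γ h : (Fin ν → ℤ) → Θ → ℝ} (hγh : IsStdGaussianFamily P γ h)
    {v : Θ → C(UnitAddTorus (Fin ν), ℝ)} (hv : IsContinuousVersion P W γ h v)
    (p : I → UnitAddTorus (Fin ν)) : HasGaussianLaw (fun θ i => v θ (p i)) P where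
  isGaussian_map := by
    classical
    refine isGaussian_of_map_eq_gaussianReal fun L => ⟨0,
      (∑' k, ‖expSum p (fun i => L (Pi.single i 1)) k‖ ^ 2 / W k).toNNReal, ?_⟩
    · rw [Measure.map_map L.continuous.measurable
        (measurable_pi_lambda _ fun i => hv.measurable (p i))]
      have e : L ∘ (fun θ i => v θ (p i)) = fun θ => ∑ i, L (Pi.single i 1) * v θ (p i) := by
        funext θ
        have h1 := L.toLinearMap.pi_apply_eq_sum_univ fun i => v θ (p i)
        simp only [ContinuousLinearMap.coe_coe, smul_eq_mul] at h1
        rw [Function.comp_apply, h1]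
        refine Finset.sum_congr rfl fun i _ => ?_
        rw [mul_comm]
        congr 2
        funext j
        simp [Pi.single_apply, eq_comm]
      rw [e]
      exact (hv.hasLaw_sum hW hWs hγh p _).map_eq

/-- The variance is a sum of nonnegative terms over frequencies, so one term bounds it from below.
Nondegeneracy is thereby reduced to finding a single frequency, not too large, with a large
exponential sum. -/
theorem IsContinuousVersion.le_variance {ν : ℕ} {Θ I : Type*} [Fintype I] [MeasurableSpace Θ]
    {P : Measure Θ} [IsProbabilityMeasure P] {W : (Fin ν → ℤ) → ℝ} (hW : ∀ k, 0 < W k)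
    (hWs : Summable fun k => (W k)⁻¹)
    {γ h : (Fin ν → ℤ) → Θ → ℝ} (hγh : IsStdGaussianFamily P γ h)
    {v : Θ → C(UnitAddTorus (Fin ν), ℝ)} (hv : IsContinuousVersion P W γ h v)
    (p : I → UnitAddTorus (Fin ν)) (u : I → ℝ) (k : Fin ν → ℤ) :
    ‖expSum p u k‖ ^ 2 / W k ≤ Var[fun θ => ∑ i, u i * v θ (p i); P] := by
  have hsum : Summable fun k => ‖expSum p u k‖ ^ 2 / W k := by
    refine Summable.of_nonneg_of_le (fun k => div_nonneg (by positivity) (hW k).le) (fun k => ?_)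
      (hWs.mul_left ((∑ i, |u i|) ^ 2))
    rw [div_eq_mul_inv]
    refine mul_le_mul_of_nonneg_right (pow_le_pow_left₀ (norm_nonneg _) ?_ 2)
      (inv_nonneg.2 (hW k).le)
    refine (norm_sum_le _ _).trans (Finset.sum_le_sum fun i _ => ?_)
    rw [norm_mul, norm_mFourier_apply, mul_one, Complex.norm_real, Real.norm_eq_abs]
  have h0 : ∀ k, 0 ≤ ‖expSum p u k‖ ^ 2 / W k := fun k => div_nonneg (by positivity) (hW k).le
  rw [(hv.hasLaw_sum hW hWs hγh p u).variance_eq, variance_id_gaussianReal,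
    Real.coe_toNNReal _ (tsum_nonneg h0)]
  exact hsum.le_tsum k fun j _ => h0 j

/-! ### Non-degeneracy of the hull function along orbits -/

theorem four_mul_norm_le_norm_toCircle_sub_one (t : UnitAddCircle) :
    4 * ‖t‖ ≤ ‖(AddCircle.toCircle t : ℂ) - 1‖ := by
  obtain ⟨x, rfl⟩ := QuotientAddGroup.mk_surjective t
  have h0 : ((x - round x : ℝ) : UnitAddCircle) = (x : UnitAddCircle) := by
    rw [AddCircle.coe_sub, sub_eq_self]
    exact (AddCircle.coe_eq_zero_iff (1 : ℝ)).2 ⟨round x, by simp⟩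
  have h1 : ‖(x : UnitAddCircle)‖ = |x - round x| := UnitAddCircle.norm_eq
  have h2 : |x - round x| ≤ 1 / 2 := abs_sub_round x
  change 4 * ‖(x : UnitAddCircle)‖ ≤ ‖(AddCircle.toCircle (x : UnitAddCircle) : ℂ) - 1‖
  rw [h1, ← h0, AddCircle.toCircle_apply_mk, Circle.coe_exp]
  generalize x - round x = s at h2
  have h3 := Complex.norm_exp_I_mul_ofReal_sub_one (2 * Real.pi / 1 * s)
  rw [mul_comm Complex.I] at h3
  rw [h3, Real.norm_eq_abs, abs_mul, abs_two]
  have e : 2 * Real.pi / 1 * s / 2 = Real.pi * s := by ring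
  rw [e]
  have h4 : |Real.pi * s| ≤ Real.pi / 2 := by
    rw [abs_mul, abs_of_pos Real.pi_pos]
    nlinarith [Real.pi_pos]
  have h5 := Real.mul_abs_le_abs_sin h4
  rw [abs_mul, abs_of_pos Real.pi_pos, ← mul_assoc, div_mul_cancel₀ _ Real.pi_pos.ne'] at h5
  linarith

theorem norm_sum_toCircle_pow_le (t : UnitAddCircle) (D : ℕ) :
    ‖∑ j ∈ Finset.range D, (AddCircle.toCircle t : ℂ) ^ j‖ ≤ D := by
  refine (norm_sum_le _ _).trans ?_
  have h : ‖(AddCircle.toCircle t : ℂ)‖ = 1 := Circle.norm_coe _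
  simp [norm_pow, h]

/-- Multiplied by `z - 1` the geometric sum telescopes to `z ^ D - 1`, and `‖z - 1‖ ≥ 4 ‖t‖`. -/
theorem norm_sum_toCircle_pow_le_inv {t : UnitAddCircle} {r : ℝ} (hr : 0 < r) (ht : r ≤ ‖t‖)
    (D : ℕ) :
    ‖∑ j ∈ Finset.range D, (AddCircle.toCircle t : ℂ) ^ j‖ ≤ 1 / (2 * r) := by
  set z : ℂ := (AddCircle.toCircle t : ℂ) with hz
  have hn : ‖z‖ = 1 := Circle.norm_coe _
  have h1 := four_mul_norm_le_norm_toCircle_sub_one t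
  have h2 : ‖(z - 1) * ∑ j ∈ Finset.range D, z ^ j‖ ≤ 2 := by
    rw [mul_geom_sum]
    refine (norm_sub_le _ _).trans ?_
    rw [norm_pow, hn]
    norm_num
  rw [norm_mul] at h2
  rw [le_div_iff₀ (by positivity)]
  have h3 : 4 * r ≤ ‖z - 1‖ := by linarith
  have h4 := mul_le_mul_of_nonneg_right h3 (norm_nonneg (∑ j ∈ Finset.range D, z ^ j))
  linarith

theorem mFourier_natCast_apply {ν : ℕ} (m : Fin ν → ℕ) (x : UnitAddTorus (Fin ν)) :
    UnitAddTorus.mFourier (fun c => (m c : ℤ)) x =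
      ∏ c, (AddCircle.toCircle (x c) : ℂ) ^ m c := by
  simp only [UnitAddTorus.mFourier, ContinuousMap.coe_mk, fourier_apply]
  refine Finset.prod_congr rfl fun c _ => ?_
  rw [natCast_zsmul, AddCircle.toCircle_nsmul]
  simp

theorem conj_mFourier_natCast_mul {ν : ℕ} (m : Fin ν → ℕ) (x y : UnitAddTorus (Fin ν)) :
    (starRingEnd ℂ) (UnitAddTorus.mFourier (fun c => (m c : ℤ)) x) *
      UnitAddTorus.mFourier (fun c => (m c : ℤ)) y =
      ∏ c, (AddCircle.toCircle (y c - x c) : ℂ) ^ m c := by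
  rw [mFourier_natCast_apply, mFourier_natCast_apply, map_prod, ← Finset.prod_mul_distrib]
  refine Finset.prod_congr rfl fun c _ => ?_
  rw [map_pow, ← mul_pow, sub_eq_add_neg, AddCircle.toCircle_add, AddCircle.toCircle_neg,
    Circle.coe_mul, Circle.coe_inv_eq_conj, mul_comm]

/-- Each coordinate of the frequency is a sum of `n` digits below `D`. Summing over the digits
produces the `n`-th power of a Dirichlet-type kernel in each coordinate, which is sharply peaked at
`t = 0`. -/
theorem sum_prod_toCircle_pow {ν : ℕ} (t : Fin ν → UnitAddCircle) (n D : ℕ) :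
    ∑ j : Fin ν → Fin n → Fin D, ∏ c, (AddCircle.toCircle (t c) : ℂ) ^ (∑ m, (j c m : ℕ)) =
      ∏ c, (∑ j ∈ Finset.range D, (AddCircle.toCircle (t c) : ℂ) ^ j) ^ n := by
  have h1 : ∀ c, (∑ j ∈ Finset.range D, (AddCircle.toCircle (t c) : ℂ) ^ j) ^ n =
      ∑ j : Fin n → Fin D, (AddCircle.toCircle (t c) : ℂ) ^ (∑ m, (j m : ℕ)) := by
    intro c
    rw [Finset.sum_range, Fintype.sum_pow]
    refine Finset.sum_congr rfl fun j _ => ?_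
    rw [Finset.prod_pow_eq_pow_sum]
  simp only [h1]
  rw [Finset.prod_univ_sum, Fintype.piFinset_univ]

/-- If the points `p i` are `r`-separated from `p i₀`, some Fourier coefficient of
`∑ i, u i δ_{p i}` with small frequency is at least half of `|u i₀|`. -/
theorem exists_norm_expSum_ge {ν : ℕ} {I : Type*} [Fintype I] [DecidableEq I]
    (p : I → UnitAddTorus (Fin ν))
    (u : I → ℝ) (i₀ : I) (hu : ∀ i, |u i| ≤ |u i₀|) {r : ℝ} (hr : 0 < r)
    (hp : ∀ i, i ≠ i₀ → ∃ c, r ≤ ‖p i c - p i₀ c‖) {n D : ℕ} (hD : 0 < D)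
    (hN : (Fintype.card I : ℝ) * (1 / (2 * D * r)) ^ n ≤ 1 / 2) :
    ∃ k : Fin ν → ℤ, (∀ c, 0 ≤ k c ∧ k c ≤ n * D) ∧ |u i₀| / 2 ≤ ‖expSum p u k‖ := by
  set κ : (Fin ν → Fin n → Fin D) → (Fin ν → ℕ) := fun j c => ∑ m, (j c m : ℕ) with hκ
  have hκ' : ∀ j c, (κ j c : ℤ) ≤ n * D := by
    intro j c
    have : κ j c ≤ n * D := by
      refine (Finset.sum_le_sum fun m _ => (j c m).2.le).trans ?_
      simp
    exact_mod_cast this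
  suffices h : ∃ j, |u i₀| / 2 ≤ ‖expSum p u fun c => (κ j c : ℤ)‖ by
    obtain ⟨j, hj⟩ := h
    exact ⟨_, fun c => ⟨by positivity, hκ' j c⟩, hj⟩
  have : Nonempty (Fin D) := ⟨⟨0, hD⟩⟩
  set N : ℝ := ((D : ℝ) ^ n) ^ ν with hNdef
  have hNpos : 0 < N := by positivity
  have hcard : (Fintype.card (Fin ν → Fin n → Fin D) : ℝ) = N := by
    simp [hNdef]
  -- Averaging the exponential sum against the conjugate character at `p i₀` replaces the weight of
  -- each point by the kernel `Q`. It is maximal, equal to `N`, at `i₀`, and at the other points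
  -- smaller by `(1 / (2 D r)) ^ n`, so their total does not cancel more than half of the main term.
  set Q : I → ℂ := fun i =>
    ∏ c, (∑ j ∈ Finset.range D, (AddCircle.toCircle (p i c - p i₀ c) : ℂ) ^ j) ^ n with hQ
  have hsum : ∑ j, (starRingEnd ℂ) (UnitAddTorus.mFourier (fun c => (κ j c : ℤ)) (p i₀)) *
      expSum p u (fun c => (κ j c : ℤ)) = ∑ i, (u i : ℂ) * Q i := by
    simp only [expSum, Finset.mul_sum]
    rw [Finset.sum_comm]
    refine Finset.sum_congr rfl fun i _ => ?_
    rw [hQ]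
    simp only [← sum_prod_toCircle_pow, Finset.mul_sum]
    refine Finset.sum_congr rfl fun j _ => ?_
    rw [← conj_mFourier_natCast_mul]
    ring
  have hQ0 : Q i₀ = N := by
    simp [hQ, hNdef]
  have hQi : ∀ i, i ≠ i₀ → ‖Q i‖ ≤ N * (1 / (2 * D * r)) ^ n := by
    intro i hi
    obtain ⟨c, hc⟩ := hp i hi
    simp only [hQ, norm_prod, norm_pow]
    have h1 : N * (1 / (2 * D * r)) ^ n = (1 / (2 * r)) ^ n * ∏ _c' ∈ Finset.univ.erase c,
        (D : ℝ) ^ n := by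
      have hν : ν - 1 + 1 = ν := Nat.sub_add_cancel (Fin.pos c)
      rw [Finset.prod_const, Finset.card_erase_of_mem (Finset.mem_univ c), Finset.card_univ,
        Fintype.card_fin, hNdef]
      conv_lhs => rw [← hν, pow_succ, mul_assoc, ← mul_pow]
      have : (D : ℝ) * (1 / (2 * D * r)) = 1 / (2 * r) := by
        have : (D : ℝ) ≠ 0 := by positivity
        field_simp
      rw [this, mul_comm]
    rw [h1, ← Finset.mul_prod_erase _ _ (Finset.mem_univ c)]
    refine mul_le_mul (pow_le_pow_left₀ (norm_nonneg _) (norm_sum_toCircle_pow_le_inv hr hc D) n)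
      (Finset.prod_le_prod (fun _ _ => by positivity) fun c' _ =>
        pow_le_pow_left₀ (norm_nonneg _) (norm_sum_toCircle_pow_le _ D) n)
      (Finset.prod_nonneg fun _ _ => by positivity) (by positivity)
  by_contra! hcon
  have hlt : ‖∑ i, (u i : ℂ) * Q i‖ < N * (|u i₀| / 2) := by
    rw [← hsum, ← hcard, ← nsmul_eq_mul, ← Finset.card_univ, ← Finset.sum_const]
    refine (norm_sum_le _ _).trans_lt (Finset.sum_lt_sum_of_nonempty Finset.univ_nonempty
      fun j _ => ?_)
    rw [norm_mul, RCLike.norm_conj, norm_mFourier_apply, one_mul]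
    exact hcon j
  have hge : N * (|u i₀| / 2) ≤ ‖∑ i, (u i : ℂ) * Q i‖ := by
    rw [← Finset.add_sum_erase _ _ (Finset.mem_univ i₀), hQ0]
    have h1 : ‖∑ i ∈ Finset.univ.erase i₀, (u i : ℂ) * Q i‖ ≤ N * (|u i₀| / 2) := by
      have h2 : ‖∑ i ∈ Finset.univ.erase i₀, (u i : ℂ) * Q i‖ ≤
          ∑ i ∈ Finset.univ.erase i₀, |u i₀| * (N * (1 / (2 * D * r)) ^ n) := by
        refine (norm_sum_le _ _).trans (Finset.sum_le_sum fun i hi => ?_)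
        rw [norm_mul, Complex.norm_real, Real.norm_eq_abs]
        exact mul_le_mul (hu i) (hQi i (Finset.ne_of_mem_erase hi)) (norm_nonneg _) (abs_nonneg _)
      have h3 : ((Finset.univ.erase i₀).card : ℝ) ≤ Fintype.card I := by
        exact_mod_cast Finset.card_le_univ _
      rw [Finset.sum_const, nsmul_eq_mul] at h2
      have h4 := mul_le_mul_of_nonneg_right h3
        (show 0 ≤ |u i₀| * (N * (1 / (2 * D * r)) ^ n) by positivity)
      have h5 := mul_le_mul_of_nonneg_left hN (show 0 ≤ |u i₀| * N by positivity)
      nlinarith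
    have h2 : ‖(u i₀ : ℂ) * N‖ = |u i₀| * N := by
      rw [norm_mul, Complex.norm_real, Complex.norm_real, Real.norm_eq_abs, Real.norm_eq_abs,
        abs_of_pos hNpos]
    have h3 := norm_sub_le_norm_add ((u i₀ : ℂ) * N) (∑ i ∈ Finset.univ.erase i₀, (u i : ℂ) * Q i)
    rw [h2] at h3
    linarith
  exact absurd hlt (not_lt.2 hge)

/-- Distinct points of an orbit are separated. -/
theorem IsDiophantine.exists_le_norm_orbit_sub {ν d : ℕ} {α : Matrix (Fin ν) (Fin d) ℝ} {c A : ℝ}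
    (hν : 1 ≤ ν) (hα : IsDiophantine α c A) (ω : UnitAddTorus (Fin ν)) {x y : Fin d → ℤ}
    (hxy : x ≠ y) :
    ∃ i, c * latticeNorm (x - y) ^ (-A) ≤ ‖orbit α ω x i - orbit α ω y i‖ := by
  have h1 := hα (x - y) (sub_ne_zero.2 hxy)
  set t := freqVec α (x - y) with ht
  have hne : Nonempty (Fin ν) := ⟨⟨0, hν⟩⟩
  have h2 : Metric.infDist t (Set.range fun (k : Fin ν → ℤ) (i : Fin ν) => (k i : ℝ)) ≤
      dist t fun i => (round (t i) : ℝ) :=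
    Metric.infDist_le_dist_of_mem ⟨fun i => round (t i), rfl⟩
  obtain ⟨i, -, hi⟩ := Finset.exists_mem_eq_sup' (Finset.univ_nonempty (α := Fin ν))
    fun i => dist (t i) (round (t i) : ℝ)
  refine ⟨i, (h1.trans h2).trans ?_⟩
  have e : orbit α ω x i - orbit α ω y i = ((t i : ℝ) : UnitAddCircle) := by
    have : t i = freqVec α x i - freqVec α y i := by
      simp [ht, freqVec, Matrix.mulVec, dotProduct, mul_sub]
    simp only [orbit, this, AddCircle.coe_sub]
    abel
  rw [e, UnitAddCircle.norm_eq]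
  rw [dist_pi_le_iff (abs_nonneg _)]
  intro j
  have h3 := Finset.le_sup' (fun i => dist (t i) (round (t i) : ℝ)) (Finset.mem_univ j)
  rw [hi] at h3
  exact h3

/-- Quantitative linear independence of the values of the hull function along an orbit. -/
theorem exists_exp_mul_sq_le_variance {d ν : ℕ} (hd : 1 ≤ d) (hν : 1 ≤ ν)
    {W : (Fin ν → ℤ) → ℝ} (hW : ∀ k, 0 < W k) (hWs : Summable fun k => (W k)⁻¹)
    {C ζ : ℝ} (hC : 0 < C) (hζ : 0 < ζ)
    (hWu : ∀ k, W k ≤ C * Real.exp (C * ‖dualPoint k‖ ^ ζ))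
    {α : Matrix (Fin ν) (Fin d) ℝ} {A c : ℝ} (hA : 0 < A) (hc : 0 < c)
    (hα : IsDiophantine α c A) {Θ : Type*} [MeasurableSpace Θ] {P : Measure Θ}
    [IsProbabilityMeasure P] {γ h : (Fin ν → ℤ) → Θ → ℝ} (hγh : IsStdGaussianFamily P γ h)
    {v : Θ → C(UnitAddTorus (Fin ν), ℝ)} (hv : IsContinuousVersion P W γ h v) :
    ∃ K : ℝ, 0 < K ∧ ∀ M : ℕ, 1 ≤ M → ∀ (ω : UnitAddTorus (Fin ν))
      (u : box (0 : Fin d → ℤ) M → ℝ) (y : box (0 : Fin d → ℤ) M),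
      Real.exp (-(K * (M : ℝ) ^ ((A + 1) * ζ))) * u y ^ 2 ≤
        Var[fun θ => ∑ i, u i * v θ (orbit α ω i); P] := by
  set K₁ : ℝ := 3 * (2 * d) ^ A / c + 1 with hK₁
  set K₂ : ℝ := (2 * Real.pi * (d * K₁)) ^ ζ with hK₂
  have hd' : (1 : ℝ) ≤ d := by exact_mod_cast hd
  have hK₁pos : 0 < K₁ := by positivity
  have hK₂pos : 0 < K₂ := Real.rpow_pos_of_pos (by positivity) _
  refine ⟨C * K₂ + |Real.log (4 * C)|, by positivity, fun M hM ω u y => ?_⟩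
  have hM' : (1 : ℝ) ≤ M := by exact_mod_cast hM
  obtain ⟨i₀, -, hi₀⟩ := Finset.exists_max_image Finset.univ (fun i => |u i|) ⟨y, Finset.mem_univ y⟩
  set r : ℝ := c * (2 * d * M) ^ (-A) with hr
  have hrpos : 0 < r := mul_pos hc (Real.rpow_pos_of_pos (by positivity) _)
  have hsep : ∀ i : box (0 : Fin d → ℤ) M, i ≠ i₀ →
      ∃ j, r ≤ ‖orbit α ω i j - orbit α ω i₀ j‖ := by
    intro i hi
    have hne : (i : Fin d → ℤ) ≠ i₀ := fun e => hi (Subtype.ext e)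
    obtain ⟨j, hj⟩ := hα.exists_le_norm_orbit_sub hν ω hne
    refine ⟨j, le_trans ?_ hj⟩
    refine mul_le_mul_of_nonneg_left ?_ hc.le
    refine Real.rpow_le_rpow_of_nonpos ?_ ?_ (by linarith)
    · obtain ⟨l, hl⟩ := Function.ne_iff.1 hne
      refine Finset.sum_pos' (fun _ _ => abs_nonneg _) ⟨l, Finset.mem_univ l, ?_⟩
      rw [Pi.sub_apply, abs_pos]
      exact_mod_cast sub_ne_zero.2 hl
    · have h1 : ∀ l ∈ (Finset.univ : Finset (Fin d)),
          |(((i : Fin d → ℤ) - (i₀ : Fin d → ℤ)) l : ℝ)| ≤ 2 * M := by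
        intro l _
        have h2 := mem_box.1 i.2
        have h3 := mem_box.1 i₀.2
        have h4 := (natAbs_le_supDist (i : Fin d → ℤ) 0 l).trans (by simpa [supDist_comm] using h2)
        have h5 := (natAbs_le_supDist (i₀ : Fin d → ℤ) 0 l).trans (by simpa [supDist_comm] using h3)
        simp only [Pi.zero_apply, sub_zero] at h4 h5
        rw [Pi.sub_apply]
        have h6 : |(i : Fin d → ℤ) l - (i₀ : Fin d → ℤ) l| ≤ 2 * (M : ℤ) :=
          abs_le.2 ⟨by omega, by omega⟩
        exact_mod_cast h6
      refine (Finset.sum_le_sum h1).trans ?_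
      rw [Finset.sum_const, nsmul_eq_mul, Finset.card_univ, Fintype.card_fin]
      exact le_of_eq (by ring)
  -- With `d` digits per coordinate and `D r ≥ 3 M`, the kernel loses a factor `(6 M) ^ d` off the
  -- peak, which beats the `(2 M + 1) ^ d` sites of the box. As `r` is of order `M ^ (-A)`, the
  -- frequencies are of order `M ^ (A + 1)`.
  set D : ℕ := ⌈3 * M / r⌉₊ with hD
  have hDge : 3 * M / r ≤ D := Nat.le_ceil _
  have hDpos : 0 < D := Nat.ceil_pos.2 (by positivity)
  have hDle : (D : ℝ) ≤ K₁ * (M : ℝ) ^ (A + 1) := by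
    have h1 : (D : ℝ) ≤ 3 * M / r + 1 := (Nat.ceil_lt_add_one (by positivity)).le
    have h2 : 3 * M / r = 3 * (2 * d) ^ A / c * (M : ℝ) ^ (A + 1) := by
      rw [hr, Real.rpow_neg (by positivity), Real.mul_rpow (by positivity) (by positivity),
        Real.rpow_add_one (by positivity)]
      have : (0 : ℝ) < (2 * d) ^ A := Real.rpow_pos_of_pos (by positivity) _
      have : (0 : ℝ) < (M : ℝ) ^ A := Real.rpow_pos_of_pos (by positivity) _
      field_simp
    have h3 : (1 : ℝ) ≤ (M : ℝ) ^ (A + 1) := Real.one_le_rpow hM' (by linarith)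
    rw [h2] at h1
    rw [hK₁, add_mul, one_mul]
    linarith
  have hN : (Fintype.card (box (0 : Fin d → ℤ) M) : ℝ) * (1 / (2 * D * r)) ^ d ≤ 1 / 2 := by
    rw [Fintype.card_coe, card_box]
    push_cast
    rw [← mul_pow]
    have h1 : 3 * (M : ℝ) ≤ D * r := (div_le_iff₀ hrpos).1 hDge
    have h2 : (2 * (M : ℝ) + 1) * (1 / (2 * D * r)) ≤ 1 / 2 := by
      rw [mul_one_div, div_le_div_iff₀ (by positivity) (by norm_num)]
      linarith
    calc ((2 * (M : ℝ) + 1) * (1 / (2 * D * r))) ^ d ≤ (1 / 2) ^ d :=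
          pow_le_pow_left₀ (by positivity) h2 d
      _ ≤ (1 / 2) ^ 1 := pow_le_pow_of_le_one (by norm_num) (by norm_num) hd
      _ = 1 / 2 := pow_one _
  obtain ⟨k, hk, hku⟩ := exists_norm_expSum_ge (fun i : box (0 : Fin d → ℤ) M => orbit α ω i) u i₀
    (fun i => hi₀ i (Finset.mem_univ i)) hrpos hsep hDpos hN
  refine le_trans ?_ (hv.le_variance hW hWs hγh (fun i : box (0 : Fin d → ℤ) M => orbit α ω i) u k)
  have hdual : ‖dualPoint k‖ ≤ 2 * Real.pi * (d * K₁) * (M : ℝ) ^ (A + 1) := by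
    rw [pi_norm_le_iff_of_nonneg (by positivity)]
    intro l
    have h1 : (0 : ℝ) ≤ k l := by exact_mod_cast (hk l).1
    have h2 : (k l : ℝ) ≤ d * D := by exact_mod_cast (hk l).2
    rw [dualPoint, Real.norm_eq_abs, abs_of_nonneg (by positivity)]
    have h3 : (k l : ℝ) ≤ d * (K₁ * (M : ℝ) ^ (A + 1)) :=
      h2.trans (mul_le_mul_of_nonneg_left hDle (by positivity))
    calc 2 * Real.pi * (k l : ℝ) ≤ 2 * Real.pi * (d * (K₁ * (M : ℝ) ^ (A + 1))) :=
          mul_le_mul_of_nonneg_left h3 (by positivity)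
      _ = _ := by ring
  have hζdual : ‖dualPoint k‖ ^ ζ ≤ K₂ * (M : ℝ) ^ ((A + 1) * ζ) := by
    refine (Real.rpow_le_rpow (norm_nonneg _) hdual hζ.le).trans (le_of_eq ?_)
    rw [Real.mul_rpow (by positivity) (by positivity), Real.rpow_mul (by positivity)]
  have hWk : W k ≤ C * Real.exp (C * (K₂ * (M : ℝ) ^ ((A + 1) * ζ))) :=
    (hWu k).trans (mul_le_mul_of_nonneg_left (Real.exp_le_exp.2
      (mul_le_mul_of_nonneg_left hζdual hC.le)) hC.le)
  have h4W : 4 * W k ≤ Real.exp ((C * K₂ + |Real.log (4 * C)|) * (M : ℝ) ^ ((A + 1) * ζ)) := by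
    have hMb : (1 : ℝ) ≤ (M : ℝ) ^ ((A + 1) * ζ) := Real.one_le_rpow hM' (by positivity)
    have h1 : Real.log (4 * C) ≤ |Real.log (4 * C)| * (M : ℝ) ^ ((A + 1) * ζ) :=
      (le_abs_self _).trans (le_mul_of_one_le_right (abs_nonneg _) hMb)
    calc 4 * W k ≤ 4 * C * Real.exp (C * (K₂ * (M : ℝ) ^ ((A + 1) * ζ))) := by linarith
      _ = Real.exp (Real.log (4 * C) + C * (K₂ * (M : ℝ) ^ ((A + 1) * ζ))) := by
          rw [Real.exp_add, Real.exp_log (by positivity)]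
      _ ≤ _ := Real.exp_le_exp.2 (by linarith)
  have huy : u y ^ 2 ≤ u i₀ ^ 2 := sq_le_sq.2 (hi₀ y (Finset.mem_univ y))
  have hsq : u i₀ ^ 2 / 4 ≤ ‖expSum (fun i : box (0 : Fin d → ℤ) M => orbit α ω i) u k‖ ^ 2 := by
    have := pow_le_pow_left₀ (by positivity) hku 2
    rw [div_pow, sq_abs] at this
    linarith
  rw [Real.exp_neg, inv_mul_eq_div]
  calc u y ^ 2 / Real.exp ((C * K₂ + |Real.log (4 * C)|) * (M : ℝ) ^ ((A + 1) * ζ))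
      ≤ u i₀ ^ 2 / (4 * W k) := by
        gcongr
        exact mul_pos (by norm_num) (hW k)
    _ = u i₀ ^ 2 / 4 / W k := by rw [div_div]
    _ ≤ _ := div_le_div_of_nonneg_right hsq (hW k).le

/-! ### Trigonometric sums on the torus -/

theorem norm_toCircle_sub_one_le (t : UnitAddCircle) :
    ‖(AddCircle.toCircle t : ℂ) - 1‖ ≤ 2 * Real.pi * ‖t‖ := by
  obtain ⟨x, rfl⟩ := QuotientAddGroup.mk_surjective t
  have h0 : ((x - round x : ℝ) : UnitAddCircle) = (x : UnitAddCircle) := by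
    rw [AddCircle.coe_sub, sub_eq_self]
    exact (AddCircle.coe_eq_zero_iff (1 : ℝ)).2 ⟨round x, by simp⟩
  have h1 : ‖(x : UnitAddCircle)‖ = |x - round x| := UnitAddCircle.norm_eq
  change ‖(AddCircle.toCircle (x : UnitAddCircle) : ℂ) - 1‖ ≤ 2 * Real.pi * ‖(x : UnitAddCircle)‖
  rw [h1, ← h0, AddCircle.toCircle_apply_mk, Circle.coe_exp]
  generalize x - round x = s
  have h3 := Complex.norm_exp_I_mul_ofReal_sub_one (2 * Real.pi / 1 * s)
  rw [mul_comm Complex.I] at h3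
  rw [h3, Real.norm_eq_abs, abs_mul, abs_two]
  have e : 2 * Real.pi / 1 * s / 2 = Real.pi * s := by ring
  rw [e]
  have h4 : |Real.sin (Real.pi * s)| ≤ |Real.pi * s| := Real.abs_sin_le_abs
  rw [abs_mul Real.pi, abs_of_pos Real.pi_pos] at h4
  linarith

theorem mFourier_apply_eq_toCircle {ν : ℕ} (k : Fin ν → ℤ) (x : UnitAddTorus (Fin ν)) :
    UnitAddTorus.mFourier k x = (AddCircle.toCircle (∑ c, k c • x c) : ℂ) := by
  simp only [UnitAddTorus.mFourier, ContinuousMap.coe_mk, fourier_apply]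
  classical
  induction (Finset.univ : Finset (Fin ν)) using Finset.induction_on with
  | empty => simp
  | insert a s ha ih =>
    rw [Finset.prod_insert ha, Finset.sum_insert ha, AddCircle.toCircle_add, Circle.coe_mul, ih]

theorem norm_mFourier_sub_le {ν : ℕ} {k : Fin ν → ℤ} {R : ℝ} (hk : ∀ c, |(k c : ℝ)| ≤ R)
    (ω ω' : UnitAddTorus (Fin ν)) :
    ‖UnitAddTorus.mFourier k ω - UnitAddTorus.mFourier k ω'‖ ≤
      2 * Real.pi * ν * R * dist ω ω' := by
  have h1 : UnitAddTorus.mFourier k ω - UnitAddTorus.mFourier k ω' =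
      UnitAddTorus.mFourier k ω' * ((AddCircle.toCircle (∑ c, k c • (ω c - ω' c)) : ℂ) - 1) := by
    rw [mFourier_apply_eq_toCircle, mFourier_apply_eq_toCircle, mul_sub, mul_one, ← Circle.coe_mul,
      ← AddCircle.toCircle_add, ← Finset.sum_add_distrib]
    congr 3
    refine congrArg _ (funext fun c => ?_)
    rw [zsmul_sub]
    abel
  rw [h1, norm_mul, norm_mFourier_apply, one_mul]
  refine (norm_toCircle_sub_one_le _).trans ?_
  have h2 : ‖∑ c, k c • (ω c - ω' c)‖ ≤ ν * (R * dist ω ω') := by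
    refine (norm_sum_le _ _).trans ?_
    calc ∑ c, ‖k c • (ω c - ω' c)‖ ≤ ∑ _c : Fin ν, R * dist ω ω' := by
          refine Finset.sum_le_sum fun c _ => ?_
          refine (norm_zsmul_le _ _).trans ?_
          rw [Int.norm_eq_abs, ← dist_eq_norm]
          exact mul_le_mul (hk c) (dist_le_pi_dist ω ω' c) dist_nonneg ((abs_nonneg _).trans (hk c))
      _ = ν * (R * dist ω ω') := by simp
  calc 2 * Real.pi * ‖∑ c, k c • (ω c - ω' c)‖ ≤ 2 * Real.pi * (ν * (R * dist ω ω')) :=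
        mul_le_mul_of_nonneg_left h2 (by positivity)
    _ = _ := by ring

theorem continuous_seriesTerm {ν : ℕ} {Θ : Type*} (W : (Fin ν → ℤ) → ℝ)
    (γ h : (Fin ν → ℤ) → Θ → ℝ) (k : Fin ν → ℤ) (θ : Θ) :
    Continuous fun ω => seriesTerm W γ h ω k θ := by
  unfold seriesTerm
  have := (UnitAddTorus.mFourier k).continuous
  fun_prop

/-- A crude Lipschitz bound: the number of frequencies times the largest coefficient and the largest
frequency. The polynomial loss in `R` is harmless, because the meshes of the nets are chosen as a
higher power of `1 / R`. -/
theorem abs_sum_seriesTerm_sub_le {ν : ℕ} {Θ : Type*} {W : (Fin ν → ℤ) → ℝ}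
    {γ h : (Fin ν → ℤ) → Θ → ℝ} {θ : Θ} {F : Finset (Fin ν → ℤ)} {R : ℕ} {G w : ℝ}
    (hF : F ⊆ box 0 R) (hG : 0 ≤ G) (hw : 0 < w) (hW : ∀ k, w ≤ W k)
    (hγ : ∀ k ∈ F, |γ k θ| ≤ G) (hh : ∀ k ∈ F, |h k θ| ≤ G) (ω ω' : UnitAddTorus (Fin ν)) :
    |∑ k ∈ F, seriesTerm W γ h ω k θ - ∑ k ∈ F, seriesTerm W γ h ω' k θ| ≤
      (2 * R + 1) ^ ν * (2 * G * (2 * Real.pi * ν * R * dist ω ω') / √w) := by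
  rw [← Finset.sum_sub_distrib]
  refine (Finset.abs_sum_le_sum_abs _ _).trans ?_
  have hb : 0 ≤ 2 * G * (2 * Real.pi * ν * R * dist ω ω') / √w := by positivity
  have h1 : ∀ k ∈ F, |seriesTerm W γ h ω k θ - seriesTerm W γ h ω' k θ| ≤
      2 * G * (2 * Real.pi * ν * R * dist ω ω') / √w := by
    intro k hk
    have hkR : ∀ c, |(k c : ℝ)| ≤ R := by
      intro c
      have h2 := (natAbs_le_supDist k 0 c).trans (mem_box.1 (hF hk))
      simp only [Pi.zero_apply, sub_zero] at h2
      have h3 : |k c| ≤ (R : ℤ) := abs_le.2 ⟨by omega, by omega⟩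
      exact_mod_cast h3
    have h4 := norm_mFourier_sub_le hkR ω ω'
    have h5 := (Complex.abs_re_le_norm _).trans h4
    have h6 := (Complex.abs_im_le_norm _).trans h4
    rw [Complex.sub_re] at h5
    rw [Complex.sub_im] at h6
    have e : seriesTerm W γ h ω k θ - seriesTerm W γ h ω' k θ =
        (γ k θ * ((UnitAddTorus.mFourier k ω).re - (UnitAddTorus.mFourier k ω').re) +
          h k θ * ((UnitAddTorus.mFourier k ω).im - (UnitAddTorus.mFourier k ω').im)) / √(W k) := by
      simp only [seriesTerm]
      ring
    rw [e, abs_div, abs_of_nonneg (Real.sqrt_nonneg _)]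
    refine div_le_div₀ (by positivity) ?_ (Real.sqrt_pos.2 hw) (Real.sqrt_le_sqrt (hW k))
    refine (abs_add_le _ _).trans ?_
    rw [abs_mul, abs_mul, two_mul G, add_mul]
    exact add_le_add (mul_le_mul (hγ k hk) h5 (abs_nonneg _) hG)
      (mul_le_mul (hh k hk) h6 (abs_nonneg _) hG)
  refine (Finset.sum_le_sum h1).trans ?_
  rw [Finset.sum_const, nsmul_eq_mul]
  refine mul_le_mul_of_nonneg_right ?_ hb
  have h2 := Finset.card_le_card hF
  rw [card_box] at h2
  exact_mod_cast h2

/-! ### Nets on the torus -/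

/-- The points of the torus with coordinates in `N⁻¹ ℤ`. -/
noncomputable def torusNet (ν N : ℕ) : Finset (UnitAddTorus (Fin ν)) :=
  Finset.image (fun (j : Fin ν → Fin N) i => (((j i : ℕ) / N : ℝ) : UnitAddCircle)) Finset.univ

theorem card_torusNet_le (ν N : ℕ) : (torusNet ν N).card ≤ N ^ ν := by
  refine Finset.card_image_le.trans ?_
  simp

theorem exists_mem_torusNet {ν N : ℕ} (hN : 0 < N) (ω : UnitAddTorus (Fin ν)) :
    ∃ ω' ∈ torusNet ν N, dist ω ω' ≤ (N : ℝ)⁻¹ := by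
  have hN' : (0 : ℝ) < N := by exact_mod_cast hN
  have h : ∀ i, ∃ j : Fin N, dist (ω i) (((j : ℕ) / N : ℝ) : UnitAddCircle) ≤ (N : ℝ)⁻¹ := by
    intro i
    obtain ⟨x, hx⟩ := QuotientAddGroup.mk_surjective (ω i)
    have h0 : ((Int.fract x : ℝ) : UnitAddCircle) = ω i := by
      rw [← hx, ← Int.self_sub_floor, AddCircle.coe_sub]
      rw [sub_eq_self]
      exact (AddCircle.coe_eq_zero_iff (1 : ℝ)).2 ⟨⌊x⌋, by simp⟩
    have h1 : Int.fract x * N < N := by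
      have := mul_lt_mul_of_pos_right (Int.fract_lt_one x) hN'
      linarith
    refine ⟨⟨⌊Int.fract x * N⌋₊, (Nat.floor_lt (by positivity)).2 h1⟩, ?_⟩
    rw [← h0, dist_eq_norm, ← AddCircle.coe_sub]
    refine (QuotientAddGroup.norm_mk_le_norm).trans ?_
    rw [Real.norm_eq_abs, abs_of_nonneg, sub_le_iff_le_add, ← one_div, ← add_div,
      le_div_iff₀ hN']
    · have := (Nat.lt_floor_add_one (Int.fract x * N)).le
      simp only
      linarith
    · rw [sub_nonneg, div_le_iff₀ hN']
      exact Nat.floor_le (by positivity)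
  choose j hj using h
  exact ⟨_, Finset.mem_image.2 ⟨j, Finset.mem_univ j, rfl⟩,
    (dist_pi_le_iff (by positivity)).2 hj⟩

/-! ### Gaussian tails -/

theorem measure_abs_ge_le {Θ : Type*} [MeasurableSpace Θ] {P : Measure Θ} [IsProbabilityMeasure P]
    {Z : Θ → ℝ} {w : NNReal} (hZ : HasLaw Z (gaussianReal 0 w) P) {w' s : ℝ}
    (hw : (w : ℝ) ≤ w') (hs : 0 ≤ s) :
    P {θ | s ≤ |Z θ|} ≤ ENNReal.ofReal (2 * Real.exp (-s ^ 2 / (2 * w'))) := by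
  have hw0 : 0 ≤ w' := w.2.trans hw
  have hsub : HasSubgaussianMGF Z w'.toNNReal P := by
    refine ⟨fun t => ?_, fun t => ?_⟩
    · have h1 := integrable_exp_mul_gaussianReal (μ := 0) (v := w) t
      rw [← hZ.map_eq] at h1
      exact h1.comp_aemeasurable hZ.aemeasurable
    · rw [mgf_gaussianReal hZ.map_eq, Real.coe_toNNReal _ hw0]
      refine Real.exp_le_exp.2 ?_
      have := mul_le_mul_of_nonneg_right hw (sq_nonneg t)
      linarith
  have h1 := hsub.measure_ge_le hs
  have h2 := hsub.neg.measure_ge_le hs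
  rw [Real.coe_toNNReal _ hw0] at h1 h2
  have h3 : {θ | s ≤ |Z θ|} ⊆ {θ | s ≤ Z θ} ∪ {θ | s ≤ (-Z) θ} := by
    intro θ hθ
    simp only [Set.mem_union, Set.mem_ofPred_eq, Pi.neg_apply] at hθ ⊢
    exact le_abs.1 hθ
  refine (measure_mono h3).trans ((measure_union_le _ _).trans ?_)
  rw [two_mul, ENNReal.ofReal_add (Real.exp_nonneg _) (Real.exp_nonneg _)]
  refine add_le_add ?_ ?_ <;>
  · rw [← ENNReal.ofReal_toReal (measure_ne_top P _)]
    exact ENNReal.ofReal_le_ofReal (by assumption)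

/-! ### Growth of the spectral weight -/

/-- The weight is bounded below, and the sum of its inverse over the cubical annuli of radii `Q ^ n`
decays exponentially. -/
structure WeightGrowth {ν : ℕ} (W : (Fin ν → ℤ) → ℝ) (Q : ℕ) (w K : ℝ) : Prop where
  two_le : 2 ≤ Q
  pos : 0 < w
  le : ∀ k, w ≤ W k
  one_le : 1 ≤ K
  annulus : ∀ n : ℕ, ∑ k ∈ box 0 (Q ^ (n + 1)) \ box 0 (Q ^ n), (W k)⁻¹ ≤ K * (1 / 16) ^ n

theorem natCast_le_norm_dualPoint {ν : ℕ} {k : Fin ν → ℤ} {R : ℕ} (hk : k ∉ box 0 R) :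
    (R : ℝ) ≤ ‖dualPoint k‖ := by
  rw [mem_box, supDist_le, not_forall] at hk
  obtain ⟨c, hc⟩ := hk
  simp only [Pi.zero_apply, sub_zero, not_le] at hc
  refine le_trans ?_ (norm_le_pi_norm (dualPoint k) c)
  rw [dualPoint, Real.norm_eq_abs, abs_mul, abs_of_pos (by positivity : 0 < 2 * Real.pi)]
  have h1 : (R : ℤ) ≤ |k c| := by rw [Int.abs_eq_natAbs]; exact_mod_cast hc.le
  have h2 : (R : ℝ) ≤ |(k c : ℝ)| := by exact_mod_cast h1
  have h3 := Real.pi_gt_three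
  nlinarith [abs_nonneg (k c : ℝ)]

/-- Take `Q ^ δ ≥ 16`. On the `n`-th annulus the weight is at least a constant times `Q ^ (n ν) * 16
^ n`, and the factor `Q ^ (n ν)` cancels the number of lattice points. The base 16 makes the
threshold `2 ^ (-n)` of order `2 ^ n` standard deviations of the block. -/
theorem exists_weightGrowth {ν : ℕ} {W : (Fin ν → ℤ) → ℝ} (hW : ∀ k, 0 < W k) {c δ : ℝ}
    (hc : 0 < c) (hδ : 0 < δ) (hWl : ∀ k, c * ‖dualPoint k‖ ^ ((ν : ℝ) + δ) ≤ W k) :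
    ∃ Q w K, WeightGrowth W Q w K := by
  obtain ⟨Q, hQ⟩ := exists_nat_ge (max 2 ((16 : ℝ) ^ δ⁻¹))
  have hQ2 : 2 ≤ Q := by exact_mod_cast (le_max_left _ _).trans hQ
  have hQ16 : (16 : ℝ) ≤ (Q : ℝ) ^ δ := by
    have h1 := Real.rpow_le_rpow (by positivity) ((le_max_right _ _).trans hQ) hδ.le
    rwa [← Real.rpow_mul (by norm_num), inv_mul_cancel₀ hδ.ne', Real.rpow_one] at h1
  have hQpos : (0 : ℝ) < Q := by positivity
  have hlow : ∀ (n : ℕ) k, k ∉ box 0 (Q ^ n) → c * (((Q : ℝ) ^ n) ^ ν * 16 ^ n) ≤ W k := by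
    intro n k hk
    refine le_trans (mul_le_mul_of_nonneg_left ?_ hc.le) (hWl k)
    have h1 := natCast_le_norm_dualPoint hk
    push_cast at h1
    refine le_trans ?_ (Real.rpow_le_rpow (by positivity) h1 (by positivity))
    rw [Real.rpow_add (by positivity), Real.rpow_natCast]
    refine mul_le_mul_of_nonneg_left ?_ (by positivity)
    rw [← Real.rpow_natCast (Q : ℝ) n, ← Real.rpow_mul (by positivity), mul_comm,
      Real.rpow_mul (by positivity), Real.rpow_natCast]
    exact pow_le_pow_left₀ (by norm_num) hQ16 n
  refine ⟨Q, min c (W 0), max 1 ((3 * Q) ^ ν / c), hQ2, lt_min hc (hW 0), fun k => ?_,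
    le_max_left _ _, fun n => ?_⟩
  · by_cases hk : k = 0
    · rw [hk]
      exact min_le_right _ _
    · refine (min_le_left _ _).trans ((le_mul_of_one_le_right hc.le ?_).trans (hWl k))
      obtain ⟨i, hi⟩ := Function.ne_iff.1 hk
      refine Real.one_le_rpow (le_trans ?_ (norm_le_pi_norm (dualPoint k) i)) (by positivity)
      rw [dualPoint, Real.norm_eq_abs, abs_mul, abs_of_pos (by positivity : 0 < 2 * Real.pi)]
      have h1 : (1 : ℤ) ≤ |k i| := Int.one_le_abs hi
      have h2 : (1 : ℝ) ≤ |(k i : ℝ)| := by exact_mod_cast h1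
      nlinarith [Real.pi_gt_three]
  · have h1 : ∀ k ∈ box 0 (Q ^ (n + 1)) \ box 0 (Q ^ n), (W k)⁻¹ ≤
        (c * (((Q : ℝ) ^ n) ^ ν * 16 ^ n))⁻¹ := fun k hk =>
      inv_anti₀ (by positivity) (hlow n k (Finset.mem_sdiff.1 hk).2)
    refine (Finset.sum_le_sum h1).trans ?_
    rw [Finset.sum_const, nsmul_eq_mul]
    have h2 : ((box (0 : Fin ν → ℤ) (Q ^ (n + 1)) \ box 0 (Q ^ n)).card : ℝ) ≤
        ((3 * Q : ℝ) * Q ^ n) ^ ν := by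
      have h3 := Finset.card_le_card (Finset.sdiff_subset
        (s := box (0 : Fin ν → ℤ) (Q ^ (n + 1))) (t := box 0 (Q ^ n)))
      rw [card_box] at h3
      have h5 : ((box (0 : Fin ν → ℤ) (Q ^ (n + 1)) \ box 0 (Q ^ n)).card : ℝ) ≤
          (((2 * Q ^ (n + 1) + 1 : ℕ) : ℝ)) ^ ν := by exact_mod_cast h3
      refine h5.trans (pow_le_pow_left₀ (by positivity) ?_ ν)
      have h4 : (1 : ℝ) ≤ (Q : ℝ) ^ (n + 1) := one_le_pow₀ (by exact_mod_cast (by omega : 1 ≤ Q))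
      push_cast
      rw [pow_succ] at h4 ⊢
      linarith
    refine (mul_le_mul_of_nonneg_right h2 (by positivity)).trans ?_
    refine le_trans (le_of_eq ?_) (mul_le_mul_of_nonneg_right
      (le_max_right 1 ((3 * Q : ℝ) ^ ν / c)) (by positivity))
    rw [mul_pow, one_div_pow]
    field_simp

theorem WeightGrowth.summable {ν : ℕ} {W : (Fin ν → ℤ) → ℝ} {Q : ℕ} {w K : ℝ}
    (hW : WeightGrowth W Q w K) : Summable fun k => (W k)⁻¹ := by
  have hpos : ∀ k, 0 ≤ (W k)⁻¹ := fun k => inv_nonneg.2 (hW.pos.le.trans (hW.le k))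
  have hmono : ∀ n, box (0 : Fin ν → ℤ) (Q ^ n) ⊆ box 0 (Q ^ (n + 1)) := fun n k hk =>
    mem_box.2 ((mem_box.1 hk).trans (Nat.pow_le_pow_right (by have := hW.two_le; omega) n.le_succ))
  have h1 : ∀ n, ∑ k ∈ box 0 (Q ^ n), (W k)⁻¹ ≤
      ∑ k ∈ box 0 (Q ^ 0), (W k)⁻¹ + ∑ i ∈ Finset.range n, K * (1 / 16) ^ i := by
    intro n
    induction n with
    | zero => simp
    | succ n ih =>
      rw [Finset.sum_range_succ, ← Finset.sum_sdiff (hmono n)]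
      linarith [hW.annulus n]
  have hs : Summable fun i : ℕ => K * (1 / 16 : ℝ) ^ i :=
    (summable_geometric_of_lt_one (by norm_num) (by norm_num)).mul_left K
  refine summable_of_sum_le hpos (c := ∑ k ∈ box 0 (Q ^ 0), (W k)⁻¹ + ∑' i : ℕ, K * (1 / 16) ^ i)
    fun F => ?_
  obtain ⟨n, hn⟩ : ∃ n, F ⊆ box 0 (Q ^ n) := by
    refine ⟨F.sup fun k => supDist k 0, fun k hk => mem_box.2 ?_⟩
    exact (Finset.le_sup (f := fun k => supDist k 0) hk).trans
      (Nat.lt_pow_self (by have := hW.two_le; omega)).le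
  refine (Finset.sum_le_sum_of_subset_of_nonneg hn fun k _ _ => hpos k).trans ((h1 n).trans ?_)
  have := hW.one_le
  have h3 := hs.sum_le_tsum (Finset.range n) fun i _ => by positivity
  linarith

/-- A Gaussian tail at `2 ^ n` standard deviations absorbs any exponentially growing number of
events: compare the exponential with its Taylor term of order `m`, where `4 ^ m > 2 T`. -/
theorem exists_pow_mul_exp_le (T K : ℝ) (hT : 0 ≤ T) (hK : 0 < K) :
    ∃ C > 0, ∀ n : ℕ, T ^ n * Real.exp (-(4 ^ n / K)) ≤ C * (1 / 2) ^ n := by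
  obtain ⟨m, hm⟩ := pow_unbounded_of_one_lt (2 * T) (by norm_num : (1 : ℝ) < 4)
  refine ⟨K ^ m * m.factorial, by positivity, fun n => ?_⟩
  have h1 : (4 ^ n / K) ^ m / m.factorial ≤ Real.exp (4 ^ n / K) :=
    Real.pow_div_factorial_le_exp _ (by positivity) m
  rw [div_le_iff₀ (by positivity), div_pow, div_le_iff₀ (by positivity)] at h1
  have h2 : (2 * T) ^ n ≤ ((4 : ℝ) ^ n) ^ m := by
    rw [← pow_mul, mul_comm n m, pow_mul]
    exact pow_le_pow_left₀ (by positivity) hm.le n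
  have h3 := h2.trans h1
  rw [Real.exp_neg, ← div_eq_mul_inv, div_le_iff₀ (Real.exp_pos _)]
  rw [mul_pow] at h3
  have e : K ^ m * (m.factorial : ℝ) * (1 / 2) ^ n * Real.exp (4 ^ n / K) =
    (Real.exp (4 ^ n / K) * m.factorial * K ^ m) * (1 / 2) ^ n := by ring
  have e2 : T ^ n = 2 ^ n * T ^ n * (1 / 2) ^ n := by
    rw [mul_right_comm, ← mul_pow]
    norm_num
  rw [e, e2]
  exact mul_le_mul_of_nonneg_right h3 (by positivity)

/-! ### Partial sums of the series -/

/-- The partial sum of the series over the cube of radius `Q ^ n`. -/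
noncomputable def cubeSum {ν : ℕ} {Θ : Type*} (W : (Fin ν → ℤ) → ℝ)
    (γ h : (Fin ν → ℤ) → Θ → ℝ) (Q n : ℕ) (ω : UnitAddTorus (Fin ν)) (θ : Θ) : ℝ :=
  ∑ k ∈ box 0 (Q ^ n), seriesTerm W γ h ω k θ

/-- The event that the coefficients with frequency of order `Q ^ n` are not too large, and the
corresponding block of the series is small at the points of a net. -/
def goodBlock {ν : ℕ} {Θ : Type*} (W : (Fin ν → ℤ) → ℝ)
    (γ h : (Fin ν → ℤ) → Θ → ℝ) (Q n : ℕ) : Set Θ :=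
  {θ | (∀ k ∈ box 0 (Q ^ (n + 1)), |γ k θ| ≤ 2 ^ n ∧ |h k θ| ≤ 2 ^ n) ∧
    ∀ ω ∈ torusNet ν (Q ^ (n * (ν + 3))),
      |cubeSum W γ h Q (n + 1) ω θ - cubeSum W γ h Q n ω θ| ≤ (1 / 2) ^ n}

theorem box_pow_subset {ν : ℕ} {Q : ℕ} (hQ : 2 ≤ Q) (n : ℕ) :
    box (0 : Fin ν → ℤ) (Q ^ n) ⊆ box 0 (Q ^ (n + 1)) := fun _ hk =>
  mem_box.2 ((mem_box.1 hk).trans (Nat.pow_le_pow_right (by omega) n.le_succ))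

theorem cubeSum_succ_sub {ν : ℕ} {Θ : Type*} (W : (Fin ν → ℤ) → ℝ)
    (γ h : (Fin ν → ℤ) → Θ → ℝ) {Q : ℕ} (hQ : 2 ≤ Q) (n : ℕ) (ω : UnitAddTorus (Fin ν)) (θ : Θ) :
    cubeSum W γ h Q (n + 1) ω θ - cubeSum W γ h Q n ω θ =
      ∑ k ∈ box 0 (Q ^ (n + 1)) \ box 0 (Q ^ n), seriesTerm W γ h ω k θ := by
  rw [cubeSum, cubeSum, ← Finset.sum_sdiff (box_pow_subset hQ n), add_sub_cancel_right]

/-- A union bound. A coefficient exceeding `2 ^ n`, or a block of variance at most `K * 16 ^ (-n)`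
exceeding `2 ^ (-n)` at a net point, has probability at most `2 exp (-4 ^ n / (2 K))`, whereas there
are only exponentially many frequencies and net points. -/
theorem exists_measure_compl_goodBlock_le {ν : ℕ} {Θ : Type*} [MeasurableSpace Θ] {P : Measure Θ}
    [IsProbabilityMeasure P] {W : (Fin ν → ℤ) → ℝ} {Q : ℕ} {w K : ℝ}
    (hW : WeightGrowth W Q w K) {γ h : (Fin ν → ℤ) → Θ → ℝ} (hγh : IsStdGaussianFamily P γ h) :
    ∃ C > 0, ∀ n, P (goodBlock W γ h Q n)ᶜ ≤ ENNReal.ofReal (C * (1 / 2) ^ n) := by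
  have hK : 0 < K := zero_lt_one.trans_le hW.one_le
  have hQ1 : 1 ≤ Q := by have := hW.two_le; omega
  have hQ1' : (1 : ℝ) ≤ Q := by exact_mod_cast hQ1
  obtain ⟨C, hC, hCn⟩ := exists_pow_mul_exp_le ((Q : ℝ) ^ (ν * (ν + 3))) (2 * K) (by positivity)
    (by positivity)
  refine ⟨(2 * (3 * Q) ^ ν + 1) * 2 * C, by positivity, fun n => ?_⟩
  set b : ℝ≥0∞ := ENNReal.ofReal (2 * Real.exp (-(4 ^ n / (2 * K)))) with hb
  have hpow : ((2 : ℝ) ^ n) ^ 2 = 4 ^ n := by rw [← pow_mul, mul_comm, pow_mul]; norm_num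
  have hcoef : ∀ {ξ : Θ → ℝ}, HasLaw ξ (gaussianReal 0 1) P → P {θ | (2 : ℝ) ^ n ≤ |ξ θ|} ≤ b := by
    intro ξ hξ
    refine (measure_abs_ge_le hξ (w' := K) (by simpa using hW.one_le) (by positivity)).trans
      (le_of_eq ?_)
    rw [hb, hpow, neg_div]
  have hblock : ∀ ω : UnitAddTorus (Fin ν),
      P {θ | (1 / 2 : ℝ) ^ n ≤ |cubeSum W γ h Q (n + 1) ω θ - cubeSum W γ h Q n ω θ|} ≤ b := by
    intro ω
    have h1 := hasLaw_sum_gaussTerm (fun k => hW.pos.trans_le (hW.le k)) hγh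
      (fun k => UnitAddTorus.mFourier k ω) (box 0 (Q ^ (n + 1)) \ box 0 (Q ^ n))
    simp only [norm_mFourier_apply, one_pow, one_div] at h1
    have h2 := measure_abs_ge_le (s := (1 / 2 : ℝ) ^ n) h1 (w' := K * (1 / 16) ^ n) (by
      rw [Real.coe_toNNReal _ (Finset.sum_nonneg fun k _ =>
        inv_nonneg.2 (hW.pos.le.trans (hW.le k)))]
      exact hW.annulus n) (by positivity)
    simp only [cubeSum_succ_sub W γ h hW.two_le, seriesTerm_eq_gaussTerm]
    refine h2.trans (le_of_eq ?_)
    rw [hb]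
    congr 4
    have e1 : (((1 : ℝ) / 2) ^ n) ^ 2 = 1 / 4 ^ n := by
      rw [← pow_mul, mul_comm, pow_mul, one_div_pow, one_div_pow]
      norm_num
    have e2 : ((1 : ℝ) / 16) ^ n = 1 / (4 ^ n * 4 ^ n) := by
      rw [one_div_pow, ← mul_pow]
      norm_num
    rw [e1, e2]
    field_simp
  have hsub : (goodBlock W γ h Q n)ᶜ ⊆
      (⋃ k ∈ box (0 : Fin ν → ℤ) (Q ^ (n + 1)),
        ({θ | (2 : ℝ) ^ n ≤ |γ k θ|} ∪ {θ | (2 : ℝ) ^ n ≤ |h k θ|})) ∪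
      ⋃ ω ∈ torusNet ν (Q ^ (n * (ν + 3))),
        {θ | (1 / 2 : ℝ) ^ n ≤ |cubeSum W γ h Q (n + 1) ω θ - cubeSum W γ h Q n ω θ|} := by
    intro θ hθ
    by_contra hcon
    simp only [Set.mem_union, Set.mem_iUnion, Set.mem_ofPred_eq, not_or, not_exists, not_le] at hcon
    refine hθ ⟨fun k hk => ?_, fun ω hω => (hcon.2 ω hω).le⟩
    exact ⟨(hcon.1 k hk).1.le, (hcon.1 k hk).2.le⟩
  refine (measure_mono hsub).trans ((measure_union_le _ _).trans ?_)
  have h1 : P (⋃ k ∈ box (0 : Fin ν → ℤ) (Q ^ (n + 1)),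
      ({θ | (2 : ℝ) ^ n ≤ |γ k θ|} ∪ {θ | (2 : ℝ) ^ n ≤ |h k θ|})) ≤
      (box (0 : Fin ν → ℤ) (Q ^ (n + 1))).card • (b + b) := by
    refine (measure_biUnion_finset_le _ _).trans (Finset.sum_le_card_nsmul _ _ _ fun k _ => ?_)
    exact (measure_union_le _ _).trans
      (add_le_add (hcoef (hγh.law_left k)) (hcoef (hγh.law_right k)))
  have h2 : P (⋃ ω ∈ torusNet ν (Q ^ (n * (ν + 3))),
      {θ | (1 / 2 : ℝ) ^ n ≤ |cubeSum W γ h Q (n + 1) ω θ - cubeSum W γ h Q n ω θ|}) ≤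
      (torusNet ν (Q ^ (n * (ν + 3)))).card • b :=
    (measure_biUnion_finset_le _ _).trans (Finset.sum_le_card_nsmul _ _ _ fun ω _ => hblock ω)
  refine (add_le_add h1 h2).trans ?_
  rw [nsmul_eq_mul, nsmul_eq_mul, ← two_mul, ← mul_assoc, ← add_mul, hb,
    ← ENNReal.ofReal_natCast, ← ENNReal.ofReal_natCast, ← ENNReal.ofReal_ofNat,
    ← ENNReal.ofReal_mul (by positivity), ← ENNReal.ofReal_add (by positivity) (by positivity),
    ← ENNReal.ofReal_mul (by positivity)]
  refine ENNReal.ofReal_le_ofReal ?_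
  have h3 : ((box (0 : Fin ν → ℤ) (Q ^ (n + 1))).card : ℝ) ≤
      (3 * Q) ^ ν * ((Q : ℝ) ^ (ν * (ν + 3))) ^ n := by
    rw [card_box]
    push_cast
    have h4 : (1 : ℝ) ≤ (Q : ℝ) ^ (n + 1) := one_le_pow₀ hQ1'
    calc (2 * (Q : ℝ) ^ (n + 1) + 1) ^ ν ≤ (3 * Q * Q ^ n) ^ ν := by
          refine pow_le_pow_left₀ (by positivity) ?_ ν
          rw [pow_succ] at h4 ⊢
          linarith
      _ = (3 * Q) ^ ν * (Q : ℝ) ^ (n * ν) := by rw [mul_pow, ← pow_mul]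
      _ ≤ _ := by
          refine mul_le_mul_of_nonneg_left ?_ (by positivity)
          rw [← pow_mul]
          refine pow_le_pow_right₀ hQ1' ?_
          nlinarith [Nat.zero_le (n * ν * ν), Nat.zero_le (n * ν)]
  have h4 : ((torusNet ν (Q ^ (n * (ν + 3)))).card : ℝ) ≤ ((Q : ℝ) ^ (ν * (ν + 3))) ^ n := by
    have h5 : ((torusNet ν (Q ^ (n * (ν + 3)))).card : ℝ) ≤
        ((Q ^ (n * (ν + 3)) : ℕ) : ℝ) ^ ν := by
      exact_mod_cast card_torusNet_le ν (Q ^ (n * (ν + 3)))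
    refine h5.trans (le_of_eq ?_)
    push_cast
    rw [← pow_mul, ← pow_mul]
    congr 1
    ring
  have h5 := hCn n
  have h6 : (box (0 : Fin ν → ℤ) (Q ^ (n + 1))).card * (2 : ℝ) +
      (torusNet ν (Q ^ (n * (ν + 3)))).card ≤
      (2 * (3 * Q) ^ ν + 1) * ((Q : ℝ) ^ (ν * (ν + 3))) ^ n := by
    linarith
  calc _ ≤ (2 * (3 * Q) ^ ν + 1) * ((Q : ℝ) ^ (ν * (ν + 3))) ^ n *
        (2 * Real.exp (-(4 ^ n / (2 * K)))) :=
        mul_le_mul_of_nonneg_right h6 (by positivity)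
    _ = (2 * (3 * Q) ^ ν + 1) * 2 * (((Q : ℝ) ^ (ν * (ν + 3))) ^ n *
        Real.exp (-(4 ^ n / (2 * K)))) := by ring
    _ ≤ (2 * (3 * Q) ^ ν + 1) * 2 * (C * (1 / 2) ^ n) :=
        mul_le_mul_of_nonneg_left h5 (by positivity)
    _ = _ := by ring

/-- On the good event, blocks are uniformly small and partial sums have a controlled modulus of
continuity. -/
theorem exists_bound_of_mem_goodBlock {ν : ℕ} {Θ : Type*} {W : (Fin ν → ℤ) → ℝ} {Q : ℕ} {w K : ℝ}
    (hW : WeightGrowth W Q w K) (γ h : (Fin ν → ℤ) → Θ → ℝ) :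
    ∃ C > 0, ∀ n, ∀ θ ∈ goodBlock W γ h Q n,
      (∀ ω, |cubeSum W γ h Q (n + 1) ω θ - cubeSum W γ h Q n ω θ| ≤ C * (1 / 2) ^ n) ∧
      ∀ ω ω', dist ω ω' ≤ (((Q ^ (n * (ν + 3)) : ℕ) : ℝ))⁻¹ →
        |cubeSum W γ h Q n ω θ - cubeSum W γ h Q n ω' θ| ≤ C * (1 / 2) ^ n := by
  have hQ2 := hW.two_le
  have hQ2' : (2 : ℝ) ≤ Q := by exact_mod_cast hQ2
  have hQpos : (0 : ℝ) < Q := by linarith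
  set C : ℝ := (3 * Q) ^ ν * (4 * Real.pi * ν * Q / √w) with hC
  have hCnn : 0 ≤ C := by positivity
  have key : ∀ n, ∀ θ ∈ goodBlock W γ h Q n, ∀ F ⊆ box 0 (Q ^ (n + 1)), ∀ ω ω',
      dist ω ω' ≤ (((Q ^ (n * (ν + 3)) : ℕ) : ℝ))⁻¹ →
      |∑ k ∈ F, seriesTerm W γ h ω k θ - ∑ k ∈ F, seriesTerm W γ h ω' k θ| ≤ C * (1 / 2) ^ n := by
    intro n θ hθ F hF ω ω' hd
    have h1 := abs_sum_seriesTerm_sub_le hF (by positivity : (0 : ℝ) ≤ 2 ^ n) hW.pos hW.le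
      (fun k hk => (hθ.1 k (hF hk)).1) (fun k hk => (hθ.1 k (hF hk)).2) ω ω'
    refine h1.trans ?_
    push_cast at hd ⊢
    have h4 : (1 : ℝ) ≤ (Q : ℝ) ^ (n + 1) := one_le_pow₀ (by linarith)
    have h5 : (2 * (Q : ℝ) ^ (n + 1) + 1) ^ ν ≤ (3 * Q) ^ ν * (Q : ℝ) ^ (n * ν) := by
      rw [pow_mul, ← mul_pow]
      refine pow_le_pow_left₀ (by positivity) ?_ ν
      rw [pow_succ] at h4 ⊢
      linarith
    -- Up to constants, there are `Q ^ (n ν)` frequencies of size `Q ^ n`, with coefficients at most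
    -- `2 ^ n ≤ Q ^ n`. The mesh `Q ^ (-n (ν + 3))` compensates all three and leaves one spare
    -- factor `Q ^ (-n)`.
    calc _ ≤ (3 * Q) ^ ν * (Q : ℝ) ^ (n * ν) *
          (2 * Q ^ n * (2 * Real.pi * ν * Q ^ (n + 1) * ((Q : ℝ) ^ (n * (ν + 3)))⁻¹) / √w) := by
          gcongr
      _ = C * ((Q : ℝ) ^ (n * ν) * Q ^ n * Q ^ n * ((Q : ℝ) ^ (n * (ν + 3)))⁻¹) := by
          rw [hC, pow_succ]
          ring
      _ = C * ((Q : ℝ) ^ n)⁻¹ := by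
          congr 1
          have : (Q : ℝ) ^ (n * (ν + 3)) = (Q : ℝ) ^ (n * ν) * Q ^ n * Q ^ n * Q ^ n := by
            rw [← pow_add, ← pow_add, ← pow_add]
            congr 1
          rw [this]
          have : (Q : ℝ) ^ (n * ν) ≠ 0 := by positivity
          have : (Q : ℝ) ^ n ≠ 0 := by positivity
          field_simp
      _ ≤ C * (1 / 2) ^ n := by
          refine mul_le_mul_of_nonneg_left ?_ hCnn
          rw [one_div, inv_pow]
          exact inv_anti₀ (by positivity) (pow_le_pow_left₀ (by norm_num) hQ2' n)
  refine ⟨C + 1, by positivity, fun n θ hθ => ⟨fun ω => ?_, fun ω ω' hd => ?_⟩⟩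
  · obtain ⟨ω', hω', hd⟩ := exists_mem_torusNet (ν := ν)
      (pow_pos (by omega : 0 < Q) (n * (ν + 3))) ω
    have h1 := hθ.2 ω' hω'
    have h2 := key n θ hθ (box 0 (Q ^ (n + 1)) \ box 0 (Q ^ n)) Finset.sdiff_subset ω ω' hd
    rw [cubeSum_succ_sub W γ h hQ2] at h1 ⊢
    have h3 := abs_sub_abs_le_abs_sub
      (∑ k ∈ box 0 (Q ^ (n + 1)) \ box 0 (Q ^ n), seriesTerm W γ h ω k θ)
      (∑ k ∈ box 0 (Q ^ (n + 1)) \ box 0 (Q ^ n), seriesTerm W γ h ω' k θ)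
    rw [add_mul]
    linarith
  · refine (key n θ hθ _ (box_pow_subset hQ2 n) ω ω' hd).trans ?_
    exact mul_le_mul_of_nonneg_right (by linarith) (by positivity)

/-! ### The continuous version -/

/-- The partial sums of the series, as continuous functions. -/
noncomputable def cubeSumMap {ν : ℕ} {Θ : Type*} (W : (Fin ν → ℤ) → ℝ)
    (γ h : (Fin ν → ℤ) → Θ → ℝ) (Q n : ℕ) (θ : Θ) : C(UnitAddTorus (Fin ν), ℝ) where
  toFun ω := cubeSum W γ h Q n ω θ
  continuous_toFun := continuous_finsetSum _ fun k _ => continuous_seriesTerm W γ h k θ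

theorem measurable_seriesTerm {ν : ℕ} {Θ : Type*} [MeasurableSpace Θ] (W : (Fin ν → ℤ) → ℝ)
    {γ h : (Fin ν → ℤ) → Θ → ℝ} (hγ : ∀ k, Measurable (γ k)) (hh : ∀ k, Measurable (h k))
    (ω : UnitAddTorus (Fin ν)) (k : Fin ν → ℤ) : Measurable (seriesTerm W γ h ω k) := by
  have h1 := hγ k
  have h2 := hh k
  unfold seriesTerm
  fun_prop

theorem measurable_cubeSum {ν : ℕ} {Θ : Type*} [MeasurableSpace Θ] (W : (Fin ν → ℤ) → ℝ)
    {γ h : (Fin ν → ℤ) → Θ → ℝ} (hγ : ∀ k, Measurable (γ k)) (hh : ∀ k, Measurable (h k))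
    (Q n : ℕ) (ω : UnitAddTorus (Fin ν)) : Measurable (cubeSum W γ h Q n ω) :=
  Finset.measurable_fun_sum _ fun k _ => measurable_seriesTerm W hγ hh ω k

theorem measurableSet_goodBlock {ν : ℕ} {Θ : Type*} [MeasurableSpace Θ] (W : (Fin ν → ℤ) → ℝ)
    {γ h : (Fin ν → ℤ) → Θ → ℝ} (hγ : ∀ k, Measurable (γ k)) (hh : ∀ k, Measurable (h k))
    (Q n : ℕ) : MeasurableSet (goodBlock W γ h Q n) := by
  have e : goodBlock W γ h Q n = (⋂ k ∈ box (0 : Fin ν → ℤ) (Q ^ (n + 1)),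
      ({θ | |γ k θ| ≤ 2 ^ n} ∩ {θ | |h k θ| ≤ 2 ^ n})) ∩
      ⋂ ω ∈ torusNet ν (Q ^ (n * (ν + 3))),
        {θ | |cubeSum W γ h Q (n + 1) ω θ - cubeSum W γ h Q n ω θ| ≤ (1 / 2) ^ n} := by
    ext θ
    simp only [goodBlock, Set.mem_inter_iff, Set.mem_iInter, Set.mem_ofPred_eq]
  rw [e]
  refine MeasurableSet.inter (Finset.measurableSet_biInter _ fun k _ => MeasurableSet.inter ?_ ?_)
    (Finset.measurableSet_biInter _ fun ω _ => ?_)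
  · exact measurableSet_le (continuous_abs.measurable.comp (hγ k)) measurable_const
  · exact measurableSet_le (continuous_abs.measurable.comp (hh k)) measurable_const
  · exact measurableSet_le (continuous_abs.measurable.comp
      ((measurable_cubeSum W hγ hh Q (n + 1) ω).sub (measurable_cubeSum W hγ hh Q n ω)))
      measurable_const

theorem ae_eventually_mem_goodBlock {ν : ℕ} {Θ : Type*} [MeasurableSpace Θ] {P : Measure Θ}
    [IsProbabilityMeasure P] {W : (Fin ν → ℤ) → ℝ} {Q : ℕ} {w K : ℝ}
    (hW : WeightGrowth W Q w K) {γ h : (Fin ν → ℤ) → Θ → ℝ} (hγh : IsStdGaussianFamily P γ h) :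
    ∀ᵐ θ ∂P, ∀ᶠ n in atTop, θ ∈ goodBlock W γ h Q n := by
  obtain ⟨C, hC, hCn⟩ := exists_measure_compl_goodBlock_le hW hγh
  have h1 : ∑' n, P (goodBlock W γ h Q n)ᶜ ≠ ∞ := by
    refine ne_top_of_le_ne_top ?_ (ENNReal.tsum_le_tsum hCn)
    rw [← ENNReal.ofReal_tsum_of_nonneg (fun n => by positivity)
      ((summable_geometric_of_lt_one (by norm_num) (by norm_num)).mul_left C)]
    exact ENNReal.ofReal_ne_top
  filter_upwards [ae_eventually_notMem h1] with θ hθ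
  exact hθ.mono fun n hn => not_not.1 hn

theorem dist_cubeSumMap_le {ν : ℕ} {Θ : Type*} {W : (Fin ν → ℤ) → ℝ} {γ h : (Fin ν → ℤ) → Θ → ℝ}
    {Q n : ℕ} {θ : Θ} {b : ℝ} (hb : 0 ≤ b)
    (H : ∀ ω, |cubeSum W γ h Q (n + 1) ω θ - cubeSum W γ h Q n ω θ| ≤ b) :
    dist (cubeSumMap W γ h Q n θ) (cubeSumMap W γ h Q (n + 1) θ) ≤ b := by
  rw [ContinuousMap.dist_le hb]
  intro ω
  rw [dist_comm, Real.dist_eq]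
  exact H ω

theorem exists_tendsto_cubeSumMap {ν : ℕ} {Θ : Type*} {W : (Fin ν → ℤ) → ℝ} {Q : ℕ} {w K : ℝ}
    (hW : WeightGrowth W Q w K) (γ h : (Fin ν → ℤ) → Θ → ℝ) {θ : Θ}
    (hθ : ∀ᶠ n in atTop, θ ∈ goodBlock W γ h Q n) :
    ∃ f, Tendsto (fun n => cubeSumMap W γ h Q n θ) atTop (𝓝 f) := by
  obtain ⟨C, hC, hCn⟩ := exists_bound_of_mem_goodBlock hW γ h
  obtain ⟨n₀, hn₀⟩ := eventually_atTop.1 hθ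
  have h1 : CauchySeq fun n => cubeSumMap W γ h Q (n + n₀) θ := by
    refine cauchySeq_of_le_geometric (1 / 2) (C * (1 / 2) ^ n₀) (by norm_num) fun n => ?_
    rw [mul_assoc, ← pow_add, add_comm n₀ n, show n + 1 + n₀ = (n + n₀) + 1 by ring]
    exact dist_cubeSumMap_le (by positivity) (hCn (n + n₀) θ (hn₀ _ (by omega))).1
  obtain ⟨f, hf⟩ := cauchySeq_tendsto_of_complete h1
  exact ⟨f, (tendsto_add_atTop_iff_nat n₀).1 hf⟩

theorem eLpNorm_two_eq_of_hasLaw {Θ : Type*} [MeasurableSpace Θ] {P : Measure Θ} {Z : Θ → ℝ}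
    {w : NNReal} (hZ : HasLaw Z (gaussianReal 0 w) P) :
    eLpNorm Z 2 P = ENNReal.ofReal (√w) := by
  have h1 : MemLp (id : ℝ → ℝ) 2 (gaussianReal 0 w) := memLp_id_gaussianReal 2
  have h2 : eLpNorm Z 2 P = eLpNorm id 2 (gaussianReal 0 w) := by
    rw [← hZ.map_eq, eLpNorm_map_measure (by fun_prop) hZ.aemeasurable]
    rfl
  rw [h2, h1.eLpNorm_eq_integral_rpow_norm (by norm_num) (by norm_num)]
  have h3 := variance_id_gaussianReal (μ := 0) (v := w)
  rw [variance_of_integral_eq_zero (by fun_prop) (by simp)] at h3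
  simp only [ENNReal.toReal_ofNat, Real.rpow_ofNat, Real.norm_eq_abs, sq_abs]
  rw [h3, Real.sqrt_eq_rpow, one_div]

/-- Almost surely all but finitely many blocks are good, so the cube sums converge uniformly;
elsewhere the process is set to zero. Mean-square convergence over all finite `F` follows from
Fatou: the norm of the difference is at most the square root of the tail of the sum of `1 / W`
outside `F`. -/
theorem exists_isContinuousVersion_of_measurable {ν : ℕ} {Θ : Type*} [MeasurableSpace Θ]
    {P : Measure Θ} [IsProbabilityMeasure P] {W : (Fin ν → ℤ) → ℝ} {Q : ℕ} {w K : ℝ}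
    (hW : WeightGrowth W Q w K) {γ h : (Fin ν → ℤ) → Θ → ℝ} (hγh : IsStdGaussianFamily P γ h)
    (hγ : ∀ k, Measurable (γ k)) (hh : ∀ k, Measurable (h k)) :
    ∃ v : Θ → C(UnitAddTorus (Fin ν), ℝ), IsContinuousVersion P W γ h v ∧
      ∀ θ, (∀ᶠ n in atTop, θ ∈ goodBlock W γ h Q n) →
        Tendsto (fun n => cubeSumMap W γ h Q n θ) atTop (𝓝 (v θ)) := by
  classical
  set G : Set Θ := {θ | ∀ᶠ n in atTop, θ ∈ goodBlock W γ h Q n} with hG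
  have hGm : MeasurableSet G := by
    have e : G = ⋃ N, ⋂ n ∈ Set.Ici N, goodBlock W γ h Q n := by
      ext θ
      simp only [hG, Set.mem_ofPred_eq, eventually_atTop, Set.mem_iUnion, Set.mem_iInter,
        Set.mem_Ici]
    rw [e]
    exact MeasurableSet.iUnion fun N => MeasurableSet.biInter (Set.to_countable _)
      fun n _ => measurableSet_goodBlock W hγ hh Q n
  have hex : ∀ θ, ∃ f, (θ ∈ G → Tendsto (fun n => cubeSumMap W γ h Q n θ) atTop (𝓝 f)) ∧
      (θ ∉ G → f = 0) := by
    intro θ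
    by_cases hθ : θ ∈ G
    · obtain ⟨f, hf⟩ := exists_tendsto_cubeSumMap hW γ h hθ
      exact ⟨f, fun _ => hf, fun h => absurd hθ h⟩
    · exact ⟨0, fun h => absurd h hθ, fun _ => rfl⟩
  choose v hv hv0 using hex
  have hvω : ∀ θ ∈ G, ∀ ω, Tendsto (fun n => cubeSum W γ h Q n ω θ) atTop (𝓝 (v θ ω)) :=
    fun θ hθ ω => ((continuous_eval_const (F := C(UnitAddTorus (Fin ν), ℝ)) ω).tendsto _).comp (hv θ hθ)
  have hmeas : ∀ ω, Measurable fun θ => v θ ω := by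
    intro ω
    refine measurable_of_tendsto_metrizable
      (fun n => (measurable_cubeSum W hγ hh Q n ω).indicator hGm) (tendsto_pi_nhds.2 fun θ => ?_)
    by_cases hθ : θ ∈ G
    · simpa [Set.indicator_of_mem hθ] using hvω θ hθ ω
    · simp [Set.indicator_of_notMem hθ, hv0 θ hθ]
  refine ⟨v, ⟨hmeas, fun ω => ?_⟩, fun θ hθ => hv θ hθ⟩
  have hpos : ∀ k, 0 < W k := fun k => hW.pos.trans_le (hW.le k)
  set e : Finset (Fin ν → ℤ) → ℝ := fun F => ∑' k, (W k)⁻¹ - ∑ k ∈ F, (W k)⁻¹ with he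
  have he0 : Tendsto (fun F => ENNReal.ofReal (√(e F))) atTop (𝓝 0) := by
    have h1 : Tendsto e atTop (𝓝 (∑' k, (W k)⁻¹ - ∑' k, (W k)⁻¹)) :=
      tendsto_const_nhds.sub hW.summable.hasSum
    rw [sub_self] at h1
    have h2 := ENNReal.tendsto_ofReal ((Real.continuous_sqrt.tendsto 0).comp h1)
    simpa using h2
  refine tendsto_of_tendsto_of_tendsto_of_le_of_le tendsto_const_nhds he0 (fun _ => zero_le)
    fun F => ?_
  have hlim : ∀ᵐ θ ∂P, Tendsto
      (fun n => ∑ k ∈ F, seriesTerm W γ h ω k θ - cubeSum W γ h Q n ω θ) atTop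
      (𝓝 (∑ k ∈ F, seriesTerm W γ h ω k θ - v θ ω)) := by
    filter_upwards [ae_eventually_mem_goodBlock hW hγh] with θ hθ
    exact tendsto_const_nhds.sub (hvω θ hθ ω)
  refine (Lp.eLpNorm_lim_le_liminf_eLpNorm (fun n => ?_) _ hlim).trans
    (liminf_le_of_frequently_le' (Eventually.frequently ?_))
  · exact ((Finset.measurable_fun_sum _ fun k _ => measurable_seriesTerm W hγ hh ω k).sub
      (measurable_cubeSum W hγ hh Q n ω)).aestronglyMeasurable
  · filter_upwards [eventually_ge_atTop (F.sup fun k => supDist k 0)] with n hn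
    have hsub : F ⊆ box 0 (Q ^ n) := fun k hk => mem_box.2
      ((Finset.le_sup (f := fun k => supDist k 0) hk).trans
        (hn.trans (Nat.lt_pow_self (by have := hW.two_le; omega)).le))
    have h1 := hasLaw_sum_gaussTerm hpos hγh (fun k => UnitAddTorus.mFourier k ω)
      (box 0 (Q ^ n) \ F)
    simp only [norm_mFourier_apply, one_pow, one_div] at h1
    have h2 := eLpNorm_two_eq_of_hasLaw h1
    have h3 : eLpNorm (fun θ => ∑ k ∈ F, seriesTerm W γ h ω k θ - cubeSum W γ h Q n ω θ) 2 P =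
        eLpNorm (fun θ => ∑ k ∈ box 0 (Q ^ n) \ F,
          gaussTerm W γ h (fun k => UnitAddTorus.mFourier k ω) k θ) 2 P := by
      have h4 := eLpNorm_sub_comm (fun θ => ∑ k ∈ F, seriesTerm W γ h ω k θ)
        (cubeSum W γ h Q n ω) 2 P
      refine h4.trans (congrArg (fun f => eLpNorm f 2 P) ?_)
      funext θ
      simp only [Pi.sub_apply, cubeSum]
      rw [← Finset.sum_sdiff hsub, add_sub_cancel_right]
      rfl
    rw [h3, h2, Real.coe_toNNReal _ (Finset.sum_nonneg fun k _ => inv_nonneg.2 (hpos k).le)]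
    refine ENNReal.ofReal_le_ofReal (Real.sqrt_le_sqrt ?_)
    rw [he]
    have h5 := Finset.sum_sdiff hsub (f := fun k => (W k)⁻¹)
    have h6 := hW.summable.sum_le_tsum (box 0 (Q ^ n)) fun k _ => inv_nonneg.2 (hpos k).le
    simp only
    linarith

/-- A law gives only almost everywhere measurability, while the event on which the continuous
version is defined must be measurable. -/
theorem IsStdGaussianFamily.exists_measurable {ι Θ : Type*} [MeasurableSpace Θ] {P : Measure Θ}
    {γ h : ι → Θ → ℝ} (hγh : IsStdGaussianFamily P γ h) :
    ∃ γ' h' : ι → Θ → ℝ, (∀ k, Measurable (γ' k)) ∧ (∀ k, Measurable (h' k)) ∧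
      (∀ k, γ k =ᵐ[P] γ' k) ∧ (∀ k, h k =ᵐ[P] h' k) ∧ IsStdGaussianFamily P γ' h' := by
  have h1 := fun k => (hγh.law_left k).aemeasurable
  have h2 := fun k => (hγh.law_right k).aemeasurable
  refine ⟨fun k => (h1 k).mk, fun k => (h2 k).mk, fun k => (h1 k).measurable_mk,
    fun k => (h2 k).measurable_mk, fun k => (h1 k).ae_eq_mk, fun k => (h2 k).ae_eq_mk,
    fun k => (hγh.law_left k).congr (h1 k).ae_eq_mk.symm,
    fun k => (hγh.law_right k).congr (h2 k).ae_eq_mk.symm, hγh.indep.congr ?_⟩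
  rintro (k | k)
  · exact (h1 k).ae_eq_mk
  · exact (h2 k).ae_eq_mk

theorem IsContinuousVersion.congr {ν : ℕ} {Θ : Type*} [MeasurableSpace Θ] {P : Measure Θ}
    {W : (Fin ν → ℤ) → ℝ} {γ h γ' h' : (Fin ν → ℤ) → Θ → ℝ}
    {v : Θ → C(UnitAddTorus (Fin ν), ℝ)} (hv : IsContinuousVersion P W γ h v)
    (h1 : ∀ k, γ k =ᵐ[P] γ' k) (h2 : ∀ k, h k =ᵐ[P] h' k) : IsContinuousVersion P W γ' h' v := by
  refine ⟨hv.measurable, fun ω => (hv.sum ω).congr fun F => eLpNorm_congr_ae ?_⟩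
  filter_upwards [ae_all_iff.2 h1, ae_all_iff.2 h2] with θ h3 h4
  simp only [seriesTerm, h3, h4]

/-- Two versions agree almost surely at each point, hence on a countable dense set, hence everywhere
by continuity. Estimates for the version built by chaining thus carry over to an arbitrary one. -/
theorem IsContinuousVersion.ae_eq {ν : ℕ} {Θ : Type*} [MeasurableSpace Θ] {P : Measure Θ}
    {W : (Fin ν → ℤ) → ℝ} {γ h : (Fin ν → ℤ) → Θ → ℝ} (hγ : ∀ k, Measurable (γ k))
    (hh : ∀ k, Measurable (h k))
    {v v' : Θ → C(UnitAddTorus (Fin ν), ℝ)} (hv : IsContinuousVersion P W γ h v)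
    (hv' : IsContinuousVersion P W γ h v') : v =ᵐ[P] v' := by
  have h1 : ∀ ω, ∀ᵐ θ ∂P, v θ ω = v' θ ω := by
    intro ω
    have h2 : ∀ F : Finset (Fin ν → ℤ), eLpNorm (fun θ => v θ ω - v' θ ω) 2 P ≤
        eLpNorm (fun θ => ∑ k ∈ F, seriesTerm W γ h ω k θ - v θ ω) 2 P +
          eLpNorm (fun θ => ∑ k ∈ F, seriesTerm W γ h ω k θ - v' θ ω) 2 P := by
      intro F
      have hF : Measurable fun θ => ∑ k ∈ F, seriesTerm W γ h ω k θ :=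
        Finset.measurable_fun_sum _ fun k _ => measurable_seriesTerm W hγ hh ω k
      have h3 := eLpNorm_sub_le (p := 2) (μ := P)
        (hF.sub (hv'.measurable ω)).aestronglyMeasurable
        (hF.sub (hv.measurable ω)).aestronglyMeasurable (by norm_num)
      rw [add_comm]
      refine le_trans (le_of_eq (congrArg (fun f => eLpNorm f 2 P) ?_)) h3
      funext θ
      simp only [Pi.sub_apply]
      ring
    have h3 := ge_of_tendsto' ((hv.sum ω).add (hv'.sum ω)) h2
    rw [add_zero, nonpos_iff_eq_zero] at h3
    have h4 := (eLpNorm_eq_zero_iff (f := fun θ => v θ ω - v' θ ω)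
      ((hv.measurable ω).sub (hv'.measurable ω)).aestronglyMeasurable two_ne_zero).1 h3
    filter_upwards [h4] with θ hθ
    exact sub_eq_zero.1 hθ
  obtain ⟨S, hS, hSd⟩ := TopologicalSpace.exists_countable_dense (UnitAddTorus (Fin ν))
  have h2 : ∀ᵐ θ ∂P, ∀ ω ∈ S, v θ ω = v' θ ω := (ae_ball_iff hS).2 fun ω _ => h1 ω
  filter_upwards [h2] with θ hθ
  exact DFunLike.coe_injective (Continuous.ext_on hSd (v θ).continuous (v' θ).continuous hθ)

theorem exists_isContinuousVersion {ν : ℕ} {Θ : Type*} [MeasurableSpace Θ]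
    {P : Measure Θ} [IsProbabilityMeasure P] {W : (Fin ν → ℤ) → ℝ} {Q : ℕ} {w K : ℝ}
    (hW : WeightGrowth W Q w K) {γ h : (Fin ν → ℤ) → Θ → ℝ} (hγh : IsStdGaussianFamily P γ h) :
    ∃ v : Θ → C(UnitAddTorus (Fin ν), ℝ), IsContinuousVersion P W γ h v := by
  obtain ⟨γ', h', hγ', hh', e1, e2, hγh'⟩ := hγh.exists_measurable
  obtain ⟨v, hv, -⟩ := exists_isContinuousVersion_of_measurable hW hγh' hγ' hh'
  exact ⟨v, hv.congr (fun k => (e1 k).symm) fun k => (e2 k).symm⟩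

/-- The modulus of continuity of a continuous version. -/
theorem IsContinuousVersion.exists_modulus {ν : ℕ} {Θ : Type*} [MeasurableSpace Θ]
    {P : Measure Θ} [IsProbabilityMeasure P] {W : (Fin ν → ℤ) → ℝ} {Q : ℕ} {w K : ℝ}
    (hW : WeightGrowth W Q w K) {γ h : (Fin ν → ℤ) → Θ → ℝ} (hγh : IsStdGaussianFamily P γ h)
    {v : Θ → C(UnitAddTorus (Fin ν), ℝ)} (hv : IsContinuousVersion P W γ h v) :
    ∃ C > 0, ∃ p : ℕ, ∀ κ, 0 < κ → κ ≤ 1 → ∃ B : Set Θ, P B ≤ ENNReal.ofReal κ ∧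
      ∀ θ ∉ B, ∀ ω ω', dist ω ω' ≤ (κ / C) ^ p → |v θ ω - v θ ω'| ≤ κ := by
  obtain ⟨γ', h', hγ', hh', e1, e2, hγh'⟩ := hγh.exists_measurable
  obtain ⟨v', hv', hlim⟩ := exists_isContinuousVersion_of_measurable hW hγh' hγ' hh'
  have hae := (hv.congr e1 e2).ae_eq hγ' hh' hv'
  obtain ⟨C₁, hC₁, hC₁n⟩ := exists_measure_compl_goodBlock_le hW hγh'
  obtain ⟨C₂, hC₂, hC₂n⟩ := exists_bound_of_mem_goodBlock hW γ' h'
  obtain ⟨s, hs⟩ := pow_unbounded_of_one_lt (Q : ℝ) (by norm_num : (1 : ℝ) < 2)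
  have hQ2 : (2 : ℝ) ≤ Q := by exact_mod_cast hW.two_le
  set C : ℝ := 2 * C₁ + 5 * C₂ + 1 with hC
  have hC1 : 1 ≤ C := by rw [hC]; linarith
  refine ⟨2 * C, by linarith, s * (ν + 3), fun κ hκ hκ1 => ?_⟩
  -- The level `N = n + 1` is the first with `C * 2 ^ (-N) < κ`. By the choice of `C`, this covers
  -- both the probability `2 C₁ * 2 ^ (-N)` of a later bad block and the oscillation `5 C₂ * 2 ^
  -- (-N)`: twice the uniform tail `2 C₂`, plus `C₂` for the partial sum. Since `Q < 2 ^ s`, the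
  -- mesh at level `N` is bounded below by a power of `κ`.
  obtain ⟨n, hn1, hn2⟩ := exists_nat_pow_near_of_lt_one (x := κ / C) (y := 1 / 2) (by positivity)
    ((div_le_one (by linarith)).2 (hκ1.trans hC1)) (by norm_num) (by norm_num)
  rw [lt_div_iff₀ (by linarith)] at hn1
  set N := n + 1 with hN
  refine ⟨(⋃ i, (goodBlock W γ' h' Q (i + N))ᶜ) ∪ {θ | v θ ≠ v' θ}, ?_, fun θ hθ ω ω' hd => ?_⟩
  · refine (measure_union_le _ _).trans ?_
    have h0 : P {θ | v θ ≠ v' θ} = 0 := ae_iff.1 hae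
    rw [h0, add_zero]
    refine (measure_iUnion_le _).trans ((ENNReal.tsum_le_tsum fun i => hC₁n (i + N)).trans ?_)
    have hs : HasSum (fun i : ℕ => C₁ * (1 / 2 : ℝ) ^ (i + N)) (C₁ * (2 * (1 / 2) ^ N)) := by
      simp only [pow_add]
      exact (hasSum_geometric_two.mul_right _).mul_left _
    rw [← ENNReal.ofReal_tsum_of_nonneg (fun i => by positivity) hs.summable, hs.tsum_eq]
    refine ENNReal.ofReal_le_ofReal (le_trans ?_ hn1.le)
    have : (0 : ℝ) < (1 / 2) ^ N := by positivity
    rw [hC]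
    nlinarith
  · simp only [Set.mem_union, Set.mem_iUnion, not_or, not_exists, Set.mem_compl_iff, not_not,
      Set.mem_ofPred_eq] at hθ
    obtain ⟨hgood, hvv⟩ := hθ
    have hl := hlim θ (eventually_atTop.2 ⟨N, fun m hm => by
      have := hgood (m - N)
      rwa [Nat.sub_add_cancel hm] at this⟩)
    have hl' : Tendsto (fun m => cubeSumMap W γ' h' Q (m + N) θ) atTop (𝓝 (v' θ)) :=
      (tendsto_add_atTop_iff_nat N).2 hl
    have h1 := dist_le_of_le_geometric_of_tendsto₀ (1 / 2) (C₂ * (1 / 2) ^ N) (by norm_num)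
      (fun m => by
        rw [mul_assoc, ← pow_add, add_comm N m, show m + 1 + N = (m + N) + 1 by ring]
        exact dist_cubeSumMap_le (by positivity) (hC₂n (m + N) θ (hgood m)).1) hl'
    rw [zero_add] at h1
    have h2 : ∀ ω, |cubeSum W γ' h' Q N ω θ - v' θ ω| ≤ 2 * (C₂ * (1 / 2) ^ N) := by
      intro ω
      have h3 := (ContinuousMap.dist_apply_le_dist (f := cubeSumMap W γ' h' Q N θ)
        (g := v' θ) ω).trans h1
      rw [Real.dist_eq] at h3
      refine h3.trans (le_of_eq ?_)
      ring
    have hd' : dist ω ω' ≤ (((Q ^ (N * (ν + 3)) : ℕ) : ℝ))⁻¹ := by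
      refine hd.trans ?_
      have h3 : κ / (2 * C) ≤ (1 / 2) ^ N := by
        rw [hN, pow_succ, mul_comm 2 C, ← div_div]
        linarith
      have hQs : ((2 : ℝ) ^ s)⁻¹ ≤ (Q : ℝ)⁻¹ := inv_anti₀ (by linarith) hs.le
      calc (κ / (2 * C)) ^ (s * (ν + 3)) ≤ ((1 / 2) ^ N) ^ (s * (ν + 3)) :=
            pow_le_pow_left₀ (by positivity) h3 _
        _ = (((2 : ℝ) ^ s)⁻¹) ^ (N * (ν + 3)) := by
            rw [← inv_pow, ← one_div, ← pow_mul, ← pow_mul]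
            congr 1
            ring
        _ ≤ ((Q : ℝ)⁻¹) ^ (N * (ν + 3)) := pow_le_pow_left₀ (by positivity) hQs _
        _ = _ := by rw [inv_pow]; push_cast; rfl
    have h3 := (hC₂n N θ (by simpa using hgood 0)).2 ω ω' hd'
    have h4 := h2 ω
    have h5 := h2 ω'
    rw [hvv]
    refine le_trans ?_ hn1.le
    have h6 : (0 : ℝ) < (1 / 2) ^ N := by positivity
    rw [abs_le] at h3 h4 h5 ⊢
    rw [hC]
    constructor <;> nlinarith [mul_pos hC₁ h6, h3.1, h3.2, h4.1, h4.2, h5.1, h5.2]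

/-! ### Translations and perturbations of resonances -/

theorem Resonant.translate {d : ℕ} {V : (Fin d → ℤ) → ℝ} {S S' : Finset (Fin d → ℤ)} {E ε : ℝ}
    (h : Resonant V S E ε) (a : Fin d → ℤ) (hS : ∀ x, x ∈ S' ↔ x + a ∈ S) :
    Resonant (fun x => V (x + a)) S' E ε := by
  obtain ⟨φ, hφ, hlt⟩ := h
  refine ⟨fun x => φ (x + a), fun x hx => hφ _ fun h => hx ((hS x).2 h), ?_⟩
  have e1 : ∑ x ∈ S', ‖φ (x + a)‖ ^ 2 = ∑ x ∈ S, ‖φ x‖ ^ 2 :=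
    Finset.sum_equiv (Equiv.addRight a) (fun x => hS x) fun x _ => rfl
  have e2 : ∑ x ∈ S', ‖ham (fun x => V (x + a)) (fun x => φ (x + a)) x - E * φ (x + a)‖ ^ 2 =
      ∑ x ∈ S, ‖ham V φ x - E * φ x‖ ^ 2 := by
    refine Finset.sum_equiv (Equiv.addRight a) (fun x => hS x) fun x _ => ?_
    simp only [ham, hop, Equiv.coe_addRight, add_right_comm, sub_add_eq_add_sub]
  rw [e1, e2]
  exact hlt

theorem NoResonance.of_translate {d : ℕ} {V : (Fin d → ℤ) → ℝ} {J M : ℕ} {ε : ℝ}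
    {a : Fin d → ℤ} (h : NoResonance (fun x => V (x + a)) J M ε 0) : NoResonance V J M ε a := by
  intro E S hS hSB hdisj hres
  choose b c hbc using hS
  have hmem : ∀ i x, x ∈ Finset.Icc (b i - a) (c i - a) ↔ x + a ∈ S i := by
    intro i x
    rw [hbc i, Finset.mem_Icc, Finset.mem_Icc, sub_le_iff_le_add, le_sub_iff_add_le]
  refine h E (fun i => Finset.Icc (b i - a) (c i - a)) (fun i => ⟨_, _, rfl⟩) (fun i x hx => ?_)
    (fun i j hij => ?_) fun i => (hres i).translate a (hmem i)
  · have h1 := mem_box.1 (hSB i ((hmem i x).1 hx))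
    rw [mem_box, supDist_le]
    intro l
    have h2 := (natAbs_le_supDist (x + a) a l).trans h1
    simpa using h2
  · rw [Finset.disjoint_left]
    intro x hx hx'
    exact Finset.disjoint_left.1 (hdisj i j hij) ((hmem i x).1 hx) ((hmem j x).1 hx')

theorem NoResonance.mono {d : ℕ} {V : (Fin d → ℤ) → ℝ} {J M M' : ℕ} {ε : ℝ}
    {a : Fin d → ℤ} (h : NoResonance V J M ε a) (hM : M' ≤ M) : NoResonance V J M' ε a :=
  fun E S hS hSB hdisj => h E S hS
    (fun i _ hx => mem_box.2 ((mem_box.1 (hSB i hx)).trans hM)) hdisj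

theorem orbit_orbit {ν d : ℕ} (α : Matrix (Fin ν) (Fin d) ℝ) (ω : UnitAddTorus (Fin ν))
    (x y : Fin d → ℤ) : orbit α (orbit α ω x) y = orbit α ω (y + x) := by
  funext i
  have : freqVec α (y + x) i = freqVec α x i + freqVec α y i := by
    simp only [freqVec, Matrix.mulVec, dotProduct, Pi.add_apply, Int.cast_add, mul_add,
      Finset.sum_add_distrib]
    exact add_comm _ _
  simp only [orbit, this, AddCircle.coe_add, add_assoc]

/-- The potential seen from the site `a` is the potential with base point `ω + α a`, so probability
estimates at the origin, valid at every base point, are enough. -/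
theorem noResonance_of_orbit {ν d : ℕ} {α : Matrix (Fin ν) (Fin d) ℝ}
    {u : C(UnitAddTorus (Fin ν), ℝ)} {g : ℝ} {ω : UnitAddTorus (Fin ν)} {J M : ℕ} {ε : ℝ}
    {a : Fin d → ℤ} (h : NoResonance (qpPotential α u g (orbit α ω a)) J M ε 0) :
    NoResonance (qpPotential α u g ω) J M ε a := by
  refine NoResonance.of_translate ?_
  convert h using 2 with x
  rw [qpPotential, qpPotential, orbit_orbit]

/-- From `(a + b)² ≤ 2 a² + 2 b²` one gets `2 ε² + 2 ε² = (2 ε)²`. This carries resonances from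
arbitrary points of the torus to the nearest net point. -/
theorem Resonant.perturb {d : ℕ} {V V' : (Fin d → ℤ) → ℝ} {S : Finset (Fin d → ℤ)} {E ε : ℝ}
    (h : Resonant V S E ε) (hV : ∀ x ∈ S, |V' x - V x| ≤ ε) : Resonant V' S E (2 * ε) := by
  obtain ⟨φ, hφ, hlt⟩ := h
  refine ⟨φ, hφ, ?_⟩
  have h1 : ∀ x ∈ S, ‖ham V' φ x - E * φ x‖ ^ 2 ≤
      2 * ‖ham V φ x - E * φ x‖ ^ 2 + 2 * (ε ^ 2 * ‖φ x‖ ^ 2) := by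
    intro x hx
    have e : ham V' φ x - E * φ x = (ham V φ x - E * φ x) + ((V' x - V x : ℝ) : ℂ) * φ x := by
      simp only [ham]
      push_cast
      ring
    have h2 : ‖ham V' φ x - E * φ x‖ ≤ ‖ham V φ x - E * φ x‖ + ε * ‖φ x‖ := by
      rw [e]
      refine (norm_add_le _ _).trans (add_le_add le_rfl ?_)
      rw [norm_mul, Complex.norm_real, Real.norm_eq_abs]
      exact mul_le_mul_of_nonneg_right (hV x hx) (norm_nonneg _)
    have h3 := pow_le_pow_left₀ (norm_nonneg _) h2 2
    nlinarith [sq_nonneg (‖ham V φ x - E * φ x‖ - ε * ‖φ x‖)]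
  refine (Finset.sum_le_sum h1).trans_lt ?_
  rw [Finset.sum_add_distrib, ← Finset.mul_sum, ← Finset.mul_sum, ← Finset.mul_sum]
  linarith

/-! ### Families of disjoint rectangles -/

open Classical in
/-- The families of `J + 1` disjoint rectangles in the box of radius `M`. -/
noncomputable def rectFamilies (d J M : ℕ) : Finset (Fin (J + 1) → Finset (Fin d → ℤ)) :=
  {S ∈ Fintype.piFinset fun _ => (box (0 : Fin d → ℤ) M ×ˢ box (0 : Fin d → ℤ) M).image
    fun p => Finset.Icc p.1 p.2 |
    (∀ i, S i ⊆ box 0 M) ∧ ∀ i j, i ≠ j → Disjoint (S i) (S j)}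

theorem card_rectFamilies_le (d J M : ℕ) :
    (rectFamilies d J M).card ≤ (2 * M + 1) ^ (2 * d * (J + 1)) := by
  classical
  refine (Finset.card_filter_le _ _).trans ?_
  rw [Fintype.card_piFinset, Finset.prod_const, Finset.card_univ, Fintype.card_fin, pow_mul]
  refine Nat.pow_le_pow_left (Finset.card_image_le.trans ?_) _
  rw [Finset.card_product, card_box, ← pow_add, two_mul d]

/-- A resonant rectangle is nonempty, so its two extreme corners lie in the box and determine it.
The event is therefore a union over polynomially many families. -/
theorem not_noResonance_iff {d J M : ℕ} {V : (Fin d → ℤ) → ℝ} {ε : ℝ} :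
    ¬ NoResonance V J M ε 0 ↔
      ∃ S ∈ rectFamilies d J M, ∃ E, ∀ i, Resonant V (S i) E ε := by
  classical
  constructor
  · intro h
    unfold NoResonance at h
    push Not at h
    obtain ⟨E, S, hS, hSB, hdisj, hres⟩ := h
    refine ⟨S, Finset.mem_filter.2 ⟨Fintype.mem_piFinset.2 fun i => ?_, hSB, hdisj⟩, E, hres⟩
    obtain ⟨a, b, hab⟩ := hS i
    have hne : a ≤ b := by
      have := (hres i).nonempty
      rwa [hab, Finset.nonempty_Icc] at this
    refine Finset.mem_image.2 ⟨(a, b), Finset.mem_product.2 ⟨hSB i ?_, hSB i ?_⟩, hab.symm⟩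
    · rw [hab]
      exact Finset.left_mem_Icc.2 hne
    · rw [hab]
      exact Finset.right_mem_Icc.2 hne
  · rintro ⟨S, hS, E, hres⟩ h
    obtain ⟨h1, h2, h3⟩ := Finset.mem_filter.1 hS
    refine h E S (fun i => ?_) h2 h3 hres
    obtain ⟨p, -, hp⟩ := Finset.mem_image.1 (Fintype.mem_piFinset.1 h1 i)
    exact ⟨p.1, p.2, hp.symm⟩

theorem resonant_qpPotential_iff {ν d : ℕ} {α : Matrix (Fin ν) (Fin d) ℝ}
    {u : C(UnitAddTorus (Fin ν), ℝ)} {g : ℝ} {ω : UnitAddTorus (Fin ν)} {B S : Finset (Fin d → ℤ)}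
    {E ε : ℝ} (hS : S ⊆ B) : Resonant (qpPotential α u g ω) S E ε ↔
      Resonant (extendPotential B g fun k => u (orbit α ω k)) S E ε := by
  have h : ∀ x ∈ S, qpPotential α u g ω x =
      extendPotential B g (fun k => u (orbit α ω k)) x := fun x hx => by
    simp [extendPotential, qpPotential, hS hx]
  exact ⟨fun H => H.congr h, fun H => H.congr fun x hx => (h x hx).symm⟩

/-- Joint measurability in `(θ, ω)` is what Fubini requires; it comes from continuity of `v θ`
together with measurability at each fixed `ω`. -/
theorem measurableSet_not_noResonance {ν d : ℕ} (α : Matrix (Fin ν) (Fin d) ℝ) {Θ : Type*}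
    [MeasurableSpace Θ] {v : Θ → C(UnitAddTorus (Fin ν), ℝ)}
    (hv : ∀ ω, Measurable fun θ => v θ ω) (g : ℝ) (J M : ℕ) (ε : ℝ) (a : Fin d → ℤ) :
    MeasurableSet {p : Θ × UnitAddTorus (Fin ν) |
      ¬ NoResonance (qpPotential α (v p.1) g (orbit α p.2 a)) J M ε 0} := by
  have hjoint : Measurable fun p : Θ × UnitAddTorus (Fin ν) => v p.1 p.2 := by
    have h1 : Measurable (Function.uncurry fun (ω : UnitAddTorus (Fin ν)) (θ : Θ) => v θ ω) :=
      measurable_uncurry_of_continuous_of_measurable (fun θ => (v θ).continuous) hv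
    exact h1.comp measurable_swap
  have horb : ∀ x : Fin d → ℤ, Continuous fun ω : UnitAddTorus (Fin ν) => orbit α ω x := by
    intro x
    unfold orbit
    fun_prop
  have e : {p : Θ × UnitAddTorus (Fin ν) |
      ¬ NoResonance (qpPotential α (v p.1) g (orbit α p.2 a)) J M ε 0} =
      ⋃ S ∈ rectFamilies d J M,
        (fun (p : Θ × UnitAddTorus (Fin ν)) (k : box (0 : Fin d → ℤ) M) =>
          v p.1 (orbit α (orbit α p.2 a) k)) ⁻¹'
        {x | ∃ E, ∀ i, Resonant (extendPotential (box 0 M) g x) (S i) E ε} := by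
    classical
    ext p
    simp only [Set.mem_ofPred_eq, not_noResonance_iff, Set.mem_iUnion, Set.mem_preimage,
      exists_prop]
    refine exists_congr fun S => and_congr_right fun hS => exists_congr fun E =>
      forall_congr' fun i => resonant_qpPotential_iff ((Finset.mem_filter.1 hS).2.1 i)
  rw [e]
  refine Finset.measurableSet_biUnion _ fun S _ =>
    (isOpen_resonant (continuous_extendPotential _ g) S ε).measurableSet.preimage ?_
  refine measurable_pi_lambda _ fun k => ?_
  exact hjoint.comp (measurable_fst.prodMk
    (((horb k).comp (horb a)).measurable.comp measurable_snd))

/-! ### Probabilities -/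

theorem exists_pow_le_mul_exp_rpow (m : ℕ) {b : ℝ} (hb : 0 < b) :
    ∃ C > 0, ∀ M : ℕ, 1 ≤ M → (2 * (M : ℝ) + 1) ^ m ≤ C * Real.exp ((M : ℝ) ^ b) := by
  obtain ⟨s, hs⟩ := exists_nat_ge b⁻¹
  refine ⟨3 ^ m * (s * m).factorial, by positivity, fun M hM => ?_⟩
  have hM' : (1 : ℝ) ≤ M := by exact_mod_cast hM
  have hy : 1 ≤ (M : ℝ) ^ b := Real.one_le_rpow hM' hb.le
  have h1 : (M : ℝ) ≤ ((M : ℝ) ^ b) ^ s := by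
    rw [← Real.rpow_natCast, ← Real.rpow_mul (by positivity)]
    conv_lhs => rw [← Real.rpow_one (M : ℝ)]
    refine Real.rpow_le_rpow_of_exponent_le hM' ?_
    rwa [inv_le_iff_one_le_mul₀' hb] at hs
  have h2 : ((M : ℝ) ^ b) ^ (s * m) ≤ (s * m).factorial * Real.exp ((M : ℝ) ^ b) := by
    have := Real.pow_div_factorial_le_exp _ (by positivity : 0 ≤ (M : ℝ) ^ b) (s * m)
    rwa [div_le_iff₀ (by positivity), mul_comm (Real.exp _)] at this
  calc (2 * (M : ℝ) + 1) ^ m ≤ (3 * ((M : ℝ) ^ b) ^ s) ^ m :=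
        pow_le_pow_left₀ (by positivity) (by linarith) m
    _ = 3 ^ m * ((M : ℝ) ^ b) ^ (s * m) := by rw [mul_pow, ← pow_mul]
    _ ≤ 3 ^ m * ((s * m).factorial * Real.exp ((M : ℝ) ^ b)) :=
        mul_le_mul_of_nonneg_left h2 (by positivity)
    _ = _ := by ring

/-- The probability of resonances at a fixed point of the torus. -/
theorem exists_measure_not_noResonance_le {d ν : ℕ} {W : (Fin ν → ℤ) → ℝ} (hW : ∀ k, 0 < W k)
    (hWs : Summable fun k => (W k)⁻¹) {α : Matrix (Fin ν) (Fin d) ℝ} {Θ : Type*}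
    [MeasurableSpace Θ] {P : Measure Θ} [IsProbabilityMeasure P] {γ h : (Fin ν → ℤ) → Θ → ℝ}
    (hγh : IsStdGaussianFamily P γ h) {v : Θ → C(UnitAddTorus (Fin ν), ℝ)}
    (hv : IsContinuousVersion P W γ h v) {K b : ℝ} (hK : 0 < K) (hb : 0 < b)
    (hvar : ∀ M : ℕ, 1 ≤ M → ∀ (ω : UnitAddTorus (Fin ν))
      (u : box (0 : Fin d → ℤ) M → ℝ) (y : box (0 : Fin d → ℤ) M),
      Real.exp (-(K * (M : ℝ) ^ b)) * u y ^ 2 ≤ Var[fun θ => ∑ i, u i * v θ (orbit α ω i); P])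
    (J : ℕ) :
    ∃ C > 0, ∀ M : ℕ, 1 ≤ M → ∀ g > 0, ∀ ε > 0, ∀ ω,
      P {θ | ¬ NoResonance (qpPotential α (v θ) g ω) J M ε 0} ≤
        ENNReal.ofReal (C * (ε / g) ^ J * Real.exp (C * (M : ℝ) ^ b)) := by
  classical
  obtain ⟨C₁, hC₁, hC₁M⟩ := exists_pow_le_mul_exp_rpow (2 * d * (J + 1) + 3 * d * J) hb
  refine ⟨max (C₁ * 4 ^ J) (1 + K * J), by positivity, fun M hM g hg ε hε ω => ?_⟩
  have hM' : (1 : ℝ) ≤ M := by exact_mod_cast hM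
  have hsub : {θ | ¬ NoResonance (qpPotential α (v θ) g ω) J M ε 0} =
      ⋃ S ∈ rectFamilies d J M, {θ | ∃ E, ∀ i, Resonant (extendPotential (box 0 M) g
        fun k => v θ (orbit α ω k)) (S i) E ε} := by
    ext θ
    simp only [Set.mem_ofPred_eq, not_noResonance_iff, Set.mem_iUnion, exists_prop]
    refine exists_congr fun S => and_congr_right fun hS => exists_congr fun E =>
      forall_congr' fun i => resonant_qpPotential_iff ((Finset.mem_filter.1 hS).2.1 i)
  rw [hsub]
  have h1 : ∀ S ∈ rectFamilies d J M, P {θ | ∃ E, ∀ i, Resonant (extendPotential (box 0 M) g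
      fun k => v θ (orbit α ω k)) (S i) E ε} ≤ ENNReal.ofReal ((box (0 : Fin d → ℤ) M).card ^ 3 /
        Real.sqrt (Real.exp (-(K * (M : ℝ) ^ b))) * (4 * ε / g)) ^ J := by
    intro S hS
    obtain ⟨-, h2, h3⟩ := Finset.mem_filter.1 hS
    exact measure_resonant_le (box 0 M)
      (hv.hasGaussianLaw hW hWs hγh fun k : box (0 : Fin d → ℤ) M => orbit α ω k)
      (Real.exp_pos _) (hvar M hM ω) hg hε S h2 h3
  refine (measure_biUnion_finset_le _ _).trans ((Finset.sum_le_card_nsmul _ _ _ h1).trans ?_)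
  rw [nsmul_eq_mul, ← ENNReal.ofReal_natCast, ← ENNReal.ofReal_pow (by positivity),
    ← ENNReal.ofReal_mul (by positivity)]
  refine ENNReal.ofReal_le_ofReal ?_
  have h2 : ((rectFamilies d J M).card : ℝ) ≤ (2 * (M : ℝ) + 1) ^ (2 * d * (J + 1)) := by
    exact_mod_cast card_rectFamilies_le d J M
  have h3 : 1 / Real.sqrt (Real.exp (-(K * (M : ℝ) ^ b))) ≤ Real.exp (K * (M : ℝ) ^ b) := by
    rw [← Real.exp_half, one_div, ← Real.exp_neg, Real.exp_le_exp]
    have : 0 ≤ K * (M : ℝ) ^ b := by positivity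
    linarith
  set m : ℝ := 2 * (M : ℝ) + 1 with hm
  set e : ℝ := Real.exp (K * (M : ℝ) ^ b) with he
  have h4 : ((box (0 : Fin d → ℤ) M).card : ℝ) ^ 3 /
      Real.sqrt (Real.exp (-(K * (M : ℝ) ^ b))) * (4 * ε / g) ≤ m ^ (3 * d) * e * (4 * ε / g) := by
    refine mul_le_mul_of_nonneg_right ?_ (by positivity)
    rw [card_box, div_eq_mul_one_div]
    push_cast
    rw [← pow_mul, mul_comm d 3]
    exact mul_le_mul_of_nonneg_left h3 (by positivity)
  have hMb : 0 ≤ (M : ℝ) ^ b := by positivity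
  calc ((rectFamilies d J M).card : ℝ) * (((box (0 : Fin d → ℤ) M).card : ℝ) ^ 3 /
      Real.sqrt (Real.exp (-(K * (M : ℝ) ^ b))) * (4 * ε / g)) ^ J
      ≤ m ^ (2 * d * (J + 1)) * (m ^ (3 * d) * e * (4 * ε / g)) ^ J := by
        gcongr
    _ = m ^ (2 * d * (J + 1) + 3 * d * J) * 4 ^ J * (ε / g) ^ J * e ^ J := by
        rw [pow_add, mul_div_assoc, mul_pow, mul_pow, mul_pow, ← pow_mul]
        ring
    _ ≤ C₁ * Real.exp ((M : ℝ) ^ b) * 4 ^ J * (ε / g) ^ J * e ^ J := by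
        gcongr
        exact hC₁M M hM
    _ = C₁ * 4 ^ J * (ε / g) ^ J * Real.exp ((1 + K * J) * (M : ℝ) ^ b) := by
        rw [he, ← Real.exp_nat_mul, add_mul, Real.exp_add, one_mul]
        ring_nf
    _ ≤ _ := by
        gcongr
        · exact le_max_left _ _
        · exact le_max_right _ _

theorem dist_orbit {ν d : ℕ} (α : Matrix (Fin ν) (Fin d) ℝ) (ω ω' : UnitAddTorus (Fin ν))
    (x : Fin d → ℤ) : dist (orbit α ω x) (orbit α ω' x) = dist ω ω' := by
  have : ∀ ω, orbit α ω x = ω + fun i => ((freqVec α x i : ℝ) : UnitAddCircle) := fun _ => rfl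
  rw [this, this, dist_add_right]

/-- The probability of multiple resonances at some point of the torus. -/
theorem exists_noResonance_uniform {d ν : ℕ} {α : Matrix (Fin ν) (Fin d) ℝ} {Θ : Type*}
    [MeasurableSpace Θ] {P : Measure Θ} [IsProbabilityMeasure P]
    {v : Θ → C(UnitAddTorus (Fin ν), ℝ)} {b : ℝ}
    (hmod : ∃ C > 0, ∃ p : ℕ, ∀ κ, 0 < κ → κ ≤ 1 → ∃ B : Set Θ, P B ≤ ENNReal.ofReal κ ∧
      ∀ θ ∉ B, ∀ ω ω', dist ω ω' ≤ (κ / C) ^ p → |v θ ω - v θ ω'| ≤ κ)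
    (hfix : ∀ J : ℕ, ∃ C > 0, ∀ M : ℕ, 1 ≤ M → ∀ g > 0, ∀ ε > 0, ∀ ω,
      P {θ | ¬ NoResonance (qpPotential α (v θ) g ω) J M ε 0} ≤
        ENNReal.ofReal (C * (ε / g) ^ J * Real.exp (C * (M : ℝ) ^ b))) :
    ∃ J : ℕ, ∃ C > 0, ∀ M : ℕ, 1 ≤ M → ∀ g > 0, ∀ ε > 0, ε ≤ g → ∃ B : Set Θ,
      P B ≤ ENNReal.ofReal (C * (ε / g) * Real.exp (C * (M : ℝ) ^ b)) ∧
      ∀ θ ∉ B, ∀ ω, NoResonance (qpPotential α (v θ) g ω) J M ε 0 := by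
  obtain ⟨C₀, hC₀, p, hp⟩ := hmod
  -- In terms of `κ = ε / g`, the net has of order `κ ^ (-p ν)` points, each failing with
  -- probability of order `κ ^ J`. The choice `J = p ν + 1` leaves one power of `κ` after the union
  -- bound.
  obtain ⟨C₁, hC₁, hC₁M⟩ := hfix (p * ν + 1)
  set C₂ : ℝ := max C₀ 1 with hC₂
  have hC₂pos : 0 < C₂ := hC₀.trans_le (le_max_left _ _)
  set C₃ : ℝ := 2 ^ ν * C₂ ^ (p * ν) * C₁ * 2 ^ (p * ν + 1) with hC₃
  have hC₃pos : 0 < C₃ := by positivity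
  refine ⟨p * ν + 1, C₃ + C₁ + 1, by positivity, fun M hM g hg ε hε hεg => ?_⟩
  set κ : ℝ := ε / g with hκ
  have hκpos : 0 < κ := div_pos hε hg
  have hκ1 : κ ≤ 1 := (div_le_one hg).2 hεg
  obtain ⟨B, hB, hBmod⟩ := hp κ hκpos hκ1
  set N : ℕ := ⌈(C₂ / κ) ^ p⌉₊ with hN
  have hNpos : 0 < N := Nat.ceil_pos.2 (by positivity)
  have hN1 : (C₂ / κ) ^ p ≤ N := Nat.le_ceil _
  have hbase : 1 ≤ (C₂ / κ) ^ p :=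
    one_le_pow₀ ((one_le_div hκpos).2 (hκ1.trans (le_max_right _ _)))
  have hN2 : (N : ℝ) ≤ 2 * (C₂ / κ) ^ p := by
    have := (Nat.ceil_lt_add_one (by positivity : 0 ≤ (C₂ / κ) ^ p)).le
    linarith
  refine ⟨B ∪ ⋃ ω ∈ torusNet ν N,
    {θ | ¬ NoResonance (qpPotential α (v θ) g ω) (p * ν + 1) M (2 * ε) 0}, ?_, fun θ hθ ω => ?_⟩
  · refine (measure_union_le _ _).trans ((add_le_add hB ((measure_biUnion_finset_le _ _).trans
      (Finset.sum_le_card_nsmul _ _ _ fun ω _ => hC₁M M hM g hg (2 * ε) (by positivity) ω))).trans ?_)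
    rw [nsmul_eq_mul, ← ENNReal.ofReal_natCast, ← ENNReal.ofReal_mul (by positivity),
      ← ENNReal.ofReal_add hκpos.le (by positivity)]
    refine ENNReal.ofReal_le_ofReal ?_
    have hMb : 0 ≤ (M : ℝ) ^ b := by positivity
    have h1 : ((torusNet ν N).card : ℝ) ≤ (2 * (C₂ / κ) ^ p) ^ ν := by
      have h2 : ((torusNet ν N).card : ℝ) ≤ (N : ℝ) ^ ν := by
        exact_mod_cast card_torusNet_le ν N
      exact h2.trans (pow_le_pow_left₀ (by positivity) hN2 ν)
    have h2 : ((torusNet ν N).card : ℝ) *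
        (C₁ * (2 * ε / g) ^ (p * ν + 1) * Real.exp (C₁ * (M : ℝ) ^ b)) ≤
        C₃ * κ * Real.exp (C₁ * (M : ℝ) ^ b) := by
      refine (mul_le_mul_of_nonneg_right h1 (by positivity)).trans (le_of_eq ?_)
      rw [mul_div_assoc, ← hκ, mul_pow, mul_pow, ← pow_mul, div_pow, hC₃, pow_succ κ]
      field_simp
    have h3 : Real.exp (C₁ * (M : ℝ) ^ b) ≤ Real.exp ((C₃ + C₁ + 1) * (M : ℝ) ^ b) :=
      Real.exp_le_exp.2 (mul_le_mul_of_nonneg_right (by linarith) hMb)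
    have h4 : 1 ≤ Real.exp ((C₃ + C₁ + 1) * (M : ℝ) ^ b) := Real.one_le_exp (by positivity)
    calc κ + _ ≤ κ + C₃ * κ * Real.exp (C₁ * (M : ℝ) ^ b) := add_le_add le_rfl h2
      _ ≤ κ * Real.exp ((C₃ + C₁ + 1) * (M : ℝ) ^ b) +
          C₃ * κ * Real.exp ((C₃ + C₁ + 1) * (M : ℝ) ^ b) := by
          refine add_le_add (le_mul_of_one_le_right hκpos.le h4)
            (mul_le_mul_of_nonneg_left h3 (by positivity))
      _ = (C₃ + 1) * κ * Real.exp ((C₃ + C₁ + 1) * (M : ℝ) ^ b) := by ring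
      _ ≤ _ := by
          gcongr
          linarith
  · simp only [Set.mem_union, Set.mem_iUnion, Set.mem_ofPred_eq, not_or, not_exists, not_not] at hθ
    obtain ⟨ω', hω', hd⟩ := exists_mem_torusNet hNpos ω
    have hd' : dist ω ω' ≤ (κ / C₀) ^ p := by
      refine hd.trans ?_
      rw [inv_le_comm₀ (by positivity) (by positivity), ← inv_pow, inv_div]
      refine le_trans (pow_le_pow_left₀ (by positivity) ?_ p) hN1
      exact div_le_div_of_nonneg_right (le_max_left _ _) hκpos.le
    intro E S hS hSB hdisj hres
    -- Moving to the nearest net point changes the potential by at most `g κ = ε`, which is why the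
    -- net event uses the threshold `2 ε`.
    refine hθ.2 ω' hω' E S hS hSB hdisj fun i => (hres i).perturb fun x _ => ?_
    have h1 := hBmod θ hθ.1 (orbit α ω' x) (orbit α ω x) (by
      rw [dist_orbit, dist_comm]
      exact hd')
    rw [qpPotential, qpPotential, ← mul_sub, abs_mul, abs_of_pos hg]
    calc g * _ ≤ g * κ := mul_le_mul_of_nonneg_left h1 hg.le
      _ = ε := by rw [hκ]; field_simp

/-! ### Choice of the scales -/

theorem eventually_mul_rpow_le (c : ℝ) {p q : ℝ} (hpq : p < q) :
    ∀ᶠ x : ℕ in atTop, c * (x : ℝ) ^ p ≤ (x : ℝ) ^ q := by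
  have h1 : Tendsto (fun x : ℕ => (x : ℝ) ^ (q - p)) atTop atTop :=
    (tendsto_rpow_atTop (sub_pos.2 hpq)).comp tendsto_natCast_atTop_atTop
  filter_upwards [h1.eventually_ge_atTop c, eventually_gt_atTop 0] with x hx hx0
  have hx' : (0 : ℝ) < x := by exact_mod_cast hx0
  calc c * (x : ℝ) ^ p ≤ (x : ℝ) ^ (q - p) * (x : ℝ) ^ p :=
        mul_le_mul_of_nonneg_right hx (by positivity)
    _ = (x : ℝ) ^ q := by rw [← Real.rpow_add hx', sub_add_cancel]

theorem sub_one_sub_le_natCast_div_sub (y z j : ℕ) (hz : 0 < z) :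
    (y : ℝ) / z - 1 - j ≤ ((y / z - j : ℕ) : ℝ) := by
  have h1 : (y : ℝ) / z < (y / z : ℕ) + 1 := by
    rw [div_lt_iff₀ (by exact_mod_cast hz)]
    exact_mod_cast Nat.lt_mul_of_div_lt (Nat.lt_succ_self (y / z)) hz
  have h2 : ((y / z : ℕ) : ℝ) ≤ ((y / z - j : ℕ) : ℝ) + j := by
    exact_mod_cast (le_tsub_add : y / z ≤ y / z - j + j)
  linarith

/-- One step of the multiscale analysis from the scale `x` to the scale `x ^ a`. -/
theorem eventually_scale_step {d J : ℕ} (hd : 1 ≤ d) {t : ℝ} (ht : 0 < t) (ht1 : t < 1) (C : ℝ)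
    (hC : 0 < C) :
    ∀ᶠ x : ℕ in atTop, 2 * x ≤ ⌈(x : ℝ) ^ t⁻¹⌉₊ ∧
      2 * d * (2 * ⌈(x : ℝ) ^ t⁻¹⌉₊ + 1) ^ d / Real.exp (-(⌈(x : ℝ) ^ t⁻¹⌉₊ : ℝ) ^ (t ^ 2)) *
        Real.exp (-(8 * d * (x + (x : ℝ) ^ ((1 + t) / 2)))) ≤ 1 ∧
      (2 * d * (2 * ⌈(x : ℝ) ^ t⁻¹⌉₊ + 1) ^ d / Real.exp (-(⌈(x : ℝ) ^ t⁻¹⌉₊ : ℝ) ^ (t ^ 2)) *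
        Real.exp (-(8 * d * (x + (x : ℝ) ^ ((1 + t) / 2))))) ^
          (⌈(x : ℝ) ^ t⁻¹⌉₊ / (x + 2) - 2 * J) ≤
        Real.exp (-(8 * d * (⌈(x : ℝ) ^ t⁻¹⌉₊ + (⌈(x : ℝ) ^ t⁻¹⌉₊ : ℝ) ^ ((1 + t) / 2)))) ∧
      Real.exp (-(x : ℝ) ^ (t ^ 2)) * Real.exp (C * (9 * (⌈(x : ℝ) ^ t⁻¹⌉₊ : ℝ)) ^ (t ^ 4)) ≤
        (x : ℝ)⁻¹ := by
  have ha : 1 < t⁻¹ := (one_lt_inv₀ ht).2 ht1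
  have hd' : (1 : ℝ) ≤ d := by exact_mod_cast hd
  obtain ⟨C₁, hC₁, hC₁M⟩ := exists_pow_le_mul_exp_rpow d (b := t ^ 2) (by positivity)
  obtain ⟨C₂, hC₂, hC₂M⟩ := exists_pow_le_mul_exp_rpow 1 (b := t ^ 3) (by positivity)
  have hσ : (1 - t) / 2 < t⁻¹ - 1 := by
    have : t⁻¹ * t = 1 := inv_mul_cancel₀ ht.ne'
    nlinarith
  -- All requirements reduce to comparing powers of `x`. With `y` of order `x ^ t⁻¹`, the resonance
  -- factor has logarithm `y ^ (t ^ 2) ~ x ^ t`, below the reserve `x ^ ((1 + t) / 2)` in the decay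
  -- factor. The probabilistic loss has logarithm `y ^ (t ^ 4) ~ x ^ (t ^ 3)`, below `x ^ (t ^ 2)`.
  filter_upwards [eventually_ge_atTop 1,
    eventually_mul_rpow_le 2 (p := 1) (q := t⁻¹) ha,
    eventually_mul_rpow_le (|Real.log (2 * d * C₁)| + 4) (p := t) (q := (1 + t) / 2) (by linarith),
    eventually_mul_rpow_le 8 (p := 0) (q := (1 + t) / 2) (by linarith),
    eventually_mul_rpow_le 24 (p := -(t⁻¹ * ((1 - t) / 2))) (q := -((1 - t) / 2)) (by nlinarith),
    eventually_mul_rpow_le (48 * (2 * J + 1)) (p := 1) (q := t⁻¹ - (1 - t) / 2) (by linarith),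
    eventually_mul_rpow_le (|Real.log C₂| + 1 + 18 * C) (p := t ^ 3) (q := t ^ 2) (by
      nlinarith [pow_pos ht 2])] with x hx1 h2x hI1 h8 h24 h48 hI3
  have hx : (1 : ℝ) ≤ x := by exact_mod_cast hx1
  have hx0 : (0 : ℝ) < x := by linarith
  set y : ℕ := ⌈(x : ℝ) ^ t⁻¹⌉₊ with hy
  have hxa : (1 : ℝ) ≤ (x : ℝ) ^ t⁻¹ := Real.one_le_rpow hx (by linarith)
  have hy1 : (x : ℝ) ^ t⁻¹ ≤ y := Nat.le_ceil _
  have hy2 : (y : ℝ) ≤ 2 * (x : ℝ) ^ t⁻¹ := by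
    have h := (Nat.ceil_lt_add_one (by positivity : 0 ≤ (x : ℝ) ^ t⁻¹)).le
    rw [← hy] at h
    exact h.trans (by rw [two_mul]; exact add_le_add le_rfl hxa)
  have hy0 : (1 : ℝ) ≤ y := hxa.trans hy1
  rw [Real.rpow_one] at h2x h48
  rw [Real.rpow_zero, mul_one] at h8
  set s : ℝ := (x : ℝ) ^ ((1 + t) / 2) with hs
  have hsx : s ≤ x := by
    conv_rhs => rw [← Real.rpow_one (x : ℝ)]
    exact Real.rpow_le_rpow_of_exponent_le hx (by linarith)
  -- the prefactor
  have hyβ : (y : ℝ) ^ (t ^ 2) ≤ 2 * (x : ℝ) ^ t := by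
    refine (Real.rpow_le_rpow (by positivity) hy2 (by positivity)).trans ?_
    rw [Real.mul_rpow (by norm_num) (by positivity), ← Real.rpow_mul hx0.le,
      show t⁻¹ * t ^ 2 = t by field_simp]
    refine mul_le_mul_of_nonneg_right ?_ (by positivity)
    calc (2 : ℝ) ^ (t ^ 2) ≤ 2 ^ (1 : ℝ) :=
          Real.rpow_le_rpow_of_exponent_le (by norm_num) (by nlinarith)
      _ = 2 := Real.rpow_one _
  have hpre : 2 * d * (2 * (y : ℝ) + 1) ^ d / Real.exp (-(y : ℝ) ^ (t ^ 2)) ≤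
      Real.exp (4 * d * s) := by
    rw [Real.exp_neg, div_inv_eq_mul]
    have h1 := hC₁M y (by exact_mod_cast hy0)
    have hxt : (1 : ℝ) ≤ (x : ℝ) ^ t := Real.one_le_rpow hx ht.le
    calc 2 * d * (2 * (y : ℝ) + 1) ^ d * Real.exp ((y : ℝ) ^ (t ^ 2)) ≤
        2 * d * (C₁ * Real.exp ((y : ℝ) ^ (t ^ 2))) * Real.exp ((y : ℝ) ^ (t ^ 2)) := by
          gcongr
      _ = Real.exp (Real.log (2 * d * C₁) + 2 * (y : ℝ) ^ (t ^ 2)) := by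
          rw [two_mul ((y : ℝ) ^ (t ^ 2)), Real.exp_add, Real.exp_add, Real.exp_log (by positivity)]
          ring
      _ ≤ Real.exp (4 * d * s) := by
          refine Real.exp_le_exp.2 ?_
          have h3 : Real.log (2 * d * C₁) ≤ |Real.log (2 * d * C₁)| * (x : ℝ) ^ t :=
            (le_abs_self _).trans (le_mul_of_one_le_right (abs_nonneg _) hxt)
          have h4 : 0 ≤ s := by positivity
          nlinarith
  have hbase : 2 * d * (2 * (y : ℝ) + 1) ^ d / Real.exp (-(y : ℝ) ^ (t ^ 2)) *
      Real.exp (-(8 * d * (x + s))) ≤ Real.exp (-(8 * d * (x + s / 2))) := by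
    refine (mul_le_mul_of_nonneg_right hpre (Real.exp_nonneg _)).trans (le_of_eq ?_)
    rw [← Real.exp_add]
    congr 1
    ring
  refine ⟨by exact_mod_cast h2x.trans hy1, hbase.trans (Real.exp_le_one_iff.2 ?_), ?_, ?_⟩
  · have : 0 ≤ 8 * (d : ℝ) * (x + s / 2) := by positivity
    linarith
  · refine (pow_le_pow_left₀ (by positivity) hbase _).trans ?_
    rw [← Real.exp_nat_mul, Real.exp_le_exp]
    have hn := sub_one_sub_le_natCast_div_sub y (x + 2) (2 * J) (by omega)
    push_cast at hn
    set n : ℝ := ((y / (x + 2) - 2 * J : ℕ) : ℝ) with hn'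
    have hyσ : (y : ℝ) ^ ((1 + t) / 2) ≤ y * (x : ℝ) ^ (-(t⁻¹ * ((1 - t) / 2))) := by
      have e : (1 + t) / 2 = 1 + -((1 - t) / 2) := by ring
      rw [e, Real.rpow_add (by linarith), Real.rpow_one]
      refine mul_le_mul_of_nonneg_left ?_ (by linarith)
      rw [← mul_neg, Real.rpow_mul hx0.le]
      exact Real.rpow_le_rpow_of_nonpos (by positivity) hy1 (by linarith)
    have hsσ : s = x * (x : ℝ) ^ (-((1 - t) / 2)) := by
      have e : (1 + t) / 2 = 1 + -((1 - t) / 2) := by ring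
      rw [hs, e, Real.rpow_add hx0, Real.rpow_one]
    have h48' : 48 * (2 * (J : ℝ) + 1) * x ≤ y * (x : ℝ) ^ (-((1 - t) / 2)) := by
      rw [sub_eq_add_neg, Real.rpow_add hx0] at h48
      exact h48.trans (mul_le_mul_of_nonneg_right hy1 (by positivity))
    set w : ℝ := (x : ℝ) ^ (-((1 - t) / 2)) with hw
    have hwpos : 0 < w := Real.rpow_pos_of_pos hx0 _
    -- The reserve `s / 2` in the exponent, over about `y / x` shells, yields a surplus of at least
    -- `y w / 12`. Half of it pays for the new reserve `y ^ ((1 + t) / 2)`, the other half for the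
    -- `2 J` bad shells and the rounding in the number of shells.
    have h1 : y + (y : ℝ) ^ ((1 + t) / 2) ≤ (x + s / 2) * n := by
      have h3 : (x + s / 2) * ((y : ℝ) / (x + 2) - 1 - 2 * J) ≤ (x + s / 2) * n :=
        mul_le_mul_of_nonneg_left hn (by positivity)
      have h4 : y + s / 4 * (y / (3 * x)) ≤ (x + s / 2) * ((y : ℝ) / (x + 2)) := by
        have h5 : (x + 2 + s / 4) * ((y : ℝ) / (x + 2)) ≤ (x + s / 2) * ((y : ℝ) / (x + 2)) :=
          mul_le_mul_of_nonneg_right (by linarith) (by positivity)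
        have h6 : (x + 2 + s / 4) * ((y : ℝ) / (x + 2)) = y + s / 4 * (y / (x + 2)) := by
          field_simp
        have h7 : s / 4 * (y / (3 * x)) ≤ s / 4 * (y / (x + 2)) := by
          gcongr
          linarith
        linarith
      have h5 : s / 4 * (y / (3 * x)) = y * w / 12 := by
        rw [hsσ]
        field_simp
        norm_num
      have h6 : (x + s / 2) * (1 + 2 * (J : ℝ)) ≤ 2 * x * (1 + 2 * J) := by
        gcongr
        linarith
      have h7 := mul_le_mul_of_nonneg_left h24 (by linarith : (0 : ℝ) ≤ y)
      nlinarith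
    have h2 := mul_le_mul_of_nonneg_left h1 (by positivity : (0 : ℝ) ≤ 8 * d)
    linarith
  · have h1 := hC₂M x hx1
    rw [pow_one] at h1
    have h9 : (9 * (y : ℝ)) ^ (t ^ 4) ≤ 18 * (x : ℝ) ^ (t ^ 3) := by
      have h2 : 9 * (y : ℝ) ≤ 18 * (x : ℝ) ^ t⁻¹ := by linarith
      refine (Real.rpow_le_rpow (by positivity) h2 (by positivity)).trans ?_
      rw [Real.mul_rpow (by norm_num) (by positivity), ← Real.rpow_mul hx0.le,
        show t⁻¹ * t ^ 4 = t ^ 3 by field_simp]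
      refine mul_le_mul_of_nonneg_right ?_ (by positivity)
      calc (18 : ℝ) ^ (t ^ 4) ≤ 18 ^ (1 : ℝ) :=
            Real.rpow_le_rpow_of_exponent_le (by norm_num) (pow_le_one₀ ht.le ht1.le)
        _ = 18 := Real.rpow_one _
    have hxt : (1 : ℝ) ≤ (x : ℝ) ^ (t ^ 3) := Real.one_le_rpow hx (by positivity)
    rw [← Real.exp_add, ← one_div, le_div_iff₀ hx0]
    calc Real.exp (-(x : ℝ) ^ (t ^ 2) + C * (9 * (y : ℝ)) ^ (t ^ 4)) * x
        ≤ Real.exp (-(x : ℝ) ^ (t ^ 2) + C * (18 * (x : ℝ) ^ (t ^ 3))) *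
          (C₂ * Real.exp ((x : ℝ) ^ (t ^ 3))) := by
          gcongr
          linarith
      _ = Real.exp (-(x : ℝ) ^ (t ^ 2) + C * (18 * (x : ℝ) ^ (t ^ 3)) +
          (Real.log C₂ + (x : ℝ) ^ (t ^ 3))) := by
          rw [Real.exp_add _ (Real.log C₂ + _), Real.exp_add (Real.log C₂), Real.exp_log hC₂]
      _ ≤ 1 := by
          refine Real.exp_le_one_iff.2 ?_
          have h3 : Real.log C₂ ≤ |Real.log C₂| * (x : ℝ) ^ (t ^ 3) :=
            (le_abs_self _).trans (le_mul_of_one_le_right (abs_nonneg _) hxt)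
          rw [add_mul, add_mul, one_mul] at hI3
          linarith

/-- The first step of the multiscale analysis. -/
theorem eventually_initial_scale_step {d J : ℕ} (hd : 1 ≤ d) {t : ℝ} (ht : 0 < t) (ht1 : t < 1) :
    ∀ᶠ x : ℕ in atTop,
      2 * d * (2 * (x : ℝ) + 1) ^ d / Real.exp (-(x : ℝ) ^ (t ^ 2)) *
        (2 * d / Real.exp x) ≤ 1 ∧
      (2 * d * (2 * (x : ℝ) + 1) ^ d / Real.exp (-(x : ℝ) ^ (t ^ 2)) *
        (2 * d / Real.exp x)) ^ (x / (0 + 2) - 2 * J) ≤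
        Real.exp (-(8 * d * (x + (x : ℝ) ^ ((1 + t) / 2)))) := by
  have hd' : (1 : ℝ) ≤ d := by exact_mod_cast hd
  obtain ⟨C₁, hC₁, hC₁M⟩ := exists_pow_le_mul_exp_rpow d (b := t ^ 2) (by positivity)
  filter_upwards [eventually_ge_atTop 1, eventually_ge_atTop (2 * (2 * J + 1 + 32 * d)),
    eventually_mul_rpow_le (2 * (|Real.log (4 * d ^ 2 * C₁)| + 2)) (p := t ^ 2) (q := 1)
      (by nlinarith)] with x hx1 hxJ hI
  have hx : (1 : ℝ) ≤ x := by exact_mod_cast hx1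
  have hx0 : (0 : ℝ) < x := by linarith
  rw [Real.rpow_one] at hI
  have hxt : (1 : ℝ) ≤ (x : ℝ) ^ (t ^ 2) := Real.one_le_rpow hx (by positivity)
  have hbase : 2 * d * (2 * (x : ℝ) + 1) ^ d / Real.exp (-(x : ℝ) ^ (t ^ 2)) *
      (2 * d / Real.exp x) ≤ Real.exp (-(x / 2 : ℝ)) := by
    rw [Real.exp_neg, div_inv_eq_mul]
    calc 2 * d * (2 * (x : ℝ) + 1) ^ d * Real.exp ((x : ℝ) ^ (t ^ 2)) * (2 * d / Real.exp x) ≤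
        2 * d * (C₁ * Real.exp ((x : ℝ) ^ (t ^ 2))) * Real.exp ((x : ℝ) ^ (t ^ 2)) *
          (2 * d / Real.exp x) := by
          gcongr
          exact hC₁M x hx1
      _ = Real.exp (Real.log (4 * d ^ 2 * C₁) + 2 * (x : ℝ) ^ (t ^ 2) - x) := by
          rw [two_mul ((x : ℝ) ^ (t ^ 2)), Real.exp_sub, Real.exp_add, Real.exp_add,
            Real.exp_log (by positivity)]
          ring
      _ ≤ Real.exp (-(x / 2 : ℝ)) := by
          refine Real.exp_le_exp.2 ?_
          have h3 : Real.log (4 * d ^ 2 * C₁) ≤ |Real.log (4 * d ^ 2 * C₁)| * (x : ℝ) ^ (t ^ 2) :=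
            (le_abs_self _).trans (le_mul_of_one_le_right (abs_nonneg _) hxt)
          linarith
  refine ⟨hbase.trans (Real.exp_le_one_iff.2 (by linarith)),
    (pow_le_pow_left₀ (by positivity) hbase _).trans ?_⟩
  rw [← Real.exp_nat_mul, Real.exp_le_exp]
  have hn := sub_one_sub_le_natCast_div_sub x (0 + 2) (2 * J) (by omega)
  push_cast at hn
  rw [zero_add]
  set n : ℝ := ((x / 2 - 2 * J : ℕ) : ℝ) with hn'
  have hs : (x : ℝ) ^ ((1 + t) / 2) ≤ x := by
    conv_rhs => rw [← Real.rpow_one (x : ℝ)]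
    exact Real.rpow_le_rpow_of_exponent_le hx (by linarith)
  have hxJ' : 2 * (2 * (J : ℝ) + 1 + 32 * d) ≤ x := by exact_mod_cast hxJ
  have h1 : 32 * (d : ℝ) ≤ n := by linarith
  have h2 : x / 2 * (32 * (d : ℝ)) ≤ x / 2 * n := mul_le_mul_of_nonneg_left h1 (by positivity)
  nlinarith

/-- The length scales. -/
noncomputable def lengthScale (t : ℝ) (N : ℕ) : ℕ → ℕ
  | 0 => 0
  | k + 1 => (fun x : ℕ => ⌈(x : ℝ) ^ t⁻¹⌉₊)^[k] N

theorem lengthScale_add_two (t : ℝ) (N k : ℕ) :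
    lengthScale t N (k + 2) = ⌈(lengthScale t N (k + 1) : ℝ) ^ t⁻¹⌉₊ :=
  Function.iterate_succ_apply' _ _ _

/-- Scales for the multiscale analysis along which resonances are improbable. -/
theorem exists_scaleSeq {d : ℕ} (J : ℕ) (hd : 1 ≤ d) {b : ℝ} (hb : 0 < b) (hb1 : b < 1) {C : ℝ}
    (hC : 0 < C) {η : ℝ} (hη : 0 < η) :
    ∃ s : ScaleSeq d J, (∀ k, s.ε (k + 1) ≤ 1) ∧
      Summable (fun k => s.ε (k + 1) * Real.exp (C * (9 * (s.L (k + 2) : ℝ)) ^ b)) ∧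
      ∑' k, s.ε (k + 1) * Real.exp (C * (9 * (s.L (k + 2) : ℝ)) ^ b) ≤ η := by
  -- Scales grow by the power `t⁻¹` and thresholds are `exp (-L ^ (t ^ 2))`. Taking `t ^ 4 = b`
  -- places the exponent `t ^ 2` strictly between what the probabilities need, `b / t = t ^ 3`, and
  -- what the decay tolerates; this is where `b < 1` is used.
  set t : ℝ := b ^ (4 : ℝ)⁻¹ with ht
  have ht0 : 0 < t := Real.rpow_pos_of_pos hb _
  have ht1 : t < 1 := Real.rpow_lt_one hb.le hb1 (by norm_num)
  have htb : t ^ 4 = b := by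
    rw [ht, ← Real.rpow_natCast, ← Real.rpow_mul hb.le]
    norm_num
  obtain ⟨N₁, hN₁⟩ := eventually_atTop.1 (eventually_scale_step (J := J) hd ht0 ht1 C hC)
  obtain ⟨N₂, hN₂⟩ := eventually_atTop.1 (eventually_initial_scale_step (J := J) hd ht0 ht1)
  obtain ⟨N₃, hN₃⟩ := exists_nat_ge (2 / η)
  set N := max (max N₁ N₂) (max N₃ 1) with hN
  have hNN₁ : N₁ ≤ N := (le_max_left _ _).trans (le_max_left _ _)
  have hNN₂ : N₂ ≤ N := (le_max_right _ _).trans (le_max_left _ _)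
  have hNN₃ : N₃ ≤ N := (le_max_left _ _).trans (le_max_right _ _)
  have hN1 : 1 ≤ N := (le_max_right _ _).trans (le_max_right _ _)
  set L := lengthScale t N with hL
  have hL1 : L 1 = N := rfl
  have hge : ∀ k, 2 ^ k * N ≤ L (k + 1) := by
    intro k
    induction k with
    | zero => simp [hL1]
    | succ k ih =>
      have h1 : N ≤ L (k + 1) := le_trans (Nat.le_mul_of_pos_left N (by positivity)) ih
      rw [hL, lengthScale_add_two, ← hL]
      refine le_trans ?_ (hN₁ _ (hNN₁.trans h1)).1
      rw [pow_succ]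
      linarith
  have hgeN : ∀ k, N ≤ L (k + 1) := fun k =>
    le_trans (Nat.le_mul_of_pos_left N (by positivity)) (hge k)
  have hstep := fun k => hN₁ _ (hNN₁.trans (hgeN k))
  simp only [hL, ← lengthScale_add_two] at hstep
  simp only [← hL] at hstep
  let s : ScaleSeq d J :=
    { L := L
      -- The threshold at scale zero is large, not small: the single-site decay factor `2 d / ε 0`
      -- must already be exponentially small in the first length `N`. Such resonances become
      -- improbable only through a large coupling, chosen after `N`.
      ε := fun k => match k with
        | 0 => Real.exp N
        | k + 1 => Real.exp (-(L (k + 1) : ℝ) ^ (t ^ 2))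
      q := fun k => match k with
        | 0 => 2 * d / Real.exp N
        | k + 1 => Real.exp (-(8 * d * (L (k + 1) + (L (k + 1) : ℝ) ^ ((1 + t) / 2))))
      L_zero := rfl
      L_strictMono := by
        refine strictMono_nat_of_lt_succ fun k => ?_
        rcases k with _ | k
        · exact hN1
        · have h1 : 2 * L (k + 1) ≤ L (k + 1 + 1) := (hstep k).1
          have h2 := hgeN k
          omega
      ε_pos := fun k => by
        rcases k with _ | k <;> exact Real.exp_pos _
      q_zero := rfl
      q_nonneg := fun k => by
        rcases k with _ | k
        · exact div_nonneg (by positivity) (Real.exp_nonneg _)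
        · exact Real.exp_nonneg _
      step_le_one := fun k => by
        rcases k with _ | k
        · exact (hN₂ N hNN₂).1
        · exact (hstep k).2.1
      step_le := fun k => by
        rcases k with _ | k
        · exact (hN₂ N hNN₂).2
        · exact (hstep k).2.2.1
      q_le := fun k => by
        refine Real.exp_le_exp.2 (neg_le_neg (mul_le_mul_of_nonneg_left ?_ (by positivity)))
        exact le_add_of_nonneg_right (by positivity) }
  have hterm : ∀ k, s.ε (k + 1) * Real.exp (C * (9 * (s.L (k + 2) : ℝ)) ^ b) ≤
      (N : ℝ)⁻¹ * (1 / 2) ^ k := by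
    intro k
    have h1 := (hstep k).2.2.2
    rw [htb] at h1
    refine h1.trans ?_
    have h2 : (2 : ℝ) ^ k * N ≤ L (k + 1) := by exact_mod_cast hge k
    have hN0 : (0 : ℝ) < N := by exact_mod_cast hN1
    rw [one_div, inv_pow, ← mul_inv, mul_comm]
    exact inv_anti₀ (by positivity) h2
  have hpos : ∀ k, 0 ≤ s.ε (k + 1) * Real.exp (C * (9 * (s.L (k + 2) : ℝ)) ^ b) := fun k =>
    mul_nonneg (s.ε_pos _).le (Real.exp_nonneg _)
  have hgeom : HasSum (fun k : ℕ => (N : ℝ)⁻¹ * (1 / 2) ^ k) ((N : ℝ)⁻¹ * 2) :=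
    hasSum_geometric_two.mul_left _
  have hsum := Summable.of_nonneg_of_le hpos hterm hgeom.summable
  refine ⟨s, fun k => Real.exp_le_one_iff.2 (neg_nonpos.2 (by positivity)), hsum, ?_⟩
  refine (hsum.tsum_le_tsum hterm hgeom.summable).trans ?_
  rw [hgeom.tsum_eq]
  have h1 : 2 / η ≤ N := hN₃.trans (by exact_mod_cast hNN₃)
  rw [div_le_iff₀ hη] at h1
  have hN0 : (0 : ℝ) < N := by exact_mod_cast hN1
  rw [inv_mul_eq_div, div_le_iff₀ hN0]
  linarith

/-! ### Localisation -/

/-- Borel–Cantelli for resonances of pairs, at almost every point of the torus. -/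
theorem ae_eventually_noResonance {d ν : ℕ} {α : Matrix (Fin ν) (Fin d) ℝ} {Θ : Type*}
    [MeasurableSpace Θ] {P : Measure Θ} [IsProbabilityMeasure P]
    {v : Θ → C(UnitAddTorus (Fin ν), ℝ)} (hv : ∀ ω, Measurable fun θ => v θ ω) {g : ℝ}
    {M : ℕ → ℕ} {ε p : ℕ → ℝ} (hp : ∀ k, 0 ≤ p k) (hps : Summable p)
    (h : ∀ k ω, P {θ | ¬ NoResonance (qpPotential α (v θ) g ω) 1 (M k) (ε k) 0} ≤
      ENNReal.ofReal (p k)) :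
    ∀ᵐ θ ∂P, ∀ᵐ ω ∂(volume : Measure (UnitAddTorus (Fin ν))), ∀ x : Fin d → ℤ,
      ∀ᶠ k in atTop, NoResonance (qpPotential α (v θ) g ω) 1 (M k) (ε k) x := by
  refine Measure.ae_ae_of_ae_prod
    (p := fun z : Θ × UnitAddTorus (Fin ν) => ∀ x : Fin d → ℤ,
      ∀ᶠ k in atTop, NoResonance (qpPotential α (v z.1) g z.2) 1 (M k) (ε k) x)
    (ae_all_iff.2 fun x => ?_)
  have hle : ∀ k, (P.prod volume) {z : Θ × UnitAddTorus (Fin ν) |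
      ¬ NoResonance (qpPotential α (v z.1) g (orbit α z.2 x)) 1 (M k) (ε k) 0} ≤
      ENNReal.ofReal (p k) * volume (Set.univ : Set (UnitAddTorus (Fin ν))) := by
    intro k
    rw [Measure.prod_apply_symm (measurableSet_not_noResonance α hv g 1 (M k) (ε k) x),
      ← lintegral_const]
    exact lintegral_mono fun ω => h k (orbit α ω x)
  have hsum : ∑' k, (P.prod volume) {z : Θ × UnitAddTorus (Fin ν) |
      ¬ NoResonance (qpPotential α (v z.1) g (orbit α z.2 x)) 1 (M k) (ε k) 0} ≠ ∞ := by
    refine ne_top_of_le_ne_top ?_ (ENNReal.tsum_le_tsum hle)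
    rw [ENNReal.tsum_mul_right, ← ENNReal.ofReal_tsum_of_nonneg hp hps]
    exact ENNReal.mul_ne_top ENNReal.ofReal_ne_top (measure_ne_top _ _)
  filter_upwards [ae_eventually_notMem hsum] with z hz
  exact hz.mono fun k hk => noResonance_of_orbit (not_not.1 hk)

/-- For a large coupling, localisation holds with probability close to one. -/
theorem exists_localised_event {d ν : ℕ} (hd : 1 ≤ d) {α : Matrix (Fin ν) (Fin d) ℝ} {Θ : Type*}
    [MeasurableSpace Θ] {P : Measure Θ} [IsProbabilityMeasure P]
    {v : Θ → C(UnitAddTorus (Fin ν), ℝ)} (hv : ∀ ω, Measurable fun θ => v θ ω) {b : ℝ}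
    (hb : 0 < b) (hb1 : b < 1)
    (hfix : ∀ J : ℕ, ∃ C > 0, ∀ M : ℕ, 1 ≤ M → ∀ g > 0, ∀ ε > 0, ∀ ω,
      P {θ | ¬ NoResonance (qpPotential α (v θ) g ω) J M ε 0} ≤
        ENNReal.ofReal (C * (ε / g) ^ J * Real.exp (C * (M : ℝ) ^ b)))
    (hunif : ∃ J : ℕ, ∃ C > 0, ∀ M : ℕ, 1 ≤ M → ∀ g > 0, ∀ ε > 0, ε ≤ g → ∃ B : Set Θ,
      P B ≤ ENNReal.ofReal (C * (ε / g) * Real.exp (C * (M : ℝ) ^ b)) ∧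
      ∀ θ ∉ B, ∀ ω, NoResonance (qpPotential α (v θ) g ω) J M ε 0)
    {η : ℝ} (hη : 0 < η) :
    ∃ g₀ : ℝ, ∀ g ≥ g₀, ∃ G : Set Θ, MeasurableSet G ∧ P Gᶜ ≤ ENNReal.ofReal η ∧
      ∀ θ ∈ G, ∀ᵐ ω ∂(volume : Measure (UnitAddTorus (Fin ν))),
        HasPurePointSpectrum (schrodinger α (v θ) ω g) ∧
        EigenfunctionsDecay (schrodinger α (v θ) ω g) := by
  obtain ⟨C₁, hC₁, hC₁M⟩ := hfix 1
  obtain ⟨J, C₂, hC₂, hC₂M⟩ := hunif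
  set C : ℝ := max C₁ C₂ with hC
  have hCpos : 0 < C := hC₁.trans_le (le_max_left _ _)
  obtain ⟨s, hs1, hssum, hsle⟩ := exists_scaleSeq (d := d) J hd hb hb1 hCpos
    (η := η / (2 * C)) (by positivity)
  set M : ℕ → ℕ := fun k => 8 * s.L (k + 1) + s.L k with hM
  have hL1 : ∀ k, 1 ≤ s.L (k + 1) := fun k => by
    have := s.L_strictMono (Nat.succ_pos k)
    rw [s.L_zero] at this
    exact this
  have hM1 : ∀ k, 1 ≤ M k := fun k => by
    have := hL1 k
    simp only [hM]
    omega
  have hM9 : ∀ k, (M k : ℝ) ^ b ≤ (9 * (s.L (k + 1) : ℝ)) ^ b := fun k => by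
    refine Real.rpow_le_rpow (by positivity) ?_ hb.le
    have h1 := s.L_strictMono (Nat.lt_succ_self k)
    have h2 : M k ≤ 9 * s.L (k + 1) := by
      simp only [hM]
      have : s.L k ≤ s.L (k + 1) := h1.le
      omega
    exact_mod_cast h2
  set a : ℕ → ℝ := fun k => s.ε k * Real.exp (C * (9 * (s.L (k + 1) : ℝ)) ^ b) with ha
  have ha0 : ∀ k, 0 ≤ a k := fun k => mul_nonneg (s.ε_pos k).le (Real.exp_nonneg _)
  have hbound : ∀ {C'}, 0 < C' → C' ≤ C → ∀ g > 0, ∀ k,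
      C' * (s.ε k / g) * Real.exp (C' * (M k : ℝ) ^ b) ≤ C / g * a k := by
    intro C' hC' hCC g hg k
    have h1 : C' * (s.ε k / g) ≤ C * (s.ε k / g) :=
      mul_le_mul_of_nonneg_right hCC (div_nonneg (s.ε_pos k).le hg.le)
    have h2 : C' * (M k : ℝ) ^ b ≤ C * (9 * (s.L (k + 1) : ℝ)) ^ b :=
      mul_le_mul hCC (hM9 k) (by positivity) hCpos.le
    calc _ ≤ C * (s.ε k / g) * Real.exp (C * (9 * (s.L (k + 1) : ℝ)) ^ b) :=
          mul_le_mul h1 (Real.exp_le_exp.2 h2) (Real.exp_nonneg _)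
            (mul_nonneg hCpos.le (div_nonneg (s.ε_pos k).le hg.le))
      _ = _ := by rw [ha]; ring
  have hasum : Summable a := (summable_nat_add_iff 1).1 hssum
  -- The bound by 1 keeps the terms of scales `k ≥ 1`, summable to at most `η / (2 C)` by the choice
  -- of scales, from growing. The bound by `s.ε 0` ensures `ε k ≤ g` at every scale, as the uniform
  -- estimate requires. The last one brings the term of scale zero below `η / 2`.
  refine ⟨max (max 1 (s.ε 0)) (2 * C * a 0 / η), fun g hg => ?_⟩
  have hg1 : 1 ≤ g := ((le_max_left _ _).trans (le_max_left _ _)).trans hg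
  have hgε : s.ε 0 ≤ g := ((le_max_right _ _).trans (le_max_left _ _)).trans hg
  have hg0 : 2 * C * a 0 / η ≤ g := (le_max_right _ _).trans hg
  have hgpos : 0 < g := by linarith
  have hεg : ∀ k, s.ε k ≤ g := by
    rintro (_ | k)
    · exact hgε
    · exact (hs1 k).trans hg1
  choose B hB hBres using fun k => hC₂M (M k) (hM1 k) g hgpos (s.ε k) (s.ε_pos k) (hεg k)
  have hpair := ae_eventually_noResonance hv (α := α) (P := P) (g := g) (M := M) (ε := s.ε)
    (p := fun k => C / g * a k) (fun k => mul_nonneg (by positivity) (ha0 k)) (hasum.mul_left _)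
    (fun k ω => (hC₁M (M k) (hM1 k) g hgpos (s.ε k) (s.ε_pos k) ω).trans
      (ENNReal.ofReal_le_ofReal (by
        rw [pow_one]
        exact hbound hC₁ (le_max_left _ _) g hgpos k)))
  set N : Set Θ := {θ | ¬ ∀ᵐ ω ∂(volume : Measure (UnitAddTorus (Fin ν))), ∀ x : Fin d → ℤ,
      ∀ᶠ k in atTop, NoResonance (qpPotential α (v θ) g ω) 1 (M k) (s.ε k) x} with hN
  have hN0 : P N = 0 := ae_iff.1 hpair
  -- The exceptional set need not be measurable, so it is replaced by a measurable hull of the same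
  -- measure.
  refine ⟨(toMeasurable P ((⋃ k, B k) ∪ N))ᶜ, (measurableSet_toMeasurable _ _).compl, ?_, ?_⟩
  · rw [compl_compl, measure_toMeasurable]
    refine (measure_union_le _ _).trans ?_
    rw [hN0, add_zero]
    refine (measure_iUnion_le _).trans ((ENNReal.tsum_le_tsum fun k => (hB k).trans
      (ENNReal.ofReal_le_ofReal (hbound hC₂ (le_max_right _ _) g hgpos k))).trans ?_)
    rw [← ENNReal.ofReal_tsum_of_nonneg (fun k => mul_nonneg (by positivity) (ha0 k))
      (hasum.mul_left _)]
    refine ENNReal.ofReal_le_ofReal ?_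
    rw [tsum_mul_left, hasum.tsum_eq_zero_add, mul_add]
    have h1 : C / g * a 0 ≤ η / 2 := by
      rw [div_le_iff₀ hη] at hg0
      rw [div_mul_eq_mul_div, div_le_iff₀ hgpos]
      linarith
    have h2 : C / g * ∑' k, a (k + 1) ≤ η / 2 := by
      have h3 : C / g ≤ C := div_le_self hCpos.le hg1
      calc C / g * ∑' k, a (k + 1) ≤ C * (η / (2 * C)) :=
            mul_le_mul h3 hsle (tsum_nonneg fun k => ha0 _) hCpos.le
        _ = η / 2 := by field_simp
    linarith
  · intro θ hθ
    have hθ' : θ ∉ (⋃ k, B k) ∪ N := fun h => hθ (subset_toMeasurable _ _ h)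
    simp only [Set.mem_union, Set.mem_iUnion, not_or, not_exists, hN, Set.mem_ofPred_eq,
      not_not] at hθ'
    filter_upwards [hθ'.2] with ω hω
    refine localised_of_noResonance s hd α (v θ) ω g (fun k x => ?_) fun x => ?_
    · exact (noResonance_of_orbit (hBres k θ (hθ'.1 k) (orbit α ω x))).mono (by
        simp only [hM]
        omega)
    · obtain ⟨k₀, hk₀⟩ := eventually_atTop.1 (hω x)
      exact ⟨k₀, hk₀⟩

/-- Choice of the localisation events for all couplings. -/
theorem exists_event_family {Θ : Type*} [MeasurableSpace Θ] {P : Measure Θ} [IsProbabilityMeasure P]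
    {Q : ℝ → Θ → Prop}
    (h : ∀ η > 0, ∃ g₀ : ℝ, ∀ g ≥ g₀, ∃ G : Set Θ, MeasurableSet G ∧ P Gᶜ ≤ ENNReal.ofReal η ∧
      ∀ θ ∈ G, Q g θ) :
    ∃ G : ℝ → Set Θ, (∀ g, MeasurableSet (G g)) ∧ Tendsto (fun g => P (G g)) atTop (𝓝 1) ∧
      ∀ g, ∀ θ ∈ G g, Q g θ := by
  choose g₀ G hGm hGP hGQ using fun n : ℕ => h (1 / ((n : ℝ) + 1)) (by positivity)
  -- For each `g`, the event collects the events of all tolerances `1 / (n + 1)` whose coupling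
  -- threshold has been passed. One family thus serves every tolerance, and for small `g` it may be
  -- empty.
  refine ⟨fun g => ⋃ n, ⋃ hg : g ≥ g₀ n, G n g hg, fun g => MeasurableSet.iUnion fun n =>
    MeasurableSet.iUnion fun hg => hGm n g hg, ?_, fun g θ hθ => ?_⟩
  · refine tendsto_order.2 ⟨fun a ha => ?_, fun a ha =>
      Eventually.of_forall fun g => prob_le_one.trans_lt ha⟩
    have hatop : a ≠ ∞ := ne_top_of_lt ha
    have ha1 : a.toReal < 1 := by
      rw [← ENNReal.toReal_one]
      exact (ENNReal.toReal_lt_toReal hatop ENNReal.one_ne_top).2 ha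
    obtain ⟨n, hn⟩ := exists_nat_one_div_lt (sub_pos.2 ha1)
    filter_upwards [eventually_ge_atTop (g₀ n)] with g hg
    have h1 : G n g hg ⊆ ⋃ n, ⋃ hg : g ≥ g₀ n, G n g hg := fun θ hθ =>
      Set.mem_iUnion.2 ⟨n, Set.mem_iUnion.2 ⟨hg, hθ⟩⟩
    refine lt_of_lt_of_le ?_ (measure_mono h1)
    have h2 := prob_add_prob_compl (μ := P) (hGm n g hg)
    have h3 : P (G n g hg) + ENNReal.ofReal (1 / ((n : ℝ) + 1)) ≥ 1 := by
      rw [← h2]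
      exact add_le_add le_rfl (hGP n g hg)
    have h4 : a + ENNReal.ofReal (1 / ((n : ℝ) + 1)) < 1 := by
      rw [← ENNReal.ofReal_toReal hatop, ← ENNReal.ofReal_add ENNReal.toReal_nonneg (by positivity),
        ← ENNReal.ofReal_one, ENNReal.ofReal_lt_ofReal_iff one_pos]
      linarith
    exact lt_of_add_lt_add_right (h4.trans_le h3)
  · obtain ⟨n, hn⟩ := Set.mem_iUnion.1 hθ
    obtain ⟨hg, hθ⟩ := Set.mem_iUnion.1 hn
    exact hGQ n g hg θ hθ

end QPLoc
theorem theorem1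
    (d ν : ℕ) (hd : 1 ≤ d) (hν : 1 ≤ ν)
    -- the spectral weight, as a function of `k`, where `ℓ = 2π k`
    (W : (Fin ν → ℤ) → ℝ) (hWpos : ∀ k, 0 < W k)
    (c C δ ζ : ℝ) (hc : 0 < c) (hC : 0 < C) (hδ : 0 < δ) (hζ : 0 < ζ)
    (hWlower : ∀ k, c * ‖QPLoc.dualPoint k‖ ^ ((ν : ℝ) + δ) ≤ W k)
    (hWupper : ∀ k, W k ≤ C * Real.exp (C * ‖QPLoc.dualPoint k‖ ^ ζ))
    -- the frequency matrix
    (α : Matrix (Fin ν) (Fin d) ℝ) (A c' : ℝ) (hA : 0 < A) (hc' : 0 < c')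
    (hα : QPLoc.IsDiophantine α c' A)
    (hAζ : (A + 1) * ζ < 1)
    -- the Gaussian variables
    {Θ : Type*} [MeasurableSpace Θ] (P : Measure Θ) [IsProbabilityMeasure P]
    (γ h : (Fin ν → ℤ) → Θ → ℝ) (hγh : QPLoc.IsStdGaussianFamily P γ h) :
    -- the random series defines a process with continuous realisations
    (∃ v : Θ → C(UnitAddTorus (Fin ν), ℝ), QPLoc.IsContinuousVersion P W γ h v) ∧
    -- localisation
    ∀ v : Θ → C(UnitAddTorus (Fin ν), ℝ), QPLoc.IsContinuousVersion P W γ h v →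
      ∃ Θplus : ℝ → Set Θ,
        (∀ g, MeasurableSet (Θplus g)) ∧
        Tendsto (fun g => P (Θplus g)) atTop (𝓝 1) ∧
        ∀ g > 0, ∀ θ ∈ Θplus g, ∀ᵐ ω ∂(volume : Measure (UnitAddTorus (Fin ν))),
          QPLoc.HasPurePointSpectrum (QPLoc.schrodinger α (v θ) ω g) ∧
          QPLoc.EigenfunctionsDecay (QPLoc.schrodinger α (v θ) ω g) := by
  obtain ⟨Q, w, K, hW⟩ := QPLoc.exists_weightGrowth hWpos hc hδ hWlower
  refine ⟨QPLoc.exists_isContinuousVersion hW hγh, fun v hv => ?_⟩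
  have hb : 0 < (A + 1) * ζ := by positivity
  obtain ⟨K', hK', hvar⟩ := QPLoc.exists_exp_mul_sq_le_variance hd hν hWpos hW.summable hC hζ
    hWupper hA hc' hα hγh hv
  have hfix := QPLoc.exists_measure_not_noResonance_le hWpos hW.summable hγh hv hK' hb hvar
  have hunif := QPLoc.exists_noResonance_uniform (hv.exists_modulus hW hγh) hfix
  obtain ⟨G, hGm, hGP, hG⟩ := QPLoc.exists_event_family fun η hη =>
    QPLoc.exists_localised_event hd hv.measurable hb hAζ hfix hunif hη
  exact ⟨G, hGm, hGP, fun g _ => hG g⟩
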